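/- **Theorem.** Let $K$ be a commutative semiring that is a subsemiring of a skew field (in particular, $K$ may itself be a commutative skew field). Let $B(1),\dots,B(n)$ be weighted component types over $K$: $B(i)$ has a finite set of ports $P(i)$ (and a finite labelled transition system, in which every port occurs in at most one transition, with weights in $K$), let $B(i,j)$, $j\ge 1$, be disjoint copies of $B(i)$ with ports $p(j)$, $p\in P(i)$, let $pw\mathcal B$ be the set of these weighted components, and fix $r:[n]\to\mathbb N$. Then equivalence with respect to $r$ of two wFOEIL sentences over $pw\mathcal B$ and $K$ is decidable in doubly exponential time: there are a program and a polynomial $q$ such that, for all wFOEIL sentences $\psi_1,\psi_2$, the program, started on $(\psi_1,\psi_2)$, halts after at most $2^{2^{q(|\psi_1|_r+|\psi_2|_r)}}$ steps and answers correctly whether $\Vert\psi_1\Vert(r,w)=\Vert\psi_2\Vert(r,w)$ for all $w\in I^*$. *Letters.* $I$ is the set of interactions: nonempty sets of ports $p(j)$, $p\in P(i)$, $1\le j\le r(i)$, with at most one port of each copy $B(i,j)$. *Formulas.* There are countably many variables $x^{(i)}$ for each $i\in[n]$. PIL: $\phi::=\mathrm{true}\mid p(x^{(i)})\mid\neg\phi\mid\phi\vee\phi$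 (with $\neg\neg\phi$ identified with $\phi$). EPIL: $\zeta::=\phi\mid\zeta*\zeta$ and $\varphi::=\zeta\mid\neg\zeta\mid\varphi\vee\varphi\mid\varphi\wedge\varphi\mid\varphi*\varphi\mid\varphi \mathbin{\sqcup\!\sqcup} \varphi$. FOEIL: $\psi::=\varphi\mid x^{(i)}=y^{(i)}\mid\neg(x^{(i)}=y^{(i)})\mid\psi\vee\psi\mid\psi\wedge\psi\mid\psi*\psi\mid\psi\mathbin{\sqcup\!\sqcup} \psi\mid Qx^{(i)}.\psi$ with $Q\in\{\exists,\forall,\exists^*,\forall^*,\exists^{\sqcup\!\sqcup},\forall^{\sqcup\!\sqcup}\}$, where in the scope of $\exists^*$ and $\exists^{\sqcup\!\sqcup}$ negation occurs only in PIL formulas and in $\neg(x=y)$. wFOEIL: $\tilde\psi::=k\mid\psi\mid\tilde\psi\oplus\tilde\psi\mid\tilde\psi\otimes\tilde\psi\mid\tilde\psi\odot\tilde\psi\mid\tilde\psi\varpi\tilde\psi\mid Qx^{(i)}.\tilde\psi$ with $k\in K$ and $Q\in\{\sum,\prod,\sum^\odot,\prod^\odot,\sum^\varpi,\prod^\varpi\}$,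 where FOEIL formulas in the scope of $\sum^\odot$ and $\sum^\varpi$ obey the same restriction on negation. Sentences have no free variables. *Satisfaction.* Let $\sigma$ be an assignment of elements of $[r(i)]$ to variables of type $i$. A PIL formula is satisfied by a one-letter word $a$ in the Boolean sense, $p(x)$ meaning $p(\sigma(x))\in a$; longer words and the empty word satisfy, among PIL formulas, only the formula $\mathrm{true}$. A nonempty word satisfies EPIL formulas inductively: $\neg,\vee,\wedge$ are Boolean, $\varphi_1*\varphi_2$ (resp. $\varphi_1\mathbin{\sqcup\!\sqcup} \varphi_2$) asks for $w=w_1w_2$ (resp. $w\in w_1\mathbin{\sqcup\!\sqcup} w_2$, the set of interleavings) with $w_i$ satisfying $\varphi_i$; the empty word satisfies no EPIL formula except $\mathrm{true}$. In FOEIL (for all words) the connectives mean the same, equality atoms compare values of $\sigma$, $\exists x^{(i)},\forall x^{(i)}$ range over $j\in[r(i)]$, $\forall^*x^{(i)}.\psi$ asks for $w=w_1\cdots w_{r(i)}$ with $w_j$ satisfying $\psi$ under $\sigma[x^{(i)}\to j]$ for all $j$, $\exists^*x^{(i)}.\psi$ for $w=w_{l_1}\cdots w_{l_t}$ for some nonempty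 $\{l_1<\dots<l_t\}\subseteq[r(i)]$ with the same property for $j=l_1,\dots,l_t$, and $\forall^{\sqcup\!\sqcup},\exists^{\sqcup\!\sqcup}$ are the same with interleaving in place of concatenation. *Values.* $\Vert k\Vert=k$; a FOEIL formula has value $1$ where it is satisfied and $0$ elsewhere; $\oplus,\otimes,\odot,\varpi$ are the pointwise sum, pointwise product, Cauchy product and shuffle product of series, where in the shuffle product every way of distributing the letters of $w$ to two subwords $w_1,w_2$ contributes one summand $s(w_1)t(w_2)$; $\sum x^{(i)},\prod x^{(i)},\prod^\odot x^{(i)},\prod^\varpi x^{(i)}$ are the sum, pointwise, Cauchy and shuffle product of the series for $x^{(i)}\to j$, $j=1,\dots,r(i)$; $\sum^\odot x^{(i)}$ and $\sum^\varpi x^{(i)}$ are the sums, over all nonempty $J\subseteq[r(i)]$, of the Cauchy (shuffle) products over $j\in J$ in increasing order. *Size.* $|\psi|_r$ is the number of symbols of $\psi$ instantiated with respect to $r$, i.e. the scope of a quantifier over $x^{(i)}$ is counted $\max(1,r(i))$ times; elements of $K$ count as one symbol, and the variable with number $m$ counts additionally with the binary length of $m$. *Time.* Programs are first-order recursive programs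 on binary trees whose leaves are empty or elements of $K$; constructing and taking apart a tree, testing, calling a function, and $+$, $\cdot$, $0$, $1$ and the equality test in $K$ cost one step each. Sentences are given as syntax trees. -/

import Mathlib

universe u v

namespace WFOEIL

/-! ### Words, shuffle, series -/

section Words

variable {A : Type*}

/-- The shuffle `u ⧢ v = {u₁v₁⋯uₘvₘ | u = u₁⋯uₘ, v = v₁⋯vₘ}` of two words. -/
def shuffle (u v : List A) : Set (List A) :=
  {w | ∃ b : List (List A × List A),
    u = (b.map fun x => x.1).flatten ∧ v = (b.map fun x => x.2).flatten ∧
    w = (b.map fun x => x.1 ++ x.2).flatten}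

/-- The iterated shuffle `w₁ ⧢ ⋯ ⧢ wₘ` of a list of words (`{ε}` for the empty list). -/
def shuffleAll : List (List A) → Set (List A)
  | [] => {[]}
  | u :: us => {w | ∃ v ∈ shuffleAll us, w ∈ shuffle u v}

/-- All ways of distributing the letters of a word to two subwords, one entry for each of the
`2 ^ |w|` ways. -/
def unshuffles : List A → List (List A × List A)
  | [] => [([], [])]
  | a :: w => (unshuffles w).flatMap fun x => [(a :: x.1, x.2), (x.1, a :: x.2)]

theorem nil_mem_shuffle : ([] : List A) ∈ shuffle [] [] := ⟨[], rfl, rfl, rfl⟩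

theorem cons_left_mem_shuffle (a : A) {u v w : List A} (h : w ∈ shuffle u v) :
    a :: w ∈ shuffle (a :: u) v := by
  obtain ⟨b, rfl, rfl, rfl⟩ := h
  exact ⟨([a], []) :: b, by simp, by simp, by simp⟩

theorem cons_right_mem_shuffle (a : A) {u v w : List A} (h : w ∈ shuffle u v) :
    a :: w ∈ shuffle u (a :: v) := by
  obtain ⟨b, rfl, rfl, rfl⟩ := h
  exact ⟨([], [a]) :: b, by simp, by simp, by simp⟩

theorem unshuffles_append_left (x : List A) {u v w : List A} (h : (u, v) ∈ unshuffles w) :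
    (x ++ u, v) ∈ unshuffles (x ++ w) := by
  induction x with
  | nil => simpa using h
  | cons a x ih =>
    simp only [List.cons_append, unshuffles, List.mem_flatMap]
    exact ⟨_, ih, by simp⟩

theorem unshuffles_append_right (x : List A) {u v w : List A} (h : (u, v) ∈ unshuffles w) :
    (u, x ++ v) ∈ unshuffles (x ++ w) := by
  induction x with
  | nil => simpa using h
  | cons a x ih =>
    simp only [List.cons_append, unshuffles, List.mem_flatMap]
    exact ⟨_, ih, by simp⟩

/-- `unshuffles w` lists exactly the pairs `(u, v)` with `w ∈ u ⧢ v`. -/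
theorem mem_unshuffles_iff (w u v : List A) : (u, v) ∈ unshuffles w ↔ w ∈ shuffle u v := by
  constructor
  · intro h
    induction w generalizing u v with
    | nil =>
      simp only [unshuffles, List.mem_singleton, Prod.mk.injEq] at h
      obtain ⟨rfl, rfl⟩ := h
      exact nil_mem_shuffle
    | cons a w ih =>
      simp only [unshuffles, List.mem_flatMap] at h
      obtain ⟨⟨u', v'⟩, h', h⟩ := h
      simp only [List.mem_cons, Prod.mk.injEq, List.not_mem_nil, or_false] at h
      rcases h with ⟨rfl, rfl⟩ | ⟨rfl, rfl⟩
      · exact cons_left_mem_shuffle a (ih _ _ h')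
      · exact cons_right_mem_shuffle a (ih _ _ h')
  · rintro ⟨b, rfl, rfl, rfl⟩
    induction b with
    | nil => simp [unshuffles]
    | cons x b ih =>
      simp only [List.map_cons, List.flatten_cons, List.append_assoc]
      exact unshuffles_append_left _ (unshuffles_append_right _ ih)

variable {K : Type*} [CommSemiring K]

/-- The Cauchy product of two series. -/
def cauchy (s t : List A → K) (w : List A) : K :=
  ∑ k ∈ Finset.range (w.length + 1), s (w.take k) * t (w.drop k)

/-- The shuffle product of two series: every way of obtaining `w` as an interleaving of two words
contributes one summand. -/
def shuffleProd (s t : List A → K) (w : List A) : K :=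
  ((unshuffles w).map fun x => s x.1 * t x.2).sum

/-- The series with value `1` on the empty word and `0` elsewhere. -/
def unitSeries : List A → K
  | [] => 1
  | _ :: _ => 0

/-- `w ↦ ∑_{w = w₁⋯wₘ} s₁(w₁)⋯sₘ(wₘ)`. -/
def cauchyAll (l : List (List A → K)) : List A → K := l.foldr cauchy unitSeries

/-- `w ↦ ∑_{w ∈ w₁ ⧢ ⋯ ⧢ wₘ} s₁(w₁)⋯sₘ(wₘ)`, over all interleavings. -/
def shuffleProdAll (l : List (List A → K)) : List A → K := l.foldr shuffleProd unitSeries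

end Words

/-- The elements of `J ⊆ {1, …, m}` in increasing order. -/
def increasing {m : ℕ} (J : Finset (Fin m)) : List (Fin m) :=
  (List.finRange m).filter fun j => decide (j ∈ J)

/-! ### Components -/

/-- A labelled transition system in which every port occurs in at most one transition. -/
structure AtomicComponent where
  State : Type
  Port : Type
  [finState : Finite State]
  [finPort : Fintype Port]
  init : State
  trans : Set (State × Port × State)
  port_unique : ∀ t ∈ trans, ∀ t' ∈ trans, t.2.1 = t'.2.1 → t = t'

/-- A weighted atomic component over `K`. -/
structure WeightedComponent (K : Type u) extends AtomicComponent where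
  wt : trans → K

attribute [instance] AtomicComponent.finState AtomicComponent.finPort

section Logic

variable {n : ℕ}

/-- The ports of the types `B(1), …, B(n)`. As ports carry their type as a tag, the port sets of
different types are disjoint. -/
abbrev ports {K : Type u} (wB : Fin n → WeightedComponent K) (i : Fin n) : Type := (wB i).Port

variable (P : Fin n → Type)

/-- The ports `p(x)` with `p ∈ P(i)` and `x` a variable of type `i`; the variables of each type
are numbered by `ℕ`. -/
structure VarPort where
  type : Fin n
  port : P type
  var : ℕ

/-- The ports `p(j)` of the instances `B(i, j)`, `j ∈ [r(i)]`. -/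
structure InstPort (r : Fin n → ℕ) where
  type : Fin n
  port : P type
  inst : Fin (r type)

/-- The interactions of the instantiation with respect to `r`: nonempty sets of ports that contain
at most one port of each instance. -/
def Interaction (r : Fin n → ℕ) : Type :=
  {a : Set (InstPort P r) // a.Nonempty ∧
    ∀ (i : Fin n) (j : Fin (r i)) (p q : P i), ⟨i, p, j⟩ ∈ a → ⟨i, q, j⟩ ∈ a → p = q}

/-! ### Syntax -/

/-- PIL formulas over the ports `α`. -/
inductive PIL (α : Type)
  | tru
  | port (a : α)
  | neg (φ : PIL α)
  | or (φ₁ φ₂ : PIL α)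

/-- The formulas `ζ ::= φ | ζ * ζ`. -/
inductive Zeta (α : Type)
  | pil (φ : PIL α)
  | conc (ζ₁ ζ₂ : Zeta α)

/-- EPIL formulas over the ports `α`. -/
inductive EPIL (α : Type)
  | zeta (ζ : Zeta α)
  | neg (ζ : Zeta α)
  | or (φ₁ φ₂ : EPIL α)
  | and (φ₁ φ₂ : EPIL α)
  | conc (φ₁ φ₂ : EPIL α)
  | shuf (φ₁ φ₂ : EPIL α)

/-- FOEIL formulas (before the restriction on negation). The variable number `x` of type `i` is
given by the pair `i x`. -/
inductive Formula
  | epil (φ : EPIL (VarPort P))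
  | eq (i : Fin n) (x y : ℕ)
  | neq (i : Fin n) (x y : ℕ)
  | or (ψ₁ ψ₂ : Formula)
  | and (ψ₁ ψ₂ : Formula)
  | conc (ψ₁ ψ₂ : Formula)
  | shuf (ψ₁ ψ₂ : Formula)
  | ex (i : Fin n) (x : ℕ) (ψ : Formula)
  | all (i : Fin n) (x : ℕ) (ψ : Formula)
  | exConc (i : Fin n) (x : ℕ) (ψ : Formula)
  | allConc (i : Fin n) (x : ℕ) (ψ : Formula)
  | exShuf (i : Fin n) (x : ℕ) (ψ : Formula)
  | allShuf (i : Fin n) (x : ℕ) (ψ : Formula)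

/-- wFOEIL formulas (before the restriction on negation). -/
inductive WFormula (K : Type u) : Type u
  | const (k : K)
  | formula (ψ : Formula P)
  | plus (ψ₁ ψ₂ : WFormula K)
  | times (ψ₁ ψ₂ : WFormula K)
  | conc (ψ₁ ψ₂ : WFormula K)
  | shuf (ψ₁ ψ₂ : WFormula K)
  | sum (i : Fin n) (x : ℕ) (ψ : WFormula K)
  | prod (i : Fin n) (x : ℕ) (ψ : WFormula K)
  | sumConc (i : Fin n) (x : ℕ) (ψ : WFormula K)
  | prodConc (i : Fin n) (x : ℕ) (ψ : WFormula K)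
  | sumShuf (i : Fin n) (x : ℕ) (ψ : WFormula K)
  | prodShuf (i : Fin n) (x : ℕ) (ψ : WFormula K)

/-! ### Restricted negation -/

/-- Negation occurs only inside PIL formulas. -/
def EPIL.NegFree {α : Type} : EPIL α → Prop
  | .zeta _ => True
  | .neg _ => False
  | .or φ₁ φ₂ | .and φ₁ φ₂ | .conc φ₁ φ₂ | .shuf φ₁ φ₂ => φ₁.NegFree ∧ φ₂.NegFree

variable {P}

/-- Negation occurs only inside PIL formulas and in formulas `¬(x = y)`. -/
def Formula.NegFree : Formula P → Prop
  | .epil φ => φ.NegFree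
  | .eq .. | .neq .. => True
  | .or ψ₁ ψ₂ | .and ψ₁ ψ₂ | .conc ψ₁ ψ₂ | .shuf ψ₁ ψ₂ => ψ₁.NegFree ∧ ψ₂.NegFree
  | .ex _ _ ψ | .all _ _ ψ | .exConc _ _ ψ | .allConc _ _ ψ | .exShuf _ _ ψ | .allShuf _ _ ψ =>
    ψ.NegFree

/-- The restriction on negation that FOEIL formulas have to obey. -/
def Formula.WellFormed : Formula P → Prop
  | .epil _ | .eq .. | .neq .. => True
  | .or ψ₁ ψ₂ | .and ψ₁ ψ₂ | .conc ψ₁ ψ₂ | .shuf ψ₁ ψ₂ => ψ₁.WellFormed ∧ ψ₂.WellFormed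
  | .ex _ _ ψ | .all _ _ ψ | .allConc _ _ ψ | .allShuf _ _ ψ => ψ.WellFormed
  | .exConc _ _ ψ | .exShuf _ _ ψ => ψ.NegFree ∧ ψ.WellFormed

/-- All FOEIL formulas that occur satisfy `Formula.NegFree`. -/
def WFormula.NegFree {K : Type u} : WFormula P K → Prop
  | .const _ => True
  | .formula ψ => ψ.NegFree
  | .plus ψ₁ ψ₂ | .times ψ₁ ψ₂ | .conc ψ₁ ψ₂ | .shuf ψ₁ ψ₂ => ψ₁.NegFree ∧ ψ₂.NegFree
  | .sum _ _ ψ | .prod _ _ ψ | .sumConc _ _ ψ | .prodConc _ _ ψ | .sumShuf _ _ ψ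
  | .prodShuf _ _ ψ => ψ.NegFree

/-- The restriction on negation that wFOEIL formulas have to obey. -/
def WFormula.WellFormed {K : Type u} : WFormula P K → Prop
  | .const _ => True
  | .formula ψ => ψ.WellFormed
  | .plus ψ₁ ψ₂ | .times ψ₁ ψ₂ | .conc ψ₁ ψ₂ | .shuf ψ₁ ψ₂ => ψ₁.WellFormed ∧ ψ₂.WellFormed
  | .sum _ _ ψ | .prod _ _ ψ | .prodConc _ _ ψ | .prodShuf _ _ ψ => ψ.WellFormed
  | .sumConc _ _ ψ | .sumShuf _ _ ψ => ψ.NegFree ∧ ψ.WellFormed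

/-! ### Free variables -/

/-- The ports that occur in a PIL formula. -/
def PIL.occ {α : Type} : PIL α → Set α
  | .tru => ∅
  | .port a => {a}
  | .neg φ => φ.occ
  | .or φ₁ φ₂ => φ₁.occ ∪ φ₂.occ

def Zeta.occ {α : Type} : Zeta α → Set α
  | .pil φ => φ.occ
  | .conc ζ₁ ζ₂ => ζ₁.occ ∪ ζ₂.occ

def EPIL.occ {α : Type} : EPIL α → Set α
  | .zeta ζ | .neg ζ => ζ.occ
  | .or φ₁ φ₂ | .and φ₁ φ₂ | .conc φ₁ φ₂ | .shuf φ₁ φ₂ => φ₁.occ ∪ φ₂.occ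

def Formula.free : Formula P → Set (Fin n × ℕ)
  | .epil φ => (fun q => (q.type, q.var)) '' φ.occ
  | .eq i x y | .neq i x y => {(i, x), (i, y)}
  | .or ψ₁ ψ₂ | .and ψ₁ ψ₂ | .conc ψ₁ ψ₂ | .shuf ψ₁ ψ₂ => ψ₁.free ∪ ψ₂.free
  | .ex i x ψ | .all i x ψ | .exConc i x ψ | .allConc i x ψ | .exShuf i x ψ | .allShuf i x ψ =>
    ψ.free \ {(i, x)}

def WFormula.free {K : Type u} : WFormula P K → Set (Fin n × ℕ)
  | .const _ => ∅
  | .formula ψ => ψ.free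
  | .plus ψ₁ ψ₂ | .times ψ₁ ψ₂ | .conc ψ₁ ψ₂ | .shuf ψ₁ ψ₂ => ψ₁.free ∪ ψ₂.free
  | .sum i x ψ | .prod i x ψ | .sumConc i x ψ | .prodConc i x ψ | .sumShuf i x ψ
  | .prodShuf i x ψ => ψ.free \ {(i, x)}

variable (P) in
/-- wFOEIL sentences. -/
def Sentence (K : Type u) : Type u := {ψ : WFormula P K // ψ.WellFormed ∧ ψ.free = ∅}

/-! ### Semantics of PIL and EPIL

The relation `act a p` says that the port `p` is active in the letter `a`. -/

section Sat

variable {α A : Type} (act : A → α → Prop)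

def PIL.Sat (a : A) : PIL α → Prop
  | .tru => True
  | .port p => act a p
  | .neg φ => ¬ φ.Sat a
  | .or φ₁ φ₂ => φ₁.Sat a ∨ φ₂.Sat a

/-- `φ` is the formula `true`, where `¬¬φ` is identified with `φ`. -/
def PIL.IsTrue : PIL α → Prop
  | .tru => True
  | .neg (.neg φ) => φ.IsTrue
  | _ => False

/-- The formula `true` is satisfied by every word, every other PIL formula only by letters. The
empty word satisfies no EPIL formula but `true`; this is the meaning of `w ≠ []` below. -/
def Zeta.Sat : Zeta α → List A → Prop
  | .pil φ, w => φ.IsTrue ∨ ∃ a, w = [a] ∧ φ.Sat act a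
  | .conc ζ₁ ζ₂, w => w ≠ [] ∧ ∃ w₁ w₂, w = w₁ ++ w₂ ∧ ζ₁.Sat w₁ ∧ ζ₂.Sat w₂

def EPIL.Sat : EPIL α → List A → Prop
  | .zeta ζ, w => ζ.Sat act w
  | .neg ζ, w => w ≠ [] ∧ ¬ ζ.Sat act w
  | .or φ₁ φ₂, w => w ≠ [] ∧ (φ₁.Sat w ∨ φ₂.Sat w)
  | .and φ₁ φ₂, w => w ≠ [] ∧ (φ₁.Sat w ∧ φ₂.Sat w)
  | .conc φ₁ φ₂, w => w ≠ [] ∧ ∃ w₁ w₂, w = w₁ ++ w₂ ∧ φ₁.Sat w₁ ∧ φ₂.Sat w₂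
  | .shuf φ₁ φ₂, w => w ≠ [] ∧ ∃ w₁ w₂, w ∈ shuffle w₁ w₂ ∧ φ₁.Sat w₁ ∧ φ₂.Sat w₂

end Sat

/-! ### Semantics of FOEIL and wFOEIL -/

/-- Assignments; `σ i x = none` if the variable `x` of type `i` is not in the domain. -/
def Assignment (r : Fin n → ℕ) : Type := (i : Fin n) → ℕ → Option (Fin (r i))

/-- The assignment with empty domain. -/
def Assignment.empty (r : Fin n → ℕ) : Assignment r := fun _ _ => none

/-- `σ[x ↦ j]`, where `x` is a variable of type `i`. -/
def Assignment.update {r : Fin n → ℕ} (σ : Assignment r) (i : Fin n) (x : ℕ) (j : Fin (r i)) :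
    Assignment r :=
  Function.update σ i (Function.update (σ i) x (some j))

/-- `p(σ(x))` is active in the interaction `a`. -/
def active {r : Fin n → ℕ} (σ : Assignment r) (a : Interaction P r) (q : VarPort P) : Prop :=
  ∃ j, σ q.type q.var = some j ∧ ⟨q.type, q.port, j⟩ ∈ a.1

/-- `(r, σ, w) ⊨ ψ`. In the first case this is `w ⊨ σ(φ)`. -/
def Formula.Sat {r : Fin n → ℕ} : Formula P → Assignment r → List (Interaction P r) → Prop
  | .epil φ, σ, w => φ.Sat (active σ) w
  | .eq i x y, σ, _ => σ i x = σ i y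
  | .neq i x y, σ, _ => σ i x ≠ σ i y
  | .or ψ₁ ψ₂, σ, w => ψ₁.Sat σ w ∨ ψ₂.Sat σ w
  | .and ψ₁ ψ₂, σ, w => ψ₁.Sat σ w ∧ ψ₂.Sat σ w
  | .conc ψ₁ ψ₂, σ, w => ∃ w₁ w₂, w = w₁ ++ w₂ ∧ ψ₁.Sat σ w₁ ∧ ψ₂.Sat σ w₂
  | .shuf ψ₁ ψ₂, σ, w => ∃ w₁ w₂, w ∈ shuffle w₁ w₂ ∧ ψ₁.Sat σ w₁ ∧ ψ₂.Sat σ w₂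
  | .ex i x ψ, σ, w => ∃ j, ψ.Sat (σ.update i x j) w
  | .all i x ψ, σ, w => ∀ j, ψ.Sat (σ.update i x j) w
  | .exConc i x ψ, σ, w => ∃ J : Finset (Fin (r i)), J.Nonempty ∧
      ∃ u : Fin (r i) → List (Interaction P r),
        w = ((increasing J).map u).flatten ∧ ∀ j ∈ J, ψ.Sat (σ.update i x j) (u j)
  | .allConc i x ψ, σ, w => ∃ u : Fin (r i) → List (Interaction P r),
        w = ((List.finRange (r i)).map u).flatten ∧ ∀ j, ψ.Sat (σ.update i x j) (u j)
  | .exShuf i x ψ, σ, w => ∃ J : Finset (Fin (r i)), J.Nonempty ∧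
      ∃ u : Fin (r i) → List (Interaction P r),
        w ∈ shuffleAll ((increasing J).map u) ∧ ∀ j ∈ J, ψ.Sat (σ.update i x j) (u j)
  | .allShuf i x ψ, σ, w => ∃ u : Fin (r i) → List (Interaction P r),
        w ∈ shuffleAll ((List.finRange (r i)).map u) ∧ ∀ j, ψ.Sat (σ.update i x j) (u j)

open Classical in
/-- The value `‖ψ‖(r, σ, w)`. -/
noncomputable def WFormula.value {K : Type u} [CommSemiring K] {r : Fin n → ℕ} :
    WFormula P K → Assignment r → List (Interaction P r) → K
  | .const k, _, _ => k
  | .formula ψ, σ, w => if ψ.Sat σ w then 1 else 0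
  | .plus ψ₁ ψ₂, σ, w => ψ₁.value σ w + ψ₂.value σ w
  | .times ψ₁ ψ₂, σ, w => ψ₁.value σ w * ψ₂.value σ w
  | .conc ψ₁ ψ₂, σ, w => cauchy (ψ₁.value σ) (ψ₂.value σ) w
  | .shuf ψ₁ ψ₂, σ, w => shuffleProd (ψ₁.value σ) (ψ₂.value σ) w
  | .sum i x ψ, σ, w => ∑ j, ψ.value (σ.update i x j) w
  | .prod i x ψ, σ, w => ∏ j, ψ.value (σ.update i x j) w
  | .sumConc i x ψ, σ, w => ∑ J : Finset (Fin (r i)) with J.Nonempty,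
      cauchyAll ((increasing J).map fun j => ψ.value (σ.update i x j)) w
  | .prodConc i x ψ, σ, w =>
      cauchyAll ((List.finRange (r i)).map fun j => ψ.value (σ.update i x j)) w
  | .sumShuf i x ψ, σ, w => ∑ J : Finset (Fin (r i)) with J.Nonempty,
      shuffleProdAll ((increasing J).map fun j => ψ.value (σ.update i x j)) w
  | .prodShuf i x ψ, σ, w =>
      shuffleProdAll ((List.finRange (r i)).map fun j => ψ.value (σ.update i x j)) w

/-- Equivalence of two sentences with respect to `r`. -/
def Sentence.Equivalent {K : Type u} [CommSemiring K] (r : Fin n → ℕ) (ψ₁ ψ₂ : Sentence P K) :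
    Prop :=
  ∀ w : List (Interaction P r),
    ψ₁.1.value (Assignment.empty r) w = ψ₂.1.value (Assignment.empty r) w

/-! ### Size

The size of a formula with respect to `r` is the number of symbols of its instantiation: the scope
of a quantifier over a variable of type `i` counts `r(i)` times (once if `r(i) = 0`). A variable
counts with the number of binary digits of its number, and an element of `K` as one symbol. -/

def PIL.size : PIL (VarPort P) → ℕ
  | .tru => 1
  | .port q => 1 + Nat.size q.var
  | .neg φ => 1 + φ.size
  | .or φ₁ φ₂ => 1 + φ₁.size + φ₂.size

def Zeta.size : Zeta (VarPort P) → ℕ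
  | .pil φ => φ.size
  | .conc ζ₁ ζ₂ => 1 + ζ₁.size + ζ₂.size

def EPIL.size : EPIL (VarPort P) → ℕ
  | .zeta ζ => ζ.size
  | .neg ζ => 1 + ζ.size
  | .or φ₁ φ₂ | .and φ₁ φ₂ | .conc φ₁ φ₂ | .shuf φ₁ φ₂ => 1 + φ₁.size + φ₂.size

def Formula.size (r : Fin n → ℕ) : Formula P → ℕ
  | .epil φ => φ.size
  | .eq _ x y | .neq _ x y => 1 + Nat.size x + Nat.size y
  | .or ψ₁ ψ₂ | .and ψ₁ ψ₂ | .conc ψ₁ ψ₂ | .shuf ψ₁ ψ₂ => 1 + ψ₁.size r + ψ₂.size r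
  | .ex i x ψ | .all i x ψ | .exConc i x ψ | .allConc i x ψ | .exShuf i x ψ | .allShuf i x ψ =>
    1 + Nat.size x + max 1 (r i) * ψ.size r

def WFormula.size {K : Type u} (r : Fin n → ℕ) : WFormula P K → ℕ
  | .const _ => 1
  | .formula ψ => ψ.size r
  | .plus ψ₁ ψ₂ | .times ψ₁ ψ₂ | .conc ψ₁ ψ₂ | .shuf ψ₁ ψ₂ => 1 + ψ₁.size r + ψ₂.size r
  | .sum i x ψ | .prod i x ψ | .sumConc i x ψ | .prodConc i x ψ | .sumShuf i x ψ
  | .prodShuf i x ψ => 1 + Nat.size x + max 1 (r i) * ψ.size r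

end Logic

/-! ### Computation over a semiring

Programs are pure first-order LISP programs. Their data are binary trees whose leaves are `nil` or
elements of `K`, and the only operations on `K` are addition, multiplication, the constants
`0` and `1`, and the equality test. Every evaluated node of an expression costs one step. -/

section Machine

/-- Binary trees with leaves `nil` or elements of `K`. -/
inductive Val (K : Type u) : Type u
  | nil
  | atom (k : K)
  | cons (a b : Val K)

variable {K : Type u}

/-- First component (`nil` if there is none). -/
def Val.fst : Val K → Val K
  | .cons a _ => a
  | _ => .nil

/-- Second component (`nil` if there is none). -/
def Val.snd : Val K → Val K
  | .cons _ b => b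
  | _ => .nil

open Classical in
/-- The truth value of `p`; false is `nil`. -/
noncomputable def Val.ofProp (p : Prop) : Val K := if p then .cons .nil .nil else .nil

def Val.IsPair : Val K → Prop
  | .cons _ _ => True
  | _ => False

/-- Both values are elements of `K`, and they are equal. -/
def Val.AtomEq : Val K → Val K → Prop
  | .atom a, .atom b => a = b
  | _, _ => False

def Val.add [CommSemiring K] : Val K → Val K → Val K
  | .atom a, .atom b => .atom (a + b)
  | _, _ => .nil

def Val.mul [CommSemiring K] : Val K → Val K → Val K
  | .atom a, .atom b => .atom (a * b)
  | _, _ => .nil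

/-- Expressions of the programming language. `var k` is the `k`-th entry of the environment,
`letIn e f` evaluates `f` after the value of `e` has been put in front of the environment, and
`call g e` applies the function number `g` of the program to the value of `e`. -/
inductive Expr : Type
  | var (k : ℕ)
  | nil
  | zero
  | one
  | cons (e f : Expr)
  | fst (e : Expr)
  | snd (e : Expr)
  | isPair (e : Expr)
  | add (e f : Expr)
  | mul (e f : Expr)
  | atomEq (e f : Expr)
  | ite (c e f : Expr)
  | letIn (e f : Expr)
  | call (g : ℕ) (e : Expr)

/-- A program: the bodies of finitely many mutually recursive functions of one argument, and a
main expression. -/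
structure Program where
  body : List Expr
  main : Expr

/-- `Eval F ρ e v t`: with the function bodies `F` and in the environment `ρ`, the expression `e`
evaluates to `v` in `t` steps. -/
inductive Eval [CommSemiring K] (F : List Expr) : List (Val K) → Expr → Val K → ℕ → Prop
  | var {ρ k v} : ρ[k]? = some v → Eval F ρ (.var k) v 1
  | nil {ρ} : Eval F ρ .nil .nil 1
  | zero {ρ} : Eval F ρ .zero (.atom 0) 1
  | one {ρ} : Eval F ρ .one (.atom 1) 1
  | cons {ρ e f a b s t} : Eval F ρ e a s → Eval F ρ f b t →
      Eval F ρ (.cons e f) (.cons a b) (s + t + 1)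
  | fst {ρ e a t} : Eval F ρ e a t → Eval F ρ (.fst e) a.fst (t + 1)
  | snd {ρ e a t} : Eval F ρ e a t → Eval F ρ (.snd e) a.snd (t + 1)
  | isPair {ρ e a t} : Eval F ρ e a t → Eval F ρ (.isPair e) (Val.ofProp a.IsPair) (t + 1)
  | add {ρ e f a b s t} : Eval F ρ e a s → Eval F ρ f b t →
      Eval F ρ (.add e f) (a.add b) (s + t + 1)
  | mul {ρ e f a b s t} : Eval F ρ e a s → Eval F ρ f b t →
      Eval F ρ (.mul e f) (a.mul b) (s + t + 1)
  | atomEq {ρ e f a b s t} : Eval F ρ e a s → Eval F ρ f b t →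
      Eval F ρ (.atomEq e f) (Val.ofProp (a.AtomEq b)) (s + t + 1)
  | ite_true {ρ c e f a b s t} : Eval F ρ c a s → a ≠ .nil → Eval F ρ e b t →
      Eval F ρ (.ite c e f) b (s + t + 1)
  | ite_false {ρ c e f b s t} : Eval F ρ c .nil s → Eval F ρ f b t →
      Eval F ρ (.ite c e f) b (s + t + 1)
  | letIn {ρ e f a b s t} : Eval F ρ e a s → Eval F (a :: ρ) f b t →
      Eval F ρ (.letIn e f) b (s + t + 1)
  | call {ρ g e d a b s t} : Eval F ρ e a s → F[g]? = some d → Eval F [a] d b t →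
      Eval F ρ (.call g e) b (s + t + 1)

/-- The value and the number of steps of an evaluation are unique. -/
theorem Eval.unique [CommSemiring K] {F : List Expr} {ρ : List (Val K)} {e : Expr} {v v' : Val K}
    {t t' : ℕ} (h : Eval F ρ e v t) (h' : Eval F ρ e v' t') : v = v' ∧ t = t' := by
  induction h generalizing v' t' with
  | var h => cases h' with | var h₂ => simp_all
  | nil => cases h'; simp
  | zero => cases h'; simp
  | one => cases h'; simp
  | cons _ _ ih₁ ih₂ =>
    cases h' with | cons h₁ h₂ =>
    obtain ⟨rfl, rfl⟩ := ih₁ h₁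
    obtain ⟨rfl, rfl⟩ := ih₂ h₂
    simp
  | add _ _ ih₁ ih₂ =>
    cases h' with | add h₁ h₂ =>
    obtain ⟨rfl, rfl⟩ := ih₁ h₁
    obtain ⟨rfl, rfl⟩ := ih₂ h₂
    simp
  | mul _ _ ih₁ ih₂ =>
    cases h' with | mul h₁ h₂ =>
    obtain ⟨rfl, rfl⟩ := ih₁ h₁
    obtain ⟨rfl, rfl⟩ := ih₂ h₂
    simp
  | atomEq _ _ ih₁ ih₂ =>
    cases h' with | atomEq h₁ h₂ =>
    obtain ⟨rfl, rfl⟩ := ih₁ h₁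
    obtain ⟨rfl, rfl⟩ := ih₂ h₂
    simp
  | fst _ ih =>
    cases h' with | fst h₁ =>
    obtain ⟨rfl, rfl⟩ := ih h₁
    simp
  | snd _ ih =>
    cases h' with | snd h₁ =>
    obtain ⟨rfl, rfl⟩ := ih h₁
    simp
  | isPair _ ih =>
    cases h' with | isPair h₁ =>
    obtain ⟨rfl, rfl⟩ := ih h₁
    simp
  | ite_true _ hn _ ih₁ ih₂ =>
    cases h' with
    | ite_true h₁ _ h₂ =>
      obtain ⟨rfl, rfl⟩ := ih₁ h₁
      obtain ⟨rfl, rfl⟩ := ih₂ h₂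
      simp
    | ite_false h₁ h₂ => exact absurd (ih₁ h₁).1 hn
  | ite_false _ _ ih₁ ih₂ =>
    cases h' with
    | ite_true h₁ hn h₂ => exact absurd (ih₁ h₁).1.symm hn
    | ite_false h₁ h₂ =>
      obtain ⟨-, rfl⟩ := ih₁ h₁
      obtain ⟨rfl, rfl⟩ := ih₂ h₂
      simp
  | letIn _ _ ih₁ ih₂ =>
    cases h' with | letIn h₁ h₂ =>
    obtain ⟨rfl, rfl⟩ := ih₁ h₁
    obtain ⟨rfl, rfl⟩ := ih₂ h₂
    simp
  | call _ hF _ ih₁ ih₂ =>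
    cases h' with | call h₁ hF' h₂ =>
    obtain ⟨rfl, rfl⟩ := ih₁ h₁
    rw [hF] at hF'
    cases hF'
    obtain ⟨rfl, rfl⟩ := ih₂ h₂
    simp

/-- The program halts on the input `x` after `t` steps with the result `v`. -/
def Program.Runs [CommSemiring K] (M : Program) (x v : Val K) (t : ℕ) : Prop :=
  Eval M.body [x] M.main v t

/-- The set `{x | S x}` is decided by one program that halts on the code of every `x` within
`2 ^ 2 ^ p(|x|)` steps, for a polynomial `p`. -/
def DecidableInDoublyExpTime [CommSemiring K] {I : Type*} (code : I → Val K) (size : I → ℕ)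
    (S : I → Prop) : Prop :=
  ∃ (M : Program) (p : Polynomial ℕ), ∀ x : I, ∃ t : ℕ,
    t ≤ 2 ^ 2 ^ p.eval (size x) ∧ M.Runs (code x) (Val.ofProp (S x)) t

/-! ### Codes of formulas -/

/-- The list of the given values. -/
def Val.list : List (Val K) → Val K
  | [] => .nil
  | a :: l => .cons a (Val.list l)

/-- The list of the binary digits of a number, least significant digit first. -/
def Val.nat (m : ℕ) : Val K :=
  Val.list (m.bits.map fun b => if b then .cons .nil .nil else .nil)

/-- A syntax tree node with the label `m` and the given children. -/
def Val.node (m : ℕ) (l : List (Val K)) : Val K := .cons (.nat m) (.list l)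

section Code

variable {n : ℕ} {P : Fin n → Type} [∀ i, Fintype (P i)]

/-- The ports of each type are coded by their numbers in a fixed enumeration. -/
noncomputable def VarPort.code (q : VarPort P) : Val K :=
  .list [.nat q.type, .nat (Fintype.equivFin (P q.type) q.port), .nat q.var]

noncomputable def PIL.code : PIL (VarPort P) → Val K
  | .tru => .node 0 []
  | .port q => .node 1 [q.code]
  | .neg φ => .node 2 [φ.code]
  | .or φ₁ φ₂ => .node 3 [φ₁.code, φ₂.code]

noncomputable def Zeta.code : Zeta (VarPort P) → Val K
  | .pil φ => .node 0 [φ.code]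
  | .conc ζ₁ ζ₂ => .node 1 [ζ₁.code, ζ₂.code]

noncomputable def EPIL.code : EPIL (VarPort P) → Val K
  | .zeta ζ => .node 0 [ζ.code]
  | .neg ζ => .node 1 [ζ.code]
  | .or φ₁ φ₂ => .node 2 [φ₁.code, φ₂.code]
  | .and φ₁ φ₂ => .node 3 [φ₁.code, φ₂.code]
  | .conc φ₁ φ₂ => .node 4 [φ₁.code, φ₂.code]
  | .shuf φ₁ φ₂ => .node 5 [φ₁.code, φ₂.code]

noncomputable def Formula.code : Formula P → Val K
  | .epil φ => .node 0 [φ.code]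
  | .eq i x y => .node 1 [.nat i, .nat x, .nat y]
  | .neq i x y => .node 2 [.nat i, .nat x, .nat y]
  | .or ψ₁ ψ₂ => .node 3 [ψ₁.code, ψ₂.code]
  | .and ψ₁ ψ₂ => .node 4 [ψ₁.code, ψ₂.code]
  | .conc ψ₁ ψ₂ => .node 5 [ψ₁.code, ψ₂.code]
  | .shuf ψ₁ ψ₂ => .node 6 [ψ₁.code, ψ₂.code]
  | .ex i x ψ => .node 7 [.nat i, .nat x, ψ.code]
  | .all i x ψ => .node 8 [.nat i, .nat x, ψ.code]
  | .exConc i x ψ => .node 9 [.nat i, .nat x, ψ.code]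
  | .allConc i x ψ => .node 10 [.nat i, .nat x, ψ.code]
  | .exShuf i x ψ => .node 11 [.nat i, .nat x, ψ.code]
  | .allShuf i x ψ => .node 12 [.nat i, .nat x, ψ.code]

noncomputable def WFormula.code : WFormula P K → Val K
  | .const k => .node 0 [.atom k]
  | .formula ψ => .node 1 [ψ.code]
  | .plus ψ₁ ψ₂ => .node 2 [ψ₁.code, ψ₂.code]
  | .times ψ₁ ψ₂ => .node 3 [ψ₁.code, ψ₂.code]
  | .conc ψ₁ ψ₂ => .node 4 [ψ₁.code, ψ₂.code]
  | .shuf ψ₁ ψ₂ => .node 5 [ψ₁.code, ψ₂.code]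
  | .sum i x ψ => .node 6 [.nat i, .nat x, ψ.code]
  | .prod i x ψ => .node 7 [.nat i, .nat x, ψ.code]
  | .sumConc i x ψ => .node 8 [.nat i, .nat x, ψ.code]
  | .prodConc i x ψ => .node 9 [.nat i, .nat x, ψ.code]
  | .sumShuf i x ψ => .node 10 [.nat i, .nat x, ψ.code]
  | .prodShuf i x ψ => .node 11 [.nat i, .nat x, ψ.code]

end Code

end Machine

end WFOEIL

/-!
Why equivalence is decidable in doubly exponential time.

**From formulas to weighted expressions.** The interactions form a finite alphabet, and every
quantifier ranges over the finite set `Fin (r i)`. So, after instantiation of the quantifiers, a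
sentence becomes a weighted rational expression `Rex` without star, built with sum, Hadamard
product, Cauchy product and shuffle product. The value of a FOEIL formula is `0` or `1`, whereas the
corresponding expression counts the ways in which a word satisfies it. The constructor `Rex.det`
repairs this: it denotes the characteristic function of the words that are accepted, and its
derivatives are those of a subset construction. `Rex.ndet` is its complement and serves for `¬ζ`.
The semantics of the instantiated sentence is the value of the sentence (`WFormula.val_inst`).

**Finitely many states.** The derivative of an expression with respect to a letter is a linear
combination of partial derivatives in the sense of Antimirov (`Rex.pd`). The finite set `Rex.st e`
contains `e` and is closed under partial derivatives (`Rex.pd_mem_st`). Thus the values on all words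
are those of a weighted automaton with states `Rex.st e`. The number of states is bounded by
`Rex.cnt e` (`Rex.card_st`), which is doubly exponential in the size of the sentence
(`WFormula.cnt_inst_le`): the Hadamard and shuffle products that come from quantifiers multiply
numbers of states, which are singly exponential for FOEIL formulas (`Formula.cnt_inst_le`), and
`Rex.det` adds an exponential. A single state, however, is a tree of singly exponential depth, has
singly exponentially many partial derivatives, and these are computed in time `2 ^ h` with `h`
singly exponential; this is the second measure, `Rex.hgt` (`WFormula.hgt_inst_le`,
`pdBound_of_mem_st`).

**Equivalence of weighted automata.** The sentences with the expressions `e` and `f` are equivalent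
if the vector `e - f`, a formal linear combination of states, has the series zero. As in the
minimization of weighted automata over a field by Schützenberger and in Tzeng's algorithm, the
procedure computes the span of all derivatives of this vector. It keeps a basis in echelon form and
a list of vectors to be examined, reduces the next vector by the basis, and, if the result is not
zero, checks its value on the empty word and adds the vector to the basis and its derivatives to the
list. A basis has at most as many vectors as there are states (`IsEchelon.length_le`), so the loop
is polynomial in the number of states (`IsTimeBound.fn_loop`, `IsTimeBound.fn_loop_isNull`).

Elements of `K` can neither be subtracted nor divided. Coefficients are therefore formal
differences, that is, pairs of elements of `K`, and elimination multiplies by the pivot instead of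
dividing by it. The pairs are interpreted in the subring of the skew field that is generated by the
image of `K`. This subring is commutative, as `K` is, and has no zero divisors, so multiplication by
a pivot loses nothing (`IsEchelon.exists_pair_red`).

**Times.** `Ev` and `Fn` bound the number of steps of expressions and function calls. For most
functions it suffices to bound the height of the evaluation tree: as every rule has at most two
recursive premises, an evaluation of height `h` takes less than `2 ^ h` steps (`Eh`, `Fh`), and
heights, unlike times, are simply the maximum of the heights of the premises plus one. Exact
counting is needed only for the elimination, where each recursion runs through a list of doubly
exponential length. `exists_eval_mainExpr` combines everything.
-/


namespace WFOEIL

/-! ### Weighted rational expressions and their partial derivatives -/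

/-- Weighted rational expressions without star, denoting series in `List A → K` (`Rex.val`):
`const k` is constant, `eps` is the characteristic function of the empty word, and `pil S` that of the
words of length one with letter in `S`; `ne e` restricts `e` to nonempty words; `alt`, `had`, `conc`,
`shuf` are sum, Hadamard product, Cauchy product and shuffle product; `det l` is the characteristic
function of the words accepted by a member of `l` (`Rex.acc`), and `ndet l` of those that are not. -/
inductive Rex (K : Type u) (A : Type) : Type u
  | const (k : K)
  | eps
  | pil (S : List A)
  | ne (e : Rex K A)
  | alt (e f : Rex K A)
  | had (e f : Rex K A)
  | conc (e f : Rex K A)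
  | shuf (e f : Rex K A)
  | det (l : List (Rex K A))
  | ndet (l : List (Rex K A))

namespace Rex

variable {K : Type u} {A : Type}

mutual
/-- Whether the empty word is accepted. Coefficients are disregarded, even the coefficient `0`. -/
def nul : Rex K A → Bool
  | const _ | eps => true
  | pil _ | ne _ => false
  | alt e f => e.nul || f.nul
  | had e f | conc e f | shuf e f => e.nul && f.nul
  | det l => nulAny l
  | ndet l => !nulAny l

/-- Whether a member of the list accepts the empty word. -/
def nulAny : List (Rex K A) → Bool
  | [] => false
  | e :: l => e.nul || nulAny l
end

theorem nulAny_iff (l : List (Rex K A)) : nulAny l = true ↔ ∃ e ∈ l, e.nul = true := by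
  induction l with
  | nil => simp [nulAny]
  | cons e l ih => simp [nulAny, ih]

variable [CommSemiring K]

/-- The value on the empty word. -/
def out : Rex K A → K
  | const k => k
  | eps => 1
  | pil _ | ne _ => 0
  | alt e f => e.out + f.out
  | had e f | conc e f | shuf e f => e.out * f.out
  | det l => if nulAny l then 1 else 0
  | ndet l => if nulAny l then 0 else 1

open Classical in
mutual
/-- The partial derivatives of an expression with respect to the letter `a`, with their coefficients.
For `det` and `ndet` this is the subset construction, which is deterministic. -/
noncomputable def pd (a : A) : Rex K A → List (K × Rex K A)
  | const k => [(1, const k)]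
  | eps => []
  | pil S => if a ∈ S then [(1, eps)] else []
  | ne e => e.pd a
  | alt e f => e.pd a ++ f.pd a
  | had e f => (e.pd a).flatMap fun x => (f.pd a).map fun y => (x.1 * y.1, had x.2 y.2)
  | conc e f => ((e.pd a).map fun x => (x.1, conc x.2 f)) ++
      if e.nul then (f.pd a).map fun x => (e.out * x.1, x.2) else []
  | shuf e f => ((e.pd a).map fun x => (x.1, shuf x.2 f)) ++
      (f.pd a).map fun x => (x.1, shuf e x.2)
  | det l => [(1, det (pdAny a l).dedup)]
  | ndet l => [(1, ndet (pdAny a l).dedup)]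

/-- The partial derivatives of the members of a list, without coefficients. -/
noncomputable def pdAny (a : A) : List (Rex K A) → List (Rex K A)
  | [] => []
  | e :: l => (e.pd a).map (fun x => x.2) ++ pdAny a l
end

/-- The series of an expression. -/
noncomputable def val : List A → Rex K A → K
  | [], e => e.out
  | a :: w, e => ((e.pd a).map fun x => x.1 * val w x.2).sum

/-- Acceptance of a word by the automaton of partial derivatives, where the coefficients are
disregarded. This is the Boolean semantics of an expression, in contrast to its series. -/
def acc : List A → Rex K A → Prop
  | [], e => e.nul = true
  | a :: w, e => ∃ x ∈ e.pd a, acc w x.2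

theorem mem_pdAny (a : A) (l : List (Rex K A)) (y : Rex K A) :
    y ∈ pdAny a l ↔ ∃ e ∈ l, ∃ x ∈ e.pd a, x.2 = y := by
  induction l with
  | nil => simp [pdAny]
  | cons e l ih => simp [pdAny, ih]

theorem out_eq_zero_of_nul (e : Rex K A) (h : e.nul = false) : e.out = 0 := by
  cases e with
  | alt e f =>
    simp only [nul, Bool.or_eq_false_iff] at h
    simp [out, out_eq_zero_of_nul e h.1, out_eq_zero_of_nul f h.2]
  | had e f | conc e f | shuf e f =>
    simp only [nul, Bool.and_eq_false_iff] at h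
    rcases h with h | h
    · simp [out, out_eq_zero_of_nul e h]
    · simp [out, out_eq_zero_of_nul f h]
  | det l | ndet l => simp_all [nul, out]
  | _ => simp_all [nul, out]

theorem pd_pil (a : A) (S : List A) [Decidable (a ∈ S)] :
    (pil S : Rex K A).pd a = if a ∈ S then [(1, eps)] else [] := by
  rw [pd]; split_ifs <;> rfl

theorem val_const (k : K) (w : List A) : val w (const k) = k := by
  induction w with
  | nil => rfl
  | cons a w ih => simp [val, pd, ih]

theorem val_eps (w : List A) : val w (eps : Rex K A) = unitSeries w := by
  cases w <;> simp [val, out, pd, unitSeries]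

theorem val_pil_nil (w : List A) : val w (pil [] : Rex K A) = 0 := by
  cases w <;> simp [val, out, pd]

theorem val_alt (e f : Rex K A) (w : List A) : val w (alt e f) = val w e + val w f := by
  cases w <;> simp [val, out, pd]

theorem val_had (e f : Rex K A) (w : List A) : val w (had e f) = val w e * val w f := by
  induction w generalizing e f with
  | nil => simp [val, out]
  | cons a w ih =>
    simp only [val, pd, List.map_flatMap, List.map_map, Function.comp_def, ih]
    simp only [List.flatMap_def, List.sum_flatten, List.map_map, Function.comp_def]
    rw [← List.sum_map_mul_right]
    congr 1
    refine List.map_congr_left fun x _ => ?_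
    rw [← List.sum_map_mul_left]
    congr 1
    refine List.map_congr_left fun y _ => ?_
    ring

theorem cauchy_cons (s t : List A → K) (a : A) (w : List A) :
    cauchy s t (a :: w) = s [] * t (a :: w) + cauchy (fun v => s (a :: v)) t w := by
  simp only [cauchy, List.length_cons]
  rw [Finset.sum_range_succ', add_comm]
  simp

theorem cauchy_sum_left {ι : Type*} (l : List ι) (c : ι → K) (s : ι → List A → K)
    (t : List A → K) (w : List A) :
    cauchy (fun v => (l.map fun i => c i * s i v).sum) t w =
      (l.map fun i => c i * cauchy (s i) t w).sum := by
  induction l with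
  | nil => simp [cauchy]
  | cons i l ih =>
    rw [List.map_cons, List.sum_cons, ← ih]
    simp only [cauchy, List.map_cons, List.sum_cons, add_mul, Finset.sum_add_distrib,
      Finset.mul_sum, mul_assoc]

theorem val_conc (e f : Rex K A) (w : List A) :
    val w (conc e f) = cauchy (fun v => val v e) (fun v => val v f) w := by
  induction w generalizing e f with
  | nil => simp [val, out, cauchy]
  | cons a w ih =>
    rw [cauchy_cons]
    simp only [val, pd, List.map_append, List.sum_append, List.map_map, Function.comp_def, ih]
    rw [cauchy_sum_left, add_comm]
    congr 1
    cases h : e.nul with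
    | false => simp [out_eq_zero_of_nul e h]
    | true => simp [Function.comp_def, mul_assoc, List.sum_map_mul_left]

theorem shuffleProd_cons (s t : List A → K) (a : A) (w : List A) :
    shuffleProd s t (a :: w) =
      shuffleProd (fun v => s (a :: v)) t w + shuffleProd s (fun v => t (a :: v)) w := by
  simp only [shuffleProd, unshuffles]
  induction unshuffles w with
  | nil => simp
  | cons x l ih =>
    simp only [List.flatMap_cons, List.map_append, List.sum_append, ih, List.map_cons,
      List.sum_cons, List.map_nil, List.sum_nil]
    ring

theorem shuffleProd_sum_left {ι : Type*} (l : List ι) (c : ι → K) (s : ι → List A → K)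
    (t : List A → K) (w : List A) :
    shuffleProd (fun v => (l.map fun i => c i * s i v).sum) t w =
      (l.map fun i => c i * shuffleProd (s i) t w).sum := by
  induction l with
  | nil => simp [shuffleProd]
  | cons i l ih =>
    rw [List.map_cons, List.sum_cons, ← ih]
    simp only [shuffleProd, List.map_cons, List.sum_cons, add_mul, List.sum_map_add,
      ← List.sum_map_mul_left, mul_assoc]

theorem shuffleProd_sum_right {ι : Type*} (l : List ι) (c : ι → K) (s : ι → List A → K)
    (t : List A → K) (w : List A) :
    shuffleProd t (fun v => (l.map fun i => c i * s i v).sum) w =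
      (l.map fun i => c i * shuffleProd t (s i) w).sum := by
  induction l with
  | nil => simp [shuffleProd]
  | cons i l ih =>
    rw [List.map_cons, List.sum_cons, ← ih]
    simp only [shuffleProd, List.map_cons, List.sum_cons, mul_add, List.sum_map_add,
      ← List.sum_map_mul_left, mul_left_comm]

theorem val_shuf (e f : Rex K A) (w : List A) :
    val w (shuf e f) = shuffleProd (fun v => val v e) (fun v => val v f) w := by
  induction w generalizing e f with
  | nil => simp [val, out, shuffleProd, unshuffles]
  | cons a w ih =>
    rw [shuffleProd_cons]
    simp only [val, pd, List.map_append, List.sum_append, List.map_map, Function.comp_def, ih]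
    rw [shuffleProd_sum_left, shuffleProd_sum_right]

theorem val_det (l : List (Rex K A)) (w : List A) [Decidable (∃ e ∈ l, acc w e)] :
    val w (det l) = if ∃ e ∈ l, acc w e then 1 else 0 := by
  induction w generalizing l with
  | nil =>
    simp only [val, out, nulAny_iff]
    exact if_congr Iff.rfl rfl rfl
  | cons a w ih =>
    classical
    simp only [val, pd, List.map_cons, List.map_nil, List.sum_cons, List.sum_nil, add_zero,
      one_mul, ih]
    refine if_congr ?_ rfl rfl
    simp only [List.mem_dedup, mem_pdAny, acc]
    constructor
    · rintro ⟨y, ⟨e, he, x, hx, rfl⟩, h⟩; exact ⟨e, he, x, hx, h⟩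
    · rintro ⟨e, he, x, hx, h⟩; exact ⟨_, ⟨e, he, x, hx, rfl⟩, h⟩

theorem acc_const (k : K) (w : List A) : acc w (const k) := by
  induction w with
  | nil => rfl
  | cons a w ih => simpa [acc, pd] using ih

theorem acc_eps (w : List A) : acc w (eps : Rex K A) ↔ w = [] := by
  cases w <;> simp [acc, nul, pd]

theorem acc_pil (S : List A) (w : List A) : acc w (pil S : Rex K A) ↔ ∃ a ∈ S, w = [a] := by
  classical
  cases w with
  | nil => simp [acc, nul]
  | cons a w =>
    simp only [acc, pd_pil]
    split_ifs with h
    · simp only [List.mem_singleton, exists_eq_left, acc_eps]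
      constructor
      · rintro rfl; exact ⟨a, h, rfl⟩
      · rintro ⟨b, _, hb⟩; simpa using (List.cons.inj hb).2
    · simp only [List.not_mem_nil, false_and, exists_false, false_iff, not_exists, not_and]
      rintro b hb hab
      exact h ((List.cons.inj hab).1 ▸ hb)

theorem acc_ne (e : Rex K A) (w : List A) : acc w (ne e) ↔ w ≠ [] ∧ acc w e := by
  cases w <;> simp [acc, nul, pd]

theorem acc_alt (e f : Rex K A) (w : List A) : acc w (alt e f) ↔ acc w e ∨ acc w f := by
  cases w with
  | nil => simp [acc, nul]
  | cons a w => simp only [acc, pd, List.mem_append, or_and_right, exists_or]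

theorem acc_had (e f : Rex K A) (w : List A) : acc w (had e f) ↔ acc w e ∧ acc w f := by
  induction w generalizing e f with
  | nil => simp [acc, nul]
  | cons a w ih =>
    simp only [acc, pd, List.mem_flatMap, List.mem_map]
    constructor
    · rintro ⟨_, ⟨x, hx, y, hy, rfl⟩, h⟩
      exact ⟨⟨x, hx, ((ih _ _).1 h).1⟩, ⟨y, hy, ((ih _ _).1 h).2⟩⟩
    · rintro ⟨⟨x, hx, h⟩, ⟨y, hy, h'⟩⟩
      exact ⟨_, ⟨x, hx, y, hy, rfl⟩, (ih _ _).2 ⟨h, h'⟩⟩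

theorem acc_conc (e f : Rex K A) (w : List A) :
    acc w (conc e f) ↔ ∃ w₁ w₂, w = w₁ ++ w₂ ∧ acc w₁ e ∧ acc w₂ f := by
  induction w generalizing e f with
  | nil => simp [acc, nul]
  | cons a w ih =>
    simp only [acc, pd, List.mem_append, List.mem_map]
    constructor
    · rintro ⟨_, ⟨x, hx, rfl⟩ | hx, h⟩
      · obtain ⟨w₁, w₂, rfl, h₁, h₂⟩ := (ih _ _).1 h
        exact ⟨a :: w₁, w₂, rfl, ⟨x, hx, h₁⟩, h₂⟩
      · split_ifs at hx with hn
        · obtain ⟨y, hy, rfl⟩ := List.mem_map.1 hx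
          exact ⟨[], a :: w, rfl, hn, y, hy, h⟩
        · simp at hx
    · rintro ⟨w₁, w₂, hw, h₁, h₂⟩
      cases w₁ with
      | nil =>
        obtain rfl : a :: w = w₂ := hw
        obtain ⟨y, hy, h⟩ := h₂
        have hn : e.nul = true := h₁
        exact ⟨(e.out * y.1, y.2), Or.inr (by rw [if_pos hn]; exact List.mem_map.2 ⟨y, hy, rfl⟩), h⟩
      | cons b w₁ =>
        simp only [List.cons_append, List.cons.injEq] at hw
        obtain ⟨rfl, rfl⟩ := hw
        obtain ⟨x, hx, h⟩ := h₁
        exact ⟨_, Or.inl ⟨x, hx, rfl⟩, (ih _ _).2 ⟨_, _, rfl, h, h₂⟩⟩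

theorem acc_shuf (e f : Rex K A) (w : List A) :
    acc w (shuf e f) ↔ ∃ w₁ w₂, w ∈ shuffle w₁ w₂ ∧ acc w₁ e ∧ acc w₂ f := by
  simp only [← mem_unshuffles_iff]
  induction w generalizing e f with
  | nil => simp [acc, nul, unshuffles]
  | cons a w ih =>
    simp only [acc, pd, List.mem_append, List.mem_map, unshuffles, List.mem_flatMap]
    constructor
    · rintro ⟨_, ⟨x, hx, rfl⟩ | ⟨x, hx, rfl⟩, h⟩
      · obtain ⟨w₁, w₂, hw, h₁, h₂⟩ := (ih _ _).1 h
        exact ⟨a :: w₁, w₂, ⟨_, hw, by simp⟩, ⟨x, hx, h₁⟩, h₂⟩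
      · obtain ⟨w₁, w₂, hw, h₁, h₂⟩ := (ih _ _).1 h
        exact ⟨w₁, a :: w₂, ⟨_, hw, by simp⟩, h₁, ⟨x, hx, h₂⟩⟩
    · rintro ⟨w₁, w₂, ⟨⟨v₁, v₂⟩, hw, hv⟩, h₁, h₂⟩
      simp only [List.mem_cons, Prod.mk.injEq, List.not_mem_nil, or_false] at hv
      rcases hv with ⟨rfl, rfl⟩ | ⟨rfl, rfl⟩
      · obtain ⟨x, hx, h⟩ := h₁
        exact ⟨_, Or.inl ⟨x, hx, rfl⟩, (ih _ _).2 ⟨_, _, hw, h, h₂⟩⟩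
      · obtain ⟨x, hx, h⟩ := h₂
        exact ⟨_, Or.inr ⟨x, hx, rfl⟩, (ih _ _).2 ⟨_, _, hw, h₁, h⟩⟩

theorem acc_ndet (l : List (Rex K A)) (w : List A) :
    acc w (ndet l) ↔ ¬ ∃ e ∈ l, acc w e := by
  induction w generalizing l with
  | nil => simp [acc, nul, ← nulAny_iff]
  | cons a w ih =>
    simp only [acc, pd, List.mem_singleton, exists_eq_left, ih, List.mem_dedup, mem_pdAny]
    refine not_congr ⟨?_, ?_⟩
    · rintro ⟨y, ⟨e, he, x, hx, rfl⟩, h⟩; exact ⟨e, he, x, hx, h⟩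
    · rintro ⟨e, he, x, hx, h⟩; exact ⟨_, ⟨e, he, x, hx, rfl⟩, h⟩

end Rex

/-! ### Sums over nonempty subsets -/

section Increasing

/-- A sum over the nonempty subsets of `a :: l`, split by whether they contain `a` and another element. -/
theorem sum_nonempty_filter_cons {ι M : Type*} [DecidableEq ι] [AddCommMonoid M] (g : List ι → M)
    (a : ι) (l : List ι) (h : (a :: l).Nodup) :
    ∑ J ∈ (a :: l).toFinset.powerset with J.Nonempty, g ((a :: l).filter fun j => decide (j ∈ J)) =
      g [a] + (∑ J ∈ l.toFinset.powerset with J.Nonempty, g (l.filter fun j => decide (j ∈ J))) +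
      ∑ J ∈ l.toFinset.powerset with J.Nonempty, g (a :: l.filter fun j => decide (j ∈ J)) := by
  obtain ⟨ha, hl⟩ := List.nodup_cons.1 h
  have ha' : a ∉ l.toFinset := by simpa using ha
  rw [Finset.sum_filter, List.toFinset_cons, Finset.sum_powerset_insert ha', Finset.sum_filter,
    Finset.sum_filter]
  have h1 : ∀ J ∈ l.toFinset.powerset, ((a :: l).filter fun j => decide (j ∈ J)) =
      l.filter fun j => decide (j ∈ J) := by
    intro J hJ
    rw [List.filter_cons_of_neg]
    simpa using fun h => ha' (Finset.mem_powerset.1 hJ h)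
  have h2 : ∀ J ∈ l.toFinset.powerset, ((a :: l).filter fun j => decide (j ∈ insert a J)) =
      a :: l.filter fun j => decide (j ∈ J) := by
    intro J hJ
    rw [List.filter_cons_of_pos (by simp)]
    congr 1
    refine List.filter_congr fun j hj => ?_
    have : j ≠ a := fun e => ha (e ▸ hj)
    simp [this]
  have h3 : ∑ J ∈ l.toFinset.powerset, (if (insert a J).Nonempty then
      g ((a :: l).filter fun j => decide (j ∈ insert a J)) else 0) =
      g [a] + ∑ J ∈ l.toFinset.powerset, if J.Nonempty then
        g (a :: l.filter fun j => decide (j ∈ J)) else 0 := by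
    rw [← Finset.add_sum_erase _ _ (Finset.empty_mem_powerset l.toFinset),
      ← Finset.add_sum_erase (a := ∅) _ (fun J => if J.Nonempty then
        g (a :: l.filter fun j => decide (j ∈ J)) else 0) (Finset.empty_mem_powerset l.toFinset)]
    rw [if_pos (Finset.insert_nonempty _ _), if_neg (by simp), zero_add,
      h2 _ (Finset.empty_mem_powerset _)]
    congr 1
    · simp
    · refine Finset.sum_congr rfl fun J hJ => ?_
      obtain ⟨hne, hJ⟩ := Finset.mem_erase.1 hJ
      rw [if_pos (Finset.insert_nonempty _ _), h2 _ hJ,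
        if_pos (Finset.nonempty_iff_ne_empty.2 hne)]
  rw [h3]
  rw [Finset.sum_congr rfl fun J hJ => by rw [h1 J hJ]]
  abel

/-- The nonempty subsets of `a :: l`, split by whether they contain `a` and another element. -/
theorem exists_nonempty_filter_cons {ι : Type*} [DecidableEq ι] (p : List ι → Prop)
    (a : ι) (l : List ι) (h : (a :: l).Nodup) :
    (∃ J : Finset ι, J.Nonempty ∧ J ⊆ (a :: l).toFinset ∧
        p ((a :: l).filter fun j => decide (j ∈ J))) ↔
      (p [a] ∨ ∃ J : Finset ι, J.Nonempty ∧ J ⊆ l.toFinset ∧ p (l.filter fun j => decide (j ∈ J))) ∨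
      ∃ J : Finset ι, J.Nonempty ∧ J ⊆ l.toFinset ∧ p (a :: l.filter fun j => decide (j ∈ J)) := by
  obtain ⟨ha, hl⟩ := List.nodup_cons.1 h
  have key : ∀ J : Finset ι, a ∉ J → (l.filter fun j => decide (j ∈ insert a J)) =
      l.filter fun j => decide (j ∈ J) := fun J _ => by
    refine List.filter_congr fun j hj => ?_
    have : j ≠ a := fun e => ha (e ▸ hj)
    simp [this]
  constructor
  · rintro ⟨J, hne, hJ, hp⟩
    by_cases haJ : a ∈ J
    · have hJ' : J.erase a ⊆ l.toFinset := fun x hx => by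
        have := hJ (Finset.mem_of_mem_erase hx)
        rw [List.toFinset_cons, Finset.mem_insert] at this
        exact this.resolve_left (Finset.ne_of_mem_erase hx)
      rw [List.filter_cons_of_pos (by simpa using haJ), ← Finset.insert_erase haJ,
        key _ (by simp)] at hp
      rcases (J.erase a).eq_empty_or_nonempty with h0 | h0
      · rw [h0] at hp
        exact Or.inl (Or.inl (by simpa using hp))
      · exact Or.inr ⟨_, h0, hJ', hp⟩
    · rw [List.filter_cons_of_neg (by simpa using haJ)] at hp
      refine Or.inl (Or.inr ⟨J, hne, fun x hx => ?_, hp⟩)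
      have := hJ hx
      rw [List.toFinset_cons, Finset.mem_insert] at this
      exact this.resolve_left fun e => haJ (e ▸ hx)
  · rintro ((hp | ⟨J, hne, hJ, hp⟩) | ⟨J, hne, hJ, hp⟩)
    · refine ⟨{a}, by simp, by simp, ?_⟩
      rw [List.filter_cons_of_pos (by simp)]
      convert hp
      simp only [Finset.mem_singleton, List.filter_eq_nil_iff, decide_eq_true_eq]
      rintro x hx rfl
      exact ha hx
    · have haJ : a ∉ J := fun h => ha (by simpa using hJ h)
      refine ⟨J, hne, hJ.trans (by simp), ?_⟩
      rwa [List.filter_cons_of_neg (by simpa using haJ)]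
    · have haJ : a ∉ J := fun h => ha (by simpa using hJ h)
      refine ⟨insert a J, by simp, ?_, ?_⟩
      · rw [List.toFinset_cons]; exact Finset.insert_subset_insert _ hJ
      · rwa [List.filter_cons_of_pos (by simp), key _ haJ]

end Increasing

namespace Rex

variable {K : Type u} {A : Type}

/-- The sum of the `op`-products of all nonempty subsequences of a list. It has linearly many
distinct subexpressions, although there are exponentially many subsequences; expanded as a tree, it is
singly exponential. -/
def sumOp (op : Rex K A → Rex K A → Rex K A) : List (Rex K A) → Rex K A
  | [] => pil []
  | [e] => e
  | e :: f :: l => alt (alt e (sumOp op (f :: l))) (op e (sumOp op (f :: l)))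

variable [CommSemiring K]

theorem acc_foldr_alt (l : List (Rex K A)) (w : List A) :
    acc w (l.foldr alt (pil [])) ↔ ∃ e ∈ l, acc w e := by
  induction l with
  | nil => simp [acc_pil]
  | cons e l ih => simp [acc_alt, ih]

theorem acc_foldr_had (l : List (Rex K A)) (w : List A) :
    acc w (l.foldr had (const 1)) ↔ ∀ e ∈ l, acc w e := by
  induction l with
  | nil => simp [acc_const]
  | cons e l ih => simp [acc_had, ih]

theorem val_foldr_alt (l : List (Rex K A)) (w : List A) :
    val w (l.foldr alt (pil [])) = (l.map (val w)).sum := by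
  induction l with
  | nil => simp [val_pil_nil]
  | cons e l ih => simp [val_alt, ih]

theorem val_foldr_had (l : List (Rex K A)) (w : List A) :
    val w (l.foldr had (const 1)) = (l.map (val w)).prod := by
  induction l with
  | nil => simp [val_const]
  | cons e l ih => simp [val_had, ih]

theorem val_foldr_conc (l : List (Rex K A)) (w : List A) :
    val w (l.foldr conc eps) = cauchyAll (l.map fun e v => val v e) w := by
  induction l generalizing w with
  | nil => simp [val_eps, cauchyAll]
  | cons e l ih => simp [val_conc, ih, cauchyAll]

theorem val_foldr_shuf (l : List (Rex K A)) (w : List A) :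
    val w (l.foldr shuf eps) = shuffleProdAll (l.map fun e v => val v e) w := by
  induction l generalizing w with
  | nil => simp [val_eps, shuffleProdAll]
  | cons e l ih => simp [val_shuf, ih, shuffleProdAll]

theorem acc_foldr_conc {ι : Type*} [DecidableEq ι] (l : List ι) (hl : l.Nodup)
    (e : ι → Rex K A) (w : List A) :
    acc w ((l.map e).foldr conc eps) ↔
      ∃ u : ι → List A, w = (l.map u).flatten ∧ ∀ j ∈ l, acc (u j) (e j) := by
  induction l generalizing w with
  | nil => simp [acc_eps]
  | cons a l ih =>
    obtain ⟨ha, hl⟩ := List.nodup_cons.1 hl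
    simp only [List.map_cons, List.foldr_cons, acc_conc, ih hl, List.flatten_cons,
      List.forall_mem_cons]
    constructor
    · rintro ⟨w₁, w₂, rfl, h₁, u, rfl, h₂⟩
      have hu : ∀ j ∈ l, Function.update u a w₁ j = u j := fun j hj =>
        Function.update_of_ne (ne_of_mem_of_not_mem hj ha) _ _
      exact ⟨Function.update u a w₁, by rw [Function.update_self, List.map_congr_left hu],
        by rwa [Function.update_self], fun j hj => by rw [hu j hj]; exact h₂ j hj⟩
    · rintro ⟨u, rfl, h₁, h₂⟩
      exact ⟨_, _, rfl, h₁, u, rfl, h₂⟩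

theorem acc_foldr_shuf {ι : Type*} [DecidableEq ι] (l : List ι) (hl : l.Nodup)
    (e : ι → Rex K A) (w : List A) :
    acc w ((l.map e).foldr shuf eps) ↔
      ∃ u : ι → List A, w ∈ shuffleAll (l.map u) ∧ ∀ j ∈ l, acc (u j) (e j) := by
  induction l generalizing w with
  | nil => simp [acc_eps, shuffleAll]
  | cons a l ih =>
    obtain ⟨ha, hl⟩ := List.nodup_cons.1 hl
    simp only [List.map_cons, List.foldr_cons, acc_shuf, ih hl, shuffleAll, Set.mem_ofPred_eq,
      List.forall_mem_cons]
    constructor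
    · rintro ⟨w₁, w₂, hw, h₁, u, hu₂, h₂⟩
      have hu : ∀ j ∈ l, Function.update u a w₁ j = u j := fun j hj =>
        Function.update_of_ne (ne_of_mem_of_not_mem hj ha) _ _
      exact ⟨Function.update u a w₁,
        ⟨w₂, by rwa [List.map_congr_left hu], by rwa [Function.update_self]⟩,
        by rwa [Function.update_self], fun j hj => by rw [hu j hj]; exact h₂ j hj⟩
    · rintro ⟨u, ⟨w₂, hw₂, hw⟩, h₁, h₂⟩
      exact ⟨_, _, hw, h₁, u, hw₂, h₂⟩

/-- `sumOp op` accepts what `op` accepts on some nonempty subsequence. -/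
theorem acc_sumOp {ι : Type*} [DecidableEq ι] (op : Rex K A → Rex K A → Rex K A)
    (e : ι → Rex K A) (p : List ι → List A → Prop)
    (hp : ∀ j w, p [j] w ↔ acc w (e j))
    (hop : ∀ (j : ι) (S : Set (List ι)) (f : Rex K A),
      (∀ w, acc w f ↔ ∃ t ∈ S, p t w) → ∀ w, acc w (op (e j) f) ↔ ∃ t ∈ S, p (j :: t) w)
    (l : List ι) (hl : l.Nodup) (w : List A) :
    acc w (sumOp op (l.map e)) ↔ ∃ J : Finset ι, J.Nonempty ∧ J ⊆ l.toFinset ∧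
      p (l.filter fun j => decide (j ∈ J)) w := by
  induction l generalizing w with
  | nil =>
    simp only [List.map_nil, sumOp, acc_pil, List.not_mem_nil, false_and, exists_false,
      List.toFinset_nil, Finset.subset_empty, false_iff]
    rintro ⟨J, hJ, rfl, _⟩
    simp at hJ
  | cons a l ih =>
    have hl' := (List.nodup_cons.1 hl).2
    rw [exists_nonempty_filter_cons (fun t => p t w) a l hl, hp]
    cases l with
    | nil =>
      have hno : ∀ (q : Finset ι → Prop), ¬ ∃ J : Finset ι, J.Nonempty ∧ J ⊆ ([] : List ι).toFinset ∧ q J := by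
        rintro q ⟨J, hJ, hJ', _⟩
        simp only [List.toFinset_nil, Finset.subset_empty] at hJ'
        simp [hJ'] at hJ
      rw [or_iff_left (hno _), or_iff_left (hno _)]
      rfl
    | cons b l =>
      simp only [List.map_cons, sumOp, acc_alt]
      have ih' := fun w => ih hl' w
      simp only [List.map_cons] at ih'
      rw [ih' w, hop a {t | ∃ J : Finset ι, J.Nonempty ∧ J ⊆ (b :: l).toFinset ∧
        t = (b :: l).filter fun j => decide (j ∈ J)} _ (fun w => by
          rw [ih' w]
          constructor
          · rintro ⟨J, h1, h2, h3⟩; exact ⟨_, ⟨J, h1, h2, rfl⟩, h3⟩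
          · rintro ⟨_, ⟨J, h1, h2, rfl⟩, h3⟩; exact ⟨J, h1, h2, h3⟩)]
      refine or_congr Iff.rfl ?_
      constructor
      · rintro ⟨_, ⟨J, h1, h2, rfl⟩, h3⟩; exact ⟨J, h1, h2, h3⟩
      · rintro ⟨J, h1, h2, h3⟩; exact ⟨_, ⟨J, h1, h2, rfl⟩, h3⟩

/-- `sumOp op` has as value the sum of the `op`-products over all nonempty subsequences. -/
theorem val_sumOp {ι : Type*} [DecidableEq ι] (op : Rex K A → Rex K A → Rex K A)
    (e : ι → Rex K A) (g : List ι → List A → K)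
    (hg : ∀ j w, g [j] w = val w (e j))
    (hop : ∀ (j : ι) (I : Finset (Finset ι)) (t : Finset ι → List ι) (f : Rex K A),
      (∀ w, val w f = ∑ J ∈ I, g (t J) w) → ∀ w, val w (op (e j) f) = ∑ J ∈ I, g (j :: t J) w)
    (l : List ι) (hl : l.Nodup) (w : List A) :
    val w (sumOp op (l.map e)) = ∑ J ∈ l.toFinset.powerset with J.Nonempty,
      g (l.filter fun j => decide (j ∈ J)) w := by
  induction l generalizing w with
  | nil => simp [sumOp, val_pil_nil, Finset.filter_singleton]
  | cons a l ih =>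
    have hl' := (List.nodup_cons.1 hl).2
    rw [sum_nonempty_filter_cons (fun t => g t w) a l hl, hg]
    cases l with
    | nil => simp [sumOp, Finset.filter_singleton]
    | cons b l =>
      simp only [List.map_cons, sumOp, val_alt]
      have ih' := fun w => ih hl' w
      simp only [List.map_cons] at ih'
      rw [ih' w, hop a _ (fun J => (b :: l).filter fun j => decide (j ∈ J)) _ ih']

theorem cauchy_unitSeries (s : List A → K) (w : List A) : cauchy s unitSeries w = s w := by
  induction w generalizing s with
  | nil => simp [cauchy, unitSeries]
  | cons a w ih => rw [cauchy_cons, ih]; simp [unitSeries]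

theorem shuffleProd_unitSeries (s : List A → K) (w : List A) :
    shuffleProd s unitSeries w = s w := by
  induction w generalizing s with
  | nil => simp [shuffleProd, unshuffles, unitSeries]
  | cons a w ih =>
    rw [shuffleProd_cons, ih]
    simp [shuffleProd, unitSeries]

theorem cauchy_finset_sum {ι : Type*} (I : Finset ι) (s : List A → K) (t : ι → List A → K)
    (w : List A) : cauchy s (fun v => ∑ i ∈ I, t i v) w = ∑ i ∈ I, cauchy s (t i) w := by
  simp only [cauchy, Finset.mul_sum]
  exact Finset.sum_comm

theorem shuffleProd_finset_sum {ι : Type*} (I : Finset ι) (s : List A → K) (t : ι → List A → K)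
    (w : List A) : shuffleProd s (fun v => ∑ i ∈ I, t i v) w = ∑ i ∈ I, shuffleProd s (t i) w := by
  simp only [shuffleProd, Finset.mul_sum]
  induction unshuffles w with
  | nil => simp
  | cons x l ih => simp [ih, Finset.sum_add_distrib]

theorem val_sumOp_conc {m : ℕ} (e : Fin m → Rex K A) (w : List A) :
    val w (sumOp conc ((List.finRange m).map e)) = ∑ J : Finset (Fin m) with J.Nonempty,
      cauchyAll ((increasing J).map fun j v => val v (e j)) w := by
  rw [val_sumOp conc e (fun t w => cauchyAll (t.map fun j v => val v (e j)) w) _ _ _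
    (List.nodup_finRange m)]
  · simp [increasing]
  · intro j w; simp [cauchyAll, cauchy_unitSeries]
  · intro j I t f hf w
    simp only [val_conc, hf, List.map_cons, cauchyAll, List.foldr_cons, cauchy_finset_sum]

theorem val_sumOp_shuf {m : ℕ} (e : Fin m → Rex K A) (w : List A) :
    val w (sumOp shuf ((List.finRange m).map e)) = ∑ J : Finset (Fin m) with J.Nonempty,
      shuffleProdAll ((increasing J).map fun j v => val v (e j)) w := by
  rw [val_sumOp shuf e (fun t w => shuffleProdAll (t.map fun j v => val v (e j)) w) _ _ _
    (List.nodup_finRange m)]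
  · simp [increasing]
  · intro j w; simp [shuffleProdAll, shuffleProd_unitSeries]
  · intro j I t f hf w
    simp only [val_shuf, hf, List.map_cons, shuffleProdAll, List.foldr_cons, shuffleProd_finset_sum]

theorem mem_increasing {m : ℕ} (J : Finset (Fin m)) (j : Fin m) : j ∈ increasing J ↔ j ∈ J := by
  simp [increasing]

theorem acc_sumOp_conc {m : ℕ} (e : Fin m → Rex K A) (w : List A) :
    acc w (sumOp conc ((List.finRange m).map e)) ↔ ∃ J : Finset (Fin m), J.Nonempty ∧
      ∃ u : Fin m → List A, w = ((increasing J).map u).flatten ∧ ∀ j ∈ J, acc (u j) (e j) := by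
  rw [acc_sumOp conc e (fun t w => acc w ((t.map e).foldr conc eps)) _ _ _
    (List.nodup_finRange m)]
  · refine exists_congr fun J => and_congr_right fun _ => ?_
    have := acc_foldr_conc (increasing J) ((List.nodup_finRange m).filter _) e w
    simp only [mem_increasing] at this
    rw [← this]
    simp [increasing]
  · intro j w; simp [acc_conc, acc_eps]
  · intro j S f hf w
    simp only [acc_conc, hf, List.map_cons, List.foldr_cons]
    constructor
    · rintro ⟨w₁, w₂, rfl, h₁, t, ht, h₂⟩; exact ⟨t, ht, w₁, w₂, rfl, h₁, h₂⟩
    · rintro ⟨t, ht, w₁, w₂, rfl, h₁, h₂⟩; exact ⟨w₁, w₂, rfl, h₁, t, ht, h₂⟩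

theorem acc_sumOp_shuf {m : ℕ} (e : Fin m → Rex K A) (w : List A) :
    acc w (sumOp shuf ((List.finRange m).map e)) ↔ ∃ J : Finset (Fin m), J.Nonempty ∧
      ∃ u : Fin m → List A, w ∈ shuffleAll ((increasing J).map u) ∧ ∀ j ∈ J, acc (u j) (e j) := by
  rw [acc_sumOp shuf e (fun t w => acc w ((t.map e).foldr shuf eps)) _ _ _
    (List.nodup_finRange m)]
  · refine exists_congr fun J => and_congr_right fun _ => ?_
    have := acc_foldr_shuf (increasing J) ((List.nodup_finRange m).filter _) e w
    simp only [mem_increasing] at this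
    rw [← this]
    simp [increasing]
  · intro j w
    have := acc_foldr_shuf [j] (by simp) e w
    simp only [List.map_cons, List.map_nil] at this ⊢
    rw [this]
    simp only [shuffleAll, List.mem_singleton, forall_eq,
      Set.mem_ofPred_eq, Set.mem_singleton_iff, exists_eq_left, ← mem_unshuffles_iff]
    have key : ∀ (u : List A), (u, []) ∈ unshuffles w ↔ u = w := by
      clear this
      induction w with
      | nil => simp [unshuffles]
      | cons a w ih =>
        intro u
        simp only [unshuffles, List.mem_flatMap, List.mem_cons, Prod.mk.injEq, List.not_mem_nil,
          or_false, reduceCtorEq, and_false]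
        constructor
        · rintro ⟨⟨x, y⟩, h, h1, h2⟩
          simp only at h1 h2
          subst h2
          rw [h1, (ih x).1 h]
        · rintro rfl; exact ⟨(w, []), (ih w).2 rfl, rfl, rfl⟩
    simp only [key]
    constructor
    · rintro ⟨u, rfl, h⟩; exact h
    · intro h; exact ⟨fun _ => w, rfl, h⟩
  · intro j S f hf w
    simp only [acc_shuf, hf, List.map_cons, List.foldr_cons]
    constructor
    · rintro ⟨w₁, w₂, hw, h₁, t, ht, h₂⟩; exact ⟨t, ht, w₁, w₂, hw, h₁, h₂⟩
    · rintro ⟨t, ht, w₁, w₂, hw, h₁, h₂⟩; exact ⟨w₁, w₂, hw, h₁, t, ht, h₂⟩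

end Rex

/-! ### Instantiation of formulas -/

section Inst

variable {n : ℕ} {P : Fin n → Type} {r : Fin n → ℕ}

open Classical in
/-- The expression for an EPIL formula built from PIL formulas by concatenation, under the
assignment `σ`; `lets` lists all letters. A PIL formula other than `true` accepts words of length one
only, and concatenations accept only nonempty words. -/
noncomputable def Zeta.inst (K : Type u) [CommSemiring K] (lets : List (Interaction P r))
    (σ : Assignment r) : Zeta (VarPort P) → Rex K (Interaction P r)
  | .pil φ => if φ.IsTrue then .const 1 else .pil (lets.filter fun a => φ.Sat (active σ) a)
  | .conc ζ₁ ζ₂ => .ne (.conc (ζ₁.inst K lets σ) (ζ₂.inst K lets σ))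

/-- The expression for an EPIL formula under the assignment `σ`; `lets` lists all letters. -/
noncomputable def EPIL.inst (K : Type u) [CommSemiring K] (lets : List (Interaction P r))
    (σ : Assignment r) : EPIL (VarPort P) → Rex K (Interaction P r)
  | .zeta ζ => ζ.inst K lets σ
  | .neg ζ => .ne (.ndet [ζ.inst K lets σ])
  | .or φ₁ φ₂ => .ne (.alt (φ₁.inst K lets σ) (φ₂.inst K lets σ))
  | .and φ₁ φ₂ => .ne (.had (φ₁.inst K lets σ) (φ₂.inst K lets σ))
  | .conc φ₁ φ₂ => .ne (.conc (φ₁.inst K lets σ) (φ₂.inst K lets σ))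
  | .shuf φ₁ φ₂ => .ne (.shuf (φ₁.inst K lets σ) (φ₂.inst K lets σ))

open Classical in
/-- The expression for a FOEIL formula under an assignment, with all quantifiers expanded. Its
acceptance is satisfaction, and its coefficients have no meaning. -/
noncomputable def Formula.inst (K : Type u) [CommSemiring K] (lets : List (Interaction P r)) :
    Formula P → Assignment r → Rex K (Interaction P r)
  | .epil φ, σ => φ.inst K lets σ
  | .eq i x y, σ => if σ i x = σ i y then .const 1 else .pil []
  | .neq i x y, σ => if σ i x = σ i y then .pil [] else .const 1
  | .or ψ₁ ψ₂, σ => .alt (ψ₁.inst K lets σ) (ψ₂.inst K lets σ)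
  | .and ψ₁ ψ₂, σ => .had (ψ₁.inst K lets σ) (ψ₂.inst K lets σ)
  | .conc ψ₁ ψ₂, σ => .conc (ψ₁.inst K lets σ) (ψ₂.inst K lets σ)
  | .shuf ψ₁ ψ₂, σ => .shuf (ψ₁.inst K lets σ) (ψ₂.inst K lets σ)
  | .ex i x ψ, σ =>
      ((List.finRange (r i)).map fun j => ψ.inst K lets (σ.update i x j)).foldr .alt (.pil [])
  | .all i x ψ, σ =>
      ((List.finRange (r i)).map fun j => ψ.inst K lets (σ.update i x j)).foldr .had (.const 1)
  | .exConc i x ψ, σ =>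
      Rex.sumOp .conc ((List.finRange (r i)).map fun j => ψ.inst K lets (σ.update i x j))
  | .allConc i x ψ, σ =>
      ((List.finRange (r i)).map fun j => ψ.inst K lets (σ.update i x j)).foldr .conc .eps
  | .exShuf i x ψ, σ =>
      Rex.sumOp .shuf ((List.finRange (r i)).map fun j => ψ.inst K lets (σ.update i x j))
  | .allShuf i x ψ, σ =>
      ((List.finRange (r i)).map fun j => ψ.inst K lets (σ.update i x j)).foldr .shuf .eps

/-- The expression for a wFOEIL formula under an assignment, with all quantifiers expanded. Its series
is the value of the formula; `det` turns satisfaction of FOEIL formulas into a series. -/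
noncomputable def WFormula.inst {K : Type u} [CommSemiring K] (lets : List (Interaction P r)) :
    WFormula P K → Assignment r → Rex K (Interaction P r)
  | .const k, _ => .const k
  | .formula ψ, σ => .det [ψ.inst K lets σ]
  | .plus ψ₁ ψ₂, σ => .alt (ψ₁.inst lets σ) (ψ₂.inst lets σ)
  | .times ψ₁ ψ₂, σ => .had (ψ₁.inst lets σ) (ψ₂.inst lets σ)
  | .conc ψ₁ ψ₂, σ => .conc (ψ₁.inst lets σ) (ψ₂.inst lets σ)
  | .shuf ψ₁ ψ₂, σ => .shuf (ψ₁.inst lets σ) (ψ₂.inst lets σ)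
  | .sum i x ψ, σ =>
      ((List.finRange (r i)).map fun j => ψ.inst lets (σ.update i x j)).foldr .alt (.pil [])
  | .prod i x ψ, σ =>
      ((List.finRange (r i)).map fun j => ψ.inst lets (σ.update i x j)).foldr .had (.const 1)
  | .sumConc i x ψ, σ =>
      Rex.sumOp .conc ((List.finRange (r i)).map fun j => ψ.inst lets (σ.update i x j))
  | .prodConc i x ψ, σ =>
      ((List.finRange (r i)).map fun j => ψ.inst lets (σ.update i x j)).foldr .conc .eps
  | .sumShuf i x ψ, σ =>
      Rex.sumOp .shuf ((List.finRange (r i)).map fun j => ψ.inst lets (σ.update i x j))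
  | .prodShuf i x ψ, σ =>
      ((List.finRange (r i)).map fun j => ψ.inst lets (σ.update i x j)).foldr .shuf .eps

variable {K : Type u} [CommSemiring K] {lets : List (Interaction P r)}

theorem Zeta.acc_inst (hA : ∀ a, a ∈ lets) (ζ : Zeta (VarPort P)) (σ : Assignment r)
    (w : List (Interaction P r)) : Rex.acc w (ζ.inst K lets σ) ↔ ζ.Sat (active σ) w := by
  induction ζ generalizing w with
  | pil φ =>
    simp only [inst, Sat]
    split_ifs with h
    · simp [h, Rex.acc_const]
    · simp [h, Rex.acc_pil, hA, and_comm]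
  | conc ζ₁ ζ₂ ih₁ ih₂ => simp [inst, Sat, Rex.acc_ne, Rex.acc_conc, ih₁, ih₂]

theorem EPIL.acc_inst (hA : ∀ a, a ∈ lets) (φ : EPIL (VarPort P)) (σ : Assignment r)
    (w : List (Interaction P r)) : Rex.acc w (φ.inst K lets σ) ↔ φ.Sat (active σ) w := by
  induction φ generalizing w with
  | zeta ζ => exact ζ.acc_inst hA σ w
  | neg ζ => simp [inst, Sat, Rex.acc_ne, Rex.acc_ndet, ζ.acc_inst hA]
  | or _ _ ih₁ ih₂ => simp [inst, Sat, Rex.acc_ne, Rex.acc_alt, ih₁, ih₂]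
  | and _ _ ih₁ ih₂ => simp [inst, Sat, Rex.acc_ne, Rex.acc_had, ih₁, ih₂]
  | conc _ _ ih₁ ih₂ => simp [inst, Sat, Rex.acc_ne, Rex.acc_conc, ih₁, ih₂]
  | shuf _ _ ih₁ ih₂ => simp [inst, Sat, Rex.acc_ne, Rex.acc_shuf, ih₁, ih₂]

theorem Formula.acc_inst (hA : ∀ a, a ∈ lets) (ψ : Formula P) (σ : Assignment r)
    (w : List (Interaction P r)) : Rex.acc w (ψ.inst K lets σ) ↔ ψ.Sat σ w := by
  induction ψ generalizing σ w with
  | epil φ => exact φ.acc_inst hA σ w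
  | eq i x y =>
    simp only [inst, Sat]
    split_ifs with h <;> simp [h, Rex.acc_const, Rex.acc_pil]
  | neq i x y =>
    simp only [inst, Sat]
    split_ifs with h <;> simp [h, Rex.acc_const, Rex.acc_pil]
  | or _ _ ih₁ ih₂ => simp [inst, Sat, Rex.acc_alt, ih₁, ih₂]
  | and _ _ ih₁ ih₂ => simp [inst, Sat, Rex.acc_had, ih₁, ih₂]
  | conc _ _ ih₁ ih₂ => simp [inst, Sat, Rex.acc_conc, ih₁, ih₂]
  | shuf _ _ ih₁ ih₂ => simp [inst, Sat, Rex.acc_shuf, ih₁, ih₂]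
  | ex i x ψ ih => simp [inst, Sat, Rex.acc_foldr_alt, ih]
  | all i x ψ ih => simp [inst, Sat, Rex.acc_foldr_had, ih]
  | exConc i x ψ ih => simp [inst, Sat, Rex.acc_sumOp_conc, ih]
  | allConc i x ψ ih =>
    simp [inst, Sat, Rex.acc_foldr_conc _ (List.nodup_finRange (r i)), ih]
  | exShuf i x ψ ih => simp [inst, Sat, Rex.acc_sumOp_shuf, ih]
  | allShuf i x ψ ih =>
    simp [inst, Sat, Rex.acc_foldr_shuf _ (List.nodup_finRange (r i)), ih]

theorem WFormula.val_inst (hA : ∀ a, a ∈ lets) (ψ : WFormula P K) (σ : Assignment r)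
    (w : List (Interaction P r)) : Rex.val w (ψ.inst lets σ) = ψ.value σ w := by
  classical
  induction ψ generalizing σ w with
  | const k => simp [inst, value, Rex.val_const]
  | formula ψ =>
    rw [inst, value, Rex.val_det]
    exact if_congr (by simp [ψ.acc_inst hA]) rfl rfl
  | plus _ _ ih₁ ih₂ => simp [inst, value, Rex.val_alt, ih₁, ih₂]
  | times _ _ ih₁ ih₂ => simp [inst, value, Rex.val_had, ih₁, ih₂]
  | conc _ _ ih₁ ih₂ => simp [inst, value, Rex.val_conc, ih₁, ih₂]
  | shuf _ _ ih₁ ih₂ => simp [inst, value, Rex.val_shuf, ih₁, ih₂]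
  | sum i x ψ ih =>
    simp only [inst, value, Rex.val_foldr_alt, List.map_map, Function.comp_def, ih]
    rw [← List.ofFn_eq_map, List.sum_ofFn]
  | prod i x ψ ih =>
    simp only [inst, value, Rex.val_foldr_had, List.map_map, Function.comp_def, ih]
    rw [← List.ofFn_eq_map, List.prod_ofFn]
  | sumConc i x ψ ih => simp only [inst, value, Rex.val_sumOp_conc, ih]
  | prodConc i x ψ ih =>
    simp only [inst, value, Rex.val_foldr_conc, List.map_map, Function.comp_def, ih]
  | sumShuf i x ψ ih => simp only [inst, value, Rex.val_sumOp_shuf, ih]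
  | prodShuf i x ψ ih =>
    simp only [inst, value, Rex.val_foldr_shuf, List.map_map, Function.comp_def, ih]

end Inst

/-! ### Counting partial derivatives -/

section BoundedLists

variable {α : Type*} [DecidableEq α]

/-- The lists of length at most `k` with entries in `U`. -/
def boundedLists (U : Finset α) : ℕ → Finset (List α)
  | 0 => {[]}
  | k + 1 => insert [] (Finset.image₂ List.cons U (boundedLists U k))

theorem mem_boundedLists (U : Finset α) (k : ℕ) (l : List α) :
    l ∈ boundedLists U k ↔ l.length ≤ k ∧ ∀ x ∈ l, x ∈ U := by
  induction k generalizing l with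
  | zero => cases l <;> simp [boundedLists]
  | succ k ih =>
    cases l with
    | nil => simp [boundedLists]
    | cons a l => simp [boundedLists, Finset.mem_image₂, ih, and_left_comm]

theorem card_boundedLists (U : Finset α) (k : ℕ) :
    (boundedLists U k).card ≤ (U.card + 1) ^ k := by
  induction k with
  | zero => simp [boundedLists]
  | succ k ih =>
    calc (boundedLists U (k + 1)).card ≤ U.card * (boundedLists U k).card + 1 :=
          (Finset.card_insert_le _ _).trans
            (Nat.add_le_add_right (Finset.card_image₂_le _ _ _) 1)
      _ ≤ U.card * (U.card + 1) ^ k + (U.card + 1) ^ k :=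
          Nat.add_le_add (Nat.mul_le_mul_left _ ih) (Nat.one_le_pow _ _ (by omega))
      _ = (U.card + 1) ^ (k + 1) := by ring

end BoundedLists

namespace Rex

variable {K : Type u} {A : Type}

mutual
/-- A bound for the number of iterated partial derivatives. For `det` and `ndet` these are given by
lists without repetitions of iterated partial derivatives of the members. -/
def cnt : Rex K A → ℕ
  | const _ | eps => 2
  | pil S => S.length + 2
  | ne e => e.cnt + 1
  | alt e f | conc e f => e.cnt + f.cnt + 1
  | had e f | shuf e f => e.cnt * f.cnt
  | det l | ndet l => (cntAny l + 2) ^ (cntAny l + 2)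

/-- The sum of the bounds `cnt` for the members of a list. -/
def cntAny : List (Rex K A) → ℕ
  | [] => 0
  | e :: l => e.cnt + cntAny l
end

/-- A bound, up to constants, for the depth of every iterated partial derivative as a tree, for the
number of its partial derivatives, and for the height of their computation. It differs from `cnt` only
at `det` and `ndet`, where a set of states counts for its elements and not for a power set. -/
def hgt : Rex K A → ℕ
  | const _ | eps => 2
  | pil S => S.length + 2
  | ne e => e.hgt + 1
  | alt e f | conc e f => e.hgt + f.hgt + 1
  | had e f | shuf e f => e.hgt * f.hgt
  | det l | ndet l => (cntAny l + 2) ^ 2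

theorem two_le_hgt (e : Rex K A) : 2 ≤ e.hgt := by
  cases e with
  | const | eps => exact le_rfl
  | pil S => simp [hgt]
  | ne e => have := two_le_hgt e; simp only [hgt]; omega
  | alt e f | conc e f => have := two_le_hgt e; have := two_le_hgt f; simp only [hgt]; omega
  | had e f | shuf e f => have := two_le_hgt e; have := two_le_hgt f; simp only [hgt]; nlinarith
  | det l | ndet l => simp only [hgt, sq]; nlinarith [Nat.zero_le (cntAny l)]

open Classical in
mutual
/-- A finite set of expressions that contains `e` and is closed under partial derivatives. -/
noncomputable def st : Rex K A → Finset (Rex K A)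
  | const k => {const k}
  | eps => {eps}
  | pil S => {pil S, eps}
  | ne e => insert (ne e) e.st
  | alt e f => insert (alt e f) (e.st ∪ f.st)
  | had e f => Finset.image₂ had e.st f.st
  | conc e f => e.st.image (fun x => conc x f) ∪ f.st
  | shuf e f => Finset.image₂ shuf e.st f.st
  | det l => (boundedLists (stAny l) (cntAny l)).image det
  | ndet l => (boundedLists (stAny l) (cntAny l)).image ndet

/-- The union of the sets `st` for the members of a list. -/
noncomputable def stAny : List (Rex K A) → Finset (Rex K A)
  | [] => ∅
  | e :: l => e.st ∪ stAny l
end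

theorem mem_stAny (l : List (Rex K A)) (y : Rex K A) : y ∈ stAny l ↔ ∃ e ∈ l, y ∈ e.st := by
  induction l with
  | nil => simp [stAny]
  | cons e l ih => simp [stAny, ih]

mutual
theorem card_st (e : Rex K A) : e.st.card ≤ e.cnt ∧ 2 ≤ e.cnt ∧ e.hgt ≤ e.cnt := by
  classical
  cases e with
  | const | eps => simp [st, cnt, hgt]
  | pil S => exact ⟨by rw [st]; exact Finset.card_le_two.trans (by simp [cnt]), by simp [cnt], le_rfl⟩
  | ne e =>
    have := card_st e
    have := Finset.card_insert_le (ne e) e.st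
    simp only [st, cnt, hgt]
    omega
  | alt e f =>
    have := card_st e
    have := card_st f
    have := Finset.card_insert_le (alt e f) (e.st ∪ f.st)
    have := Finset.card_union_le e.st f.st
    simp only [st, cnt, hgt]
    omega
  | conc e f =>
    have := card_st e
    have := card_st f
    have := Finset.card_union_le (e.st.image (fun x => conc x f)) f.st
    have := Finset.card_image_le (s := e.st) (f := fun x => conc x f)
    simp only [st, cnt, hgt]
    omega
  | had e f | shuf e f =>
    obtain ⟨h1, h2, h3⟩ := card_st e
    obtain ⟨h4, h5, h6⟩ := card_st f
    simp only [st, cnt, hgt]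
    exact ⟨(Finset.card_image₂_le _ _ _).trans (Nat.mul_le_mul h1 h4), by nlinarith,
      Nat.mul_le_mul h3 h6⟩
  | det l | ndet l =>
    have h1 := card_stAny l
    simp only [st, cnt, hgt]
    refine ⟨?_, ?_, Nat.pow_le_pow_right (by omega) (by omega)⟩
    · refine Finset.card_image_le.trans ((card_boundedLists _ _).trans ?_)
      calc ((stAny l).card + 1) ^ cntAny l ≤ (cntAny l + 2) ^ cntAny l :=
            Nat.pow_le_pow_left (by omega) _
        _ ≤ _ := Nat.pow_le_pow_right (by omega) (by omega)
    · calc 2 ≤ (cntAny l + 2) ^ 1 := by rw [pow_one]; omega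
        _ ≤ _ := Nat.pow_le_pow_right (by omega) (by omega)

theorem card_stAny (l : List (Rex K A)) :
    (stAny l).card ≤ cntAny l := by
  classical
  cases l with
  | nil => simp [stAny, cntAny]
  | cons e l =>
    have := card_st e
    have := card_stAny l
    have := Finset.card_union_le e.st (stAny l)
    simp only [stAny, cntAny]
    omega
end

theorem two_le_cnt (e : Rex K A) : 2 ≤ e.cnt := (card_st e).2.1

theorem hgt_le_cnt (e : Rex K A) : e.hgt ≤ e.cnt := (card_st e).2.2

theorem cnt_le_cntAny {l : List (Rex K A)} {e : Rex K A} (h : e ∈ l) : e.cnt ≤ cntAny l := by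
  induction l with
  | nil => simp at h
  | cons f l ih =>
    simp only [cntAny]
    rcases List.mem_cons.1 h with rfl | h
    · omega
    · have := ih h; omega

theorem length_le_cntAny (l : List (Rex K A)) : l.length ≤ cntAny l := by
  induction l with
  | nil => simp
  | cons f l ih =>
    have := two_le_cnt f
    simp only [cntAny, List.length_cons]
    omega

theorem self_mem_st (e : Rex K A) : e ∈ e.st := by
  classical
  cases e with
  | const | eps | pil | ne | alt => simp [st]
  | had e f | shuf e f =>
    simp only [st]
    exact Finset.mem_image₂_of_mem (self_mem_st e) (self_mem_st f)
  | conc e f =>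
    simp only [st]
    exact Finset.mem_union_left _ (Finset.mem_image_of_mem _ (self_mem_st e))
  | det l | ndet l =>
    simp only [st]
    refine Finset.mem_image_of_mem _ ((mem_boundedLists _ _ _).2
      ⟨length_le_cntAny l, fun x hx => (mem_stAny _ _).2 ⟨x, hx, self_mem_st x⟩⟩)

variable [CommSemiring K]

theorem length_dedup_pdAny_le (a : A) [DecidableEq (Rex K A)] {l l' : List (Rex K A)}
    (h : ∀ y ∈ pdAny a l', y ∈ stAny l) : (pdAny a l').dedup.length ≤ cntAny l := by
  refine le_trans ?_ (card_stAny l)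
  rw [← List.toFinset_card_of_nodup (List.nodup_dedup _)]
  exact Finset.card_le_card fun y hy => h y (by simpa using hy)

/-- `st e` is closed under partial derivatives. -/
theorem pd_mem_st (e x : Rex K A) (hx : x ∈ e.st) (a : A) (y : K × Rex K A) (hy : y ∈ x.pd a) :
    y.2 ∈ e.st := by
  classical
  cases e with
  | const k =>
    obtain rfl : x = const k := by simpa [st] using hx
    simp_all [pd, st]
  | eps =>
    obtain rfl : x = eps := by simpa [st] using hx
    simp [pd] at hy
  | pil S =>
    have hx' : x = pil S ∨ x = eps := by simpa [st] using hx
    rcases hx' with rfl | rfl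
    · rw [pd_pil] at hy
      split_ifs at hy
      · simp_all [st]
      · simp at hy
    · simp [pd] at hy
  | ne e =>
    simp only [st, Finset.mem_insert] at hx ⊢
    rcases hx with rfl | hx
    · exact Or.inr (pd_mem_st e e (self_mem_st e) a y (by simpa [pd] using hy))
    · exact Or.inr (pd_mem_st e x hx a y hy)
  | alt e f =>
    simp only [st, Finset.mem_insert, Finset.mem_union] at hx ⊢
    rcases hx with rfl | hx | hx
    · simp only [pd, List.mem_append] at hy
      rcases hy with hy | hy
      · exact Or.inr (Or.inl (pd_mem_st e e (self_mem_st e) a y hy))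
      · exact Or.inr (Or.inr (pd_mem_st f f (self_mem_st f) a y hy))
    · exact Or.inr (Or.inl (pd_mem_st e x hx a y hy))
    · exact Or.inr (Or.inr (pd_mem_st f x hx a y hy))
  | had e f =>
    simp only [st, Finset.mem_image₂] at hx ⊢
    obtain ⟨x₁, h₁, x₂, h₂, rfl⟩ := hx
    simp only [pd, List.mem_flatMap, List.mem_map] at hy
    obtain ⟨z₁, hz₁, z₂, hz₂, rfl⟩ := hy
    exact ⟨_, pd_mem_st e x₁ h₁ a z₁ hz₁, _, pd_mem_st f x₂ h₂ a z₂ hz₂, rfl⟩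
  | shuf e f =>
    simp only [st, Finset.mem_image₂] at hx ⊢
    obtain ⟨x₁, h₁, x₂, h₂, rfl⟩ := hx
    simp only [pd, List.mem_append, List.mem_map] at hy
    rcases hy with ⟨z, hz, rfl⟩ | ⟨z, hz, rfl⟩
    · exact ⟨_, pd_mem_st e x₁ h₁ a z hz, _, h₂, rfl⟩
    · exact ⟨_, h₁, _, pd_mem_st f x₂ h₂ a z hz, rfl⟩
  | conc e f =>
    simp only [st, Finset.mem_union, Finset.mem_image] at hx ⊢
    rcases hx with ⟨x, hx, rfl⟩ | hx
    · simp only [pd, List.mem_append, List.mem_map] at hy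
      rcases hy with ⟨z, hz, rfl⟩ | hy
      · exact Or.inl ⟨_, pd_mem_st e x hx a z hz, rfl⟩
      · split_ifs at hy
        · obtain ⟨z, hz, rfl⟩ := List.mem_map.1 hy
          exact Or.inr (pd_mem_st f f (self_mem_st f) a z hz)
        · simp at hy
    · exact Or.inr (pd_mem_st f x hx a y hy)
  | det l | ndet l =>
    simp only [st, Finset.mem_image, mem_boundedLists] at hx ⊢
    obtain ⟨l', ⟨hlen, hl'⟩, rfl⟩ := hx
    simp only [pd, List.mem_singleton] at hy
    subst hy
    have key : ∀ y ∈ pdAny a l', y ∈ stAny l := by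
      intro y hy
      obtain ⟨x, hx, z, hz, rfl⟩ := (mem_pdAny a l' y).1 hy
      obtain ⟨e, he, hxe⟩ := (mem_stAny l x).1 (hl' x hx)
      exact (mem_stAny _ _).2 ⟨e, he, pd_mem_st e x hxe a z hz⟩
    exact ⟨_, ⟨length_dedup_pdAny_le a key, fun y hy => key y (List.mem_dedup.1 hy)⟩, rfl⟩

end Rex

/-! ### The number of states of an instantiated formula -/

section FoldBounds

variable {K : Type u} {A : Type}

/-- If `op` at most multiplies the measure `μ`, up to a factor `2`, then `μ` grows on folds like a power
with an exponent linear in the length. -/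
theorem Rex.measure_foldr_le (μ : Rex K A → ℕ) (op : Rex K A → Rex K A → Rex K A)
    (hop : ∀ e f, μ (op e f) ≤ 2 * (μ e * μ f)) (b : Rex K A) (hb : μ b ≤ 2) (g : ℕ)
    (l : List (Rex K A)) (hl : ∀ e ∈ l, μ e ≤ 2 ^ g) :
    μ (l.foldr op b) ≤ 2 ^ ((g + 2) * l.length + 1) := by
  induction l with
  | nil => simpa using hb
  | cons e l ih =>
    have h1 := hl e (by simp)
    have h2 := ih fun x hx => hl x (by simp [hx])
    calc μ ((e :: l).foldr op b) ≤ 2 * (μ e * μ (l.foldr op b)) := hop _ _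
      _ ≤ 2 * (2 ^ g * 2 ^ ((g + 2) * l.length + 1)) :=
          Nat.mul_le_mul_left _ (Nat.mul_le_mul h1 h2)
      _ = 2 ^ ((g + 2) * l.length + 1 + (g + 1)) := by ring
      _ ≤ _ := Nat.pow_le_pow_right (by omega) (by
          rw [List.length_cons, Nat.mul_succ]; omega)

/-- The measure of a sum over all nonempty subsequences is also a power with an exponent linear in the
length, although the tail occurs twice in `sumOp`. -/
theorem Rex.measure_sumOp_le (μ : Rex K A → ℕ) (op : Rex K A → Rex K A → Rex K A)
    (hop : ∀ e f, μ (op e f) ≤ μ e * μ f + μ e + μ f + 1)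
    (halt : ∀ e f, μ (alt e f) ≤ μ e + μ f + 1) (hb : μ (pil []) ≤ 2) (h2 : ∀ e, 2 ≤ μ e) (g : ℕ)
    (l : List (Rex K A)) (hl : ∀ e ∈ l, μ e ≤ 2 ^ g) :
    μ (sumOp op l) ≤ 2 ^ ((g + 3) * l.length + 1) := by
  induction l with
  | nil => simpa [sumOp] using hb
  | cons e l ih =>
    have h1 := hl e (by simp)
    cases l with
    | nil => exact h1.trans (Nat.pow_le_pow_right (by omega) (by simp; omega))
    | cons f l =>
      have h3 := ih fun x hx => hl x (by simp only [List.mem_cons] at hx ⊢; exact Or.inr hx)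
      have h4 := halt (alt e (sumOp op (f :: l))) (op e (sumOp op (f :: l)))
      have h5 := halt e (sumOp op (f :: l))
      have h6 := hop e (sumOp op (f :: l))
      have h7 := h2 e
      have h8 := h2 (sumOp op (f :: l))
      calc μ (sumOp op (e :: f :: l)) ≤ 8 * (μ e * μ (sumOp op (f :: l))) := by
            simp only [sumOp]; nlinarith
        _ ≤ 8 * (2 ^ g * 2 ^ ((g + 3) * (f :: l).length + 1)) :=
            Nat.mul_le_mul_left _ (Nat.mul_le_mul h1 h3)
        _ = 2 ^ ((g + 3) * (f :: l).length + 1 + (g + 3)) := by ring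
        _ ≤ _ := Nat.pow_le_pow_right (by omega) (by
            simp only [List.length_cons, Nat.mul_succ]; omega)

end FoldBounds

/-- The exponents in the bounds for instantiated formulas of size `s`, where `b` is the number of letters
and `R` bounds the numbers of instances. For fixed `b` and `R` this is a polynomial in `s`; its degree
depends on `R` because each quantifier multiplies the exponent by the number of instances, while the
size `max 1 (r i) * s` of the quantified formula grows by a factor of only two if `r i = 2`. -/
def growth (b R s : ℕ) : ℕ := ((b + 4) * s) ^ (5 * R + 2)

section Growth

variable (b R : ℕ)

theorem growth_mono {s t : ℕ} (h : s ≤ t) : growth b R s ≤ growth b R t :=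
  Nat.pow_le_pow_left (Nat.mul_le_mul_left _ h) _

theorem le_growth {s : ℕ} (h : 1 ≤ s) : b + 4 ≤ growth b R s := by
  calc b + 4 ≤ (b + 4) * s := Nat.le_mul_of_pos_right _ h
    _ ≤ _ := Nat.le_self_pow (by omega) _

theorem add_pow_le_pow_add (x y c : ℕ) (hc : c ≠ 0) : x ^ c + y ^ c ≤ (x + y) ^ c := by
  obtain ⟨c, rfl⟩ := Nat.exists_eq_succ_of_ne_zero hc
  calc x ^ (c + 1) + y ^ (c + 1) = x ^ c * x + y ^ c * y := by ring
    _ ≤ (x + y) ^ c * x + (x + y) ^ c * y := by gcongr <;> omega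
    _ = (x + y) ^ (c + 1) := by ring

theorem growth_add (s t : ℕ) : growth b R s + growth b R t ≤ growth b R (s + t) := by
  unfold growth
  rw [Nat.mul_add]
  exact add_pow_le_pow_add _ _ _ (by omega)

theorem growth_succ (s : ℕ) : growth b R s + 4 ≤ growth b R (1 + s) := by
  have := growth_add b R 1 s
  have := le_growth b R (le_refl 1)
  omega

theorem growth_two_mul {s : ℕ} (hs : 1 ≤ s) :
    R * (growth b R s + 3) + 1 ≤ growth b R (2 * s) := by
  have h1 : growth b R (2 * s) = 2 ^ (5 * R + 2) * growth b R s := by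
    unfold growth; rw [← mul_pow]; ring_nf
  have h2 : 5 * R + 2 < 2 ^ (5 * R + 2) := Nat.lt_two_pow_self
  have h3 := le_growth b R hs
  rw [h1]
  nlinarith

theorem sq_le_growth (s : ℕ) (hs : 1 ≤ s) : ((b + 4) * s) ^ 2 ≤ growth b R s :=
  Nat.pow_le_pow_right (by nlinarith) (by omega)

/-- The exponent of a quantified formula with `k` instances. If `k ≥ 2`, the size is at least doubled,
which multiplies `growth` by `2 ^ (5 * R + 2)`; if `k ≤ 1`, the symbol of the quantifier suffices. -/
theorem growth_quantifier {k s z : ℕ} (hk : k ≤ R) (hs : 1 ≤ s) :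
    (growth b R s + 3) * k + 1 ≤ growth b R (1 + z + max 1 k * s) := by
  rcases Nat.lt_or_ge k 2 with h | h
  · have h1 : growth b R (1 + s) ≤ growth b R (1 + z + max 1 k * s) :=
      growth_mono b R (by have : s ≤ max 1 k * s := Nat.le_mul_of_pos_left _ (by omega)
                          omega)
    have h2 := growth_succ b R s
    have h3 : (growth b R s + 3) * k ≤ growth b R s + 3 :=
      (Nat.mul_le_mul_left _ (by omega : k ≤ 1)).trans (by omega)
    omega
  · have h1 : growth b R (2 * s) ≤ growth b R (1 + z + max 1 k * s) :=
      growth_mono b R (by have : 2 * s ≤ max 1 k * s := Nat.mul_le_mul_right _ (by omega)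
                          omega)
    have h2 := growth_two_mul b R hs
    have h3 : (growth b R s + 3) * k ≤ (growth b R s + 3) * R := Nat.mul_le_mul_left _ hk
    nlinarith

end Growth

section InstBounds

variable {n : ℕ} {P : Fin n → Type} {r : Fin n → ℕ} {K : Type u}

theorem PIL.one_le_size (φ : PIL (VarPort P)) : 1 ≤ φ.size := by
  cases φ <;> simp only [size] <;> omega

theorem Zeta.one_le_size (ζ : Zeta (VarPort P)) : 1 ≤ ζ.size := by
  cases ζ with
  | pil φ => exact φ.one_le_size
  | conc => simp only [size]; omega

theorem EPIL.one_le_size (φ : EPIL (VarPort P)) : 1 ≤ φ.size := by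
  cases φ with
  | zeta ζ => exact ζ.one_le_size
  | _ => simp only [size]; omega

theorem Formula.one_le_size (ψ : Formula P) : 1 ≤ ψ.size r := by
  cases ψ with
  | epil φ => exact φ.one_le_size
  | _ => simp only [size]; omega

theorem WFormula.one_le_size (ψ : WFormula P K) : 1 ≤ ψ.size r := by
  cases ψ with
  | formula φ => exact φ.one_le_size
  | const => simp [size]
  | _ => simp only [size]; omega

variable [CommSemiring K] (lets : List (Interaction P r))

/-- The automaton of a concatenation has linearly many states. -/
theorem Zeta.cnt_inst_le (ζ : Zeta (VarPort P)) (σ : Assignment r) :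
    (ζ.inst K lets σ).cnt + 2 ≤ (lets.length + 4) * ζ.size := by
  classical
  induction ζ with
  | pil φ =>
    have h1 := φ.one_le_size
    have h2 : lets.length + 4 ≤ (lets.length + 4) * φ.size := Nat.le_mul_of_pos_right _ h1
    simp only [inst, size]
    split_ifs
    · simp only [Rex.cnt]; omega
    · have := List.length_filter_le (fun a => decide (φ.Sat (active σ) a)) lets
      simp only [Rex.cnt]
      omega
  | conc ζ₁ ζ₂ ih₁ ih₂ =>
    simp only [inst, Rex.cnt, size]
    nlinarith

theorem self_pow_succ_le (t : ℕ) : t ^ t + 1 ≤ 2 ^ (t ^ 2 + 1) := by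
  have h1 : t ^ t ≤ 2 ^ (t ^ 2) := by
    calc t ^ t ≤ (2 ^ t) ^ t := Nat.pow_le_pow_left Nat.lt_two_pow_self.le _
      _ = _ := by rw [← pow_mul, sq]
  have h2 := Nat.one_le_two_pow (n := t ^ 2)
  rw [pow_succ]
  omega

/-- A binary operation on numbers of states, in terms of exponents. -/
theorem two_pow_binary {x y g h k : ℕ} (hx : x ≤ 2 ^ g) (hy : y ≤ 2 ^ h) (hx2 : 2 ≤ x)
    (hy2 : 2 ≤ y) (hk : g + h + 1 ≤ k) : x + y + 1 ≤ 2 ^ k ∧ x * y ≤ 2 ^ k := by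
  have h1 : 2 * (x * y) ≤ 2 ^ k := by
    calc 2 * (x * y) ≤ 2 * (2 ^ g * 2 ^ h) := Nat.mul_le_mul_left _ (Nat.mul_le_mul hx hy)
      _ = 2 ^ (g + h + 1) := by ring
      _ ≤ _ := Nat.pow_le_pow_right (by omega) hk
  constructor <;> nlinarith

theorem two_pow_binary_succ {x y g h k : ℕ} (hx : x ≤ 2 ^ g) (hy : y ≤ 2 ^ h) (hx2 : 2 ≤ x)
    (hy2 : 2 ≤ y) (hk : g + h + 2 ≤ k) : x + y + 1 + 1 ≤ 2 ^ k ∧ x * y + 1 ≤ 2 ^ k := by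
  obtain ⟨h1, h2⟩ := two_pow_binary hx hy hx2 hy2 le_rfl
  have h3 : 2 ^ (g + h + 2) ≤ 2 ^ k := Nat.pow_le_pow_right (by omega) hk
  have h4 := Nat.one_le_two_pow (n := g + h + 1)
  rw [pow_succ] at h3
  omega

variable {R : ℕ}

theorem EPIL.cnt_inst_le (φ : EPIL (VarPort P)) (σ : Assignment r) :
    (φ.inst K lets σ).cnt ≤ 2 ^ growth lets.length R φ.size := by
  induction φ with
  | zeta ζ =>
    have h1 := ζ.cnt_inst_le (K := K) lets σ
    have h2 : (lets.length + 4) * ζ.size ≤ growth lets.length R ζ.size :=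
      Nat.le_self_pow (by omega) _
    have h3 := Nat.lt_two_pow_self (n := growth lets.length R ζ.size)
    simp only [inst, size]
    omega
  | neg ζ =>
    have h1 := ζ.cnt_inst_le (K := K) lets σ
    have h2 := sq_le_growth lets.length R ζ.size ζ.one_le_size
    have h3 := growth_succ lets.length R ζ.size
    simp only [inst, size, Rex.cnt, Rex.cntAny, Nat.add_zero]
    refine (self_pow_succ_le _).trans (Nat.pow_le_pow_right (by omega) ?_)
    have := Nat.pow_le_pow_left h1 2
    omega
  | or φ₁ φ₂ ih₁ ih₂ | conc φ₁ φ₂ ih₁ ih₂ =>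
    have h1 := growth_add lets.length R φ₁.size φ₂.size
    have h2 := growth_succ lets.length R (φ₁.size + φ₂.size)
    rw [← Nat.add_assoc] at h2
    exact (two_pow_binary_succ ih₁ ih₂ (Rex.two_le_cnt _) (Rex.two_le_cnt _)
      (by simp only [size]; omega)).1
  | and φ₁ φ₂ ih₁ ih₂ | shuf φ₁ φ₂ ih₁ ih₂ =>
    have h1 := growth_add lets.length R φ₁.size φ₂.size
    have h2 := growth_succ lets.length R (φ₁.size + φ₂.size)
    rw [← Nat.add_assoc] at h2
    exact (two_pow_binary_succ ih₁ ih₂ (Rex.two_le_cnt _) (Rex.two_le_cnt _)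
      (by simp only [size]; omega)).2

/-- The bounds for folds apply to the two measures on expressions. -/
theorem Rex.measure_fold_le (μ : Rex K (Interaction P r) → ℕ)
    (hμ : μ = Rex.cnt ∨ μ = Rex.hgt) {k g : ℕ} (e : Fin k → Rex K (Interaction P r))
    (he : ∀ j, μ (e j) ≤ 2 ^ g) :
    μ (((List.finRange k).map e).foldr .alt (.pil [])) ≤ 2 ^ ((g + 3) * k + 1) ∧
    μ (((List.finRange k).map e).foldr .had (.const 1)) ≤ 2 ^ ((g + 3) * k + 1) ∧
    μ (((List.finRange k).map e).foldr .conc .eps) ≤ 2 ^ ((g + 3) * k + 1) ∧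
    μ (((List.finRange k).map e).foldr .shuf .eps) ≤ 2 ^ ((g + 3) * k + 1) ∧
    μ (Rex.sumOp .conc ((List.finRange k).map e)) ≤ 2 ^ ((g + 3) * k + 1) ∧
    μ (Rex.sumOp .shuf ((List.finRange k).map e)) ≤ 2 ^ ((g + 3) * k + 1) := by
  have hl : ∀ x ∈ (List.finRange k).map e, μ x ≤ 2 ^ g := by
    intro x hx
    obtain ⟨j, _, rfl⟩ := List.mem_map.1 hx
    exact he j
  have h2 : ∀ e, 2 ≤ μ e := by
    rcases hμ with rfl | rfl
    exacts [Rex.two_le_cnt, Rex.two_le_hgt]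
  have halt : ∀ e f, μ (.alt e f) = μ e + μ f + 1 := by rcases hμ with rfl | rfl <;> exact fun _ _ => rfl
  have hconc : ∀ e f, μ (.conc e f) = μ e + μ f + 1 := by rcases hμ with rfl | rfl <;> exact fun _ _ => rfl
  have hhad : ∀ e f, μ (.had e f) = μ e * μ f := by rcases hμ with rfl | rfl <;> exact fun _ _ => rfl
  have hshuf : ∀ e f, μ (.shuf e f) = μ e * μ f := by rcases hμ with rfl | rfl <;> exact fun _ _ => rfl
  have hp : μ (.pil []) = 2 := by rcases hμ with rfl | rfl <;> rfl
  have hc : μ (.const 1) = 2 := by rcases hμ with rfl | rfl <;> rfl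
  have hε : μ .eps = 2 := by rcases hμ with rfl | rfl <;> rfl
  have hsum : ∀ e f, μ e + μ f + 1 ≤ 2 * (μ e * μ f) := fun e f => by
    have := h2 e; have := h2 f; nlinarith
  have hfold : ∀ op : Rex K (Interaction P r) → Rex K (Interaction P r) → Rex K (Interaction P r),
      (∀ e f, μ (op e f) ≤ 2 * (μ e * μ f)) → ∀ b, μ b ≤ 2 →
      μ (((List.finRange k).map e).foldr op b) ≤ 2 ^ ((g + 3) * k + 1) := fun op hop b hb => by
    refine (Rex.measure_foldr_le μ op hop b hb g _ hl).trans (Nat.pow_le_pow_right (by omega) ?_)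
    rw [List.length_map, List.length_finRange]
    have : (g + 2) * k ≤ (g + 3) * k := Nat.mul_le_mul_right _ (by omega)
    omega
  have hsop : ∀ op : Rex K (Interaction P r) → Rex K (Interaction P r) → Rex K (Interaction P r),
      (∀ e f, μ (op e f) ≤ μ e * μ f + μ e + μ f + 1) →
      μ (Rex.sumOp op ((List.finRange k).map e)) ≤ 2 ^ ((g + 3) * k + 1) := fun op hop => by
    have := Rex.measure_sumOp_le μ op hop (fun e f => (halt e f).le) hp.le h2 g _ hl
    rwa [List.length_map, List.length_finRange] at this
  refine ⟨hfold _ (fun e f => ?_) _ hp.le, hfold _ (fun e f => ?_) _ hc.le,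
    hfold _ (fun e f => ?_) _ hε.le, hfold _ (fun e f => ?_) _ hε.le,
    hsop _ fun e f => ?_, hsop _ fun e f => ?_⟩
  · rw [halt]; exact hsum e f
  · rw [hhad]; omega
  · rw [hconc]; exact hsum e f
  · rw [hshuf]; omega
  · rw [hconc]; have := Nat.zero_le (μ e * μ f); omega
  · rw [hshuf]; omega

/-- The instance of a FOEIL formula has singly exponentially many states. -/
theorem Formula.cnt_inst_le (hR : ∀ i, r i ≤ R) (ψ : Formula P) (σ : Assignment r) :
    (ψ.inst K lets σ).cnt ≤ 2 ^ growth lets.length R (ψ.size r) := by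
  classical
  induction ψ generalizing σ with
  | epil φ => exact φ.cnt_inst_le lets σ
  | eq i x y | neq i x y =>
    have h := le_growth lets.length R (s := 1 + Nat.size x + Nat.size y) (by omega)
    have h1 : 2 ^ 1 ≤ 2 ^ growth lets.length R (1 + Nat.size x + Nat.size y) :=
      Nat.pow_le_pow_right (by omega) (by omega)
    simp only [inst, size]
    split_ifs <;> exact h1
  | or φ₁ φ₂ ih₁ ih₂ | conc φ₁ φ₂ ih₁ ih₂ =>
    have h1 := growth_add lets.length R (φ₁.size r) (φ₂.size r)
    have h2 := growth_succ lets.length R (φ₁.size r + φ₂.size r)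
    rw [← Nat.add_assoc] at h2
    exact (two_pow_binary (ih₁ σ) (ih₂ σ) (Rex.two_le_cnt _) (Rex.two_le_cnt _)
      (by simp only [size]; omega)).1
  | and φ₁ φ₂ ih₁ ih₂ | shuf φ₁ φ₂ ih₁ ih₂ =>
    have h1 := growth_add lets.length R (φ₁.size r) (φ₂.size r)
    have h2 := growth_succ lets.length R (φ₁.size r + φ₂.size r)
    rw [← Nat.add_assoc] at h2
    exact (two_pow_binary (ih₁ σ) (ih₂ σ) (Rex.two_le_cnt _) (Rex.two_le_cnt _)
      (by simp only [size]; omega)).2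
  | ex i x ψ ih | all i x ψ ih | exConc i x ψ ih | allConc i x ψ ih | exShuf i x ψ ih
  | allShuf i x ψ ih =>
    have h := Rex.measure_fold_le Rex.cnt (Or.inl rfl)
      (fun j => ψ.inst K lets (σ.update i x j)) (fun j => ih (σ.update i x j))
    have hg : 2 ^ _ ≤ 2 ^ _ := Nat.pow_le_pow_right (n := 2) (by omega)
      (growth_quantifier lets.length R (hR i) (ψ.one_le_size (r := r)) (z := Nat.size x))
    obtain ⟨h1, h2, h3, h4, h5, h6⟩ := h
    simp only [inst, size]
    refine le_trans ?_ hg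
    assumption

/-- The depth of a state of an instantiated sentence is singly exponential: only `det` squares the
singly exponential bound for FOEIL formulas, and the further operations multiply. -/
theorem WFormula.hgt_inst_le (hR : ∀ i, r i ≤ R) (ψ : WFormula P K) (σ : Assignment r) :
    (ψ.inst lets σ).hgt ≤ 2 ^ (4 * growth lets.length R (ψ.size r)) := by
  induction ψ generalizing σ with
  | const k =>
    have h := le_growth lets.length R (le_refl 1)
    exact Nat.pow_le_pow_right (n := 2) (i := 1) (by omega) (by rw [size]; omega)
  | formula φ =>
    have h := φ.cnt_inst_le (K := K) lets hR σ
    have h2 := Rex.two_le_cnt (φ.inst K lets σ)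
    have h1 := le_growth lets.length R (φ.one_le_size (r := r))
    simp only [inst, size, Rex.hgt, Rex.cntAny, Nat.add_zero]
    set G := growth lets.length R (φ.size r)
    calc ((φ.inst K lets σ).cnt + 2) ^ 2 ≤ (2 ^ (G + 1)) ^ 2 :=
          Nat.pow_le_pow_left (by rw [pow_succ]; omega) _
      _ = 2 ^ ((G + 1) * 2) := by rw [← pow_mul]
      _ ≤ _ := Nat.pow_le_pow_right (by omega) (by omega)
  | plus φ₁ φ₂ ih₁ ih₂ | conc φ₁ φ₂ ih₁ ih₂ =>
    have h1 := growth_add lets.length R (φ₁.size r) (φ₂.size r)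
    have h2 := growth_succ lets.length R (φ₁.size r + φ₂.size r)
    rw [← Nat.add_assoc] at h2
    exact (two_pow_binary (ih₁ σ) (ih₂ σ) (Rex.two_le_hgt _) (Rex.two_le_hgt _)
      (by simp only [size]; omega)).1
  | times φ₁ φ₂ ih₁ ih₂ | shuf φ₁ φ₂ ih₁ ih₂ =>
    have h1 := growth_add lets.length R (φ₁.size r) (φ₂.size r)
    have h2 := growth_succ lets.length R (φ₁.size r + φ₂.size r)
    rw [← Nat.add_assoc] at h2
    exact (two_pow_binary (ih₁ σ) (ih₂ σ) (Rex.two_le_hgt _) (Rex.two_le_hgt _)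
      (by simp only [size]; omega)).2
  | sum i x ψ ih | prod i x ψ ih | sumConc i x ψ ih | prodConc i x ψ ih | sumShuf i x ψ ih
  | prodShuf i x ψ ih =>
    have h := Rex.measure_fold_le Rex.hgt (Or.inr rfl)
      (fun j => ψ.inst lets (σ.update i x j)) (fun j => ih (σ.update i x j))
    have hq := growth_quantifier lets.length R (hR i) (ψ.one_le_size (r := r)) (z := Nat.size x)
    have hg : 2 ^ ((4 * growth lets.length R (ψ.size r) + 3) * r i + 1) ≤
        2 ^ (4 * growth lets.length R (1 + Nat.size x + max 1 (r i) * ψ.size r)) :=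
      Nat.pow_le_pow_right (n := 2) (by omega) (by nlinarith)
    obtain ⟨h1, h2, h3, h4, h5, h6⟩ := h
    simp only [inst, size]
    refine le_trans ?_ hg
    assumption

theorem two_pow_add_le {g h : ℕ} (hg : 1 ≤ g) (hh : 1 ≤ h) : 2 ^ g + 2 ^ h + 1 ≤ 2 ^ (g + h + 1) := by
  have h1 : 2 ^ 1 ≤ 2 ^ g := Nat.pow_le_pow_right (by omega) hg
  have h2 : 2 ^ 1 ≤ 2 ^ h := Nat.pow_le_pow_right (by omega) hh
  rw [pow_succ, pow_add]
  nlinarith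

theorem two_pow_mul_le (g k : ℕ) : (2 ^ g + 3) * k + 1 ≤ 2 ^ ((g + 3) * k + 1) := by
  have h1 := Nat.lt_two_pow_self (n := k)
  have h2 := Nat.one_le_two_pow (n := g)
  induction k with
  | zero => simp
  | succ k ih =>
    have ih := ih Nat.lt_two_pow_self
    have h3 := Nat.one_le_two_pow (n := (g + 3) * k + 1)
    have e : 2 ^ ((g + 3) * (k + 1) + 1) = 2 ^ ((g + 3) * k + 1) * (2 ^ g * 8) := by ring
    rw [e]
    nlinarith [Nat.mul_le_mul h3 h2]

/-- The instance of a wFOEIL formula has doubly exponentially many states: `det` makes the number of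
states exponential in that of the FOEIL formula, and the further operations multiply. -/
theorem WFormula.cnt_inst_le (hR : ∀ i, r i ≤ R) (ψ : WFormula P K) (σ : Assignment r) :
    (ψ.inst lets σ).cnt ≤ 2 ^ 2 ^ (4 * growth lets.length R (ψ.size r)) := by
  have hbin : ∀ φ₁ φ₂ : WFormula P K, 2 ^ (4 * growth lets.length R (φ₁.size r)) +
      2 ^ (4 * growth lets.length R (φ₂.size r)) + 1 ≤
      2 ^ (4 * growth lets.length R (1 + φ₁.size r + φ₂.size r)) := fun φ₁ φ₂ => by
    have h1 := growth_add lets.length R (φ₁.size r) (φ₂.size r)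
    have h2 := growth_succ lets.length R (φ₁.size r + φ₂.size r)
    have h3 := le_growth lets.length R (φ₁.one_le_size (r := r))
    have h4 := le_growth lets.length R (φ₂.one_le_size (r := r))
    rw [← Nat.add_assoc] at h2
    exact (two_pow_add_le (by omega) (by omega)).trans
      (Nat.pow_le_pow_right (by omega) (by omega))
  induction ψ generalizing σ with
  | const k => exact Nat.pow_le_pow_right (n := 2) (i := 1) (by omega) Nat.one_le_two_pow
  | formula φ =>
    have h := φ.cnt_inst_le (K := K) lets hR σ
    have h2 := Rex.two_le_cnt (φ.inst K lets σ)
    have h1 := le_growth lets.length R (φ.one_le_size (r := r))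
    simp only [inst, size, Rex.cnt, Rex.cntAny, Nat.add_zero]
    set G := growth lets.length R (φ.size r)
    have h3 : (φ.inst K lets σ).cnt + 2 ≤ 2 ^ (G + 1) := by rw [pow_succ]; omega
    calc ((φ.inst K lets σ).cnt + 2) ^ ((φ.inst K lets σ).cnt + 2)
        ≤ (2 ^ (G + 1)) ^ ((φ.inst K lets σ).cnt + 2) := Nat.pow_le_pow_left h3 _
      _ ≤ (2 ^ (G + 1)) ^ (2 ^ (G + 1)) :=
          Nat.pow_le_pow_right (Nat.two_pow_pos _) h3
      _ = 2 ^ ((G + 1) * 2 ^ (G + 1)) := by rw [← pow_mul]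
      _ ≤ 2 ^ (2 ^ (G + 1) * 2 ^ (G + 1)) :=
          Nat.pow_le_pow_right (by omega) (Nat.mul_le_mul_right _ Nat.lt_two_pow_self.le)
      _ = 2 ^ 2 ^ (2 * (G + 1)) := by rw [← pow_add, ← two_mul]
      _ ≤ _ := Nat.pow_le_pow_right (by omega) (Nat.pow_le_pow_right (by omega) (by omega))
  | plus φ₁ φ₂ ih₁ ih₂ | conc φ₁ φ₂ ih₁ ih₂ =>
    exact (two_pow_binary (ih₁ σ) (ih₂ σ) (Rex.two_le_cnt _) (Rex.two_le_cnt _) (hbin φ₁ φ₂)).1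
  | times φ₁ φ₂ ih₁ ih₂ | shuf φ₁ φ₂ ih₁ ih₂ =>
    exact (two_pow_binary (ih₁ σ) (ih₂ σ) (Rex.two_le_cnt _) (Rex.two_le_cnt _) (hbin φ₁ φ₂)).2
  | sum i x ψ ih | prod i x ψ ih | sumConc i x ψ ih | prodConc i x ψ ih | sumShuf i x ψ ih
  | prodShuf i x ψ ih =>
    have h := Rex.measure_fold_le Rex.cnt (Or.inl rfl)
      (fun j => ψ.inst lets (σ.update i x j)) (fun j => ih (σ.update i x j))
    have hq := growth_quantifier lets.length R (hR i) (ψ.one_le_size (r := r)) (z := Nat.size x)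
    have hg : 2 ^ ((2 ^ (4 * growth lets.length R (ψ.size r)) + 3) * r i + 1) ≤
        2 ^ 2 ^ (4 * growth lets.length R (1 + Nat.size x + max 1 (r i) * ψ.size r)) :=
      Nat.pow_le_pow_right (n := 2) (by omega) ((two_pow_mul_le _ _).trans
        (Nat.pow_le_pow_right (by omega) (by nlinarith)))
    obtain ⟨h1, h2, h3, h4, h5, h6⟩ := h
    simp only [inst, size]
    refine le_trans ?_ hg
    assumption

end InstBounds

/-! ### Evaluation with time bounds -/

section Evaluation

variable {K : Type u} [CommSemiring K] {F : List Expr} {ρ : List (Val K)} {e f c : Expr}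
  {a b v : Val K} {T T₁ T₂ h : ℕ}

/-- `e` evaluates to `v` in fewer than `T` steps. -/
def Ev (F : List Expr) (ρ : List (Val K)) (e : Expr) (v : Val K) (T : ℕ) : Prop :=
  ∃ t, t + 1 ≤ T ∧ Eval F ρ e v t

/-- The function number `g`, called with `x`, returns `v` in fewer than `T` steps. -/
def Fn (F : List Expr) (g : ℕ) (x v : Val K) (T : ℕ) : Prop :=
  ∃ d, F[g]? = some d ∧ Ev F [x] d v T

/-- `e` evaluates to `v` in fewer than `2 ^ h` steps. As no expression has more than two subexpressions
that are evaluated, `h` behaves like the height of the evaluation tree. -/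
def Eh (F : List Expr) (ρ : List (Val K)) (e : Expr) (v : Val K) (h : ℕ) : Prop :=
  Ev F ρ e v (2 ^ h)

/-- The function number `g`, called with `x`, returns `v` in fewer than `2 ^ h` steps. -/
def Fh (F : List Expr) (g : ℕ) (x v : Val K) (h : ℕ) : Prop := Fn F g x v (2 ^ h)

namespace Ev

theorem mono (H : Ev F ρ e v T₁) (hT : T₁ ≤ T₂) : Ev F ρ e v T₂ :=
  let ⟨t, ht, H⟩ := H; ⟨t, ht.trans hT, H⟩

theorem var0 : Ev F (a :: ρ) (.var 0) a 2 := ⟨1, le_rfl, .var rfl⟩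

theorem nil : Ev F ρ .nil .nil 2 := ⟨1, le_rfl, .nil⟩

theorem zero : Ev F ρ .zero (.atom 0) 2 := ⟨1, le_rfl, .zero⟩

theorem one : Ev F ρ .one (.atom 1) 2 := ⟨1, le_rfl, .one⟩

theorem cons (H₁ : Ev F ρ e a T₁) (H₂ : Ev F ρ f b T₂) :
    Ev F ρ (.cons e f) (.cons a b) (T₁ + T₂) :=
  let ⟨s, hs, H₁⟩ := H₁; let ⟨t, ht, H₂⟩ := H₂; ⟨s + t + 1, by omega, .cons H₁ H₂⟩

theorem fst (H : Ev F ρ e (.cons a b) T) : Ev F ρ (.fst e) a (T + 1) :=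
  let ⟨s, hs, H⟩ := H; ⟨s + 1, by omega, .fst H⟩

theorem snd (H : Ev F ρ e (.cons a b) T) : Ev F ρ (.snd e) b (T + 1) :=
  let ⟨s, hs, H⟩ := H; ⟨s + 1, by omega, .snd H⟩

theorem isPair (H : Ev F ρ e v T) : Ev F ρ (.isPair e) (Val.ofProp v.IsPair) (T + 1) :=
  let ⟨s, hs, H⟩ := H; ⟨s + 1, by omega, .isPair H⟩

theorem add {x y : K} (H₁ : Ev F ρ e (.atom x) T₁) (H₂ : Ev F ρ f (.atom y) T₂) :
    Ev F ρ (.add e f) (.atom (x + y)) (T₁ + T₂) :=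
  let ⟨s, hs, H₁⟩ := H₁; let ⟨t, ht, H₂⟩ := H₂; ⟨s + t + 1, by omega, .add H₁ H₂⟩

theorem mul {x y : K} (H₁ : Ev F ρ e (.atom x) T₁) (H₂ : Ev F ρ f (.atom y) T₂) :
    Ev F ρ (.mul e f) (.atom (x * y)) (T₁ + T₂) :=
  let ⟨s, hs, H₁⟩ := H₁; let ⟨t, ht, H₂⟩ := H₂; ⟨s + t + 1, by omega, .mul H₁ H₂⟩

theorem atomEq (H₁ : Ev F ρ e a T₁) (H₂ : Ev F ρ f b T₂) :
    Ev F ρ (.atomEq e f) (Val.ofProp (a.AtomEq b)) (T₁ + T₂) :=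
  let ⟨s, hs, H₁⟩ := H₁; let ⟨t, ht, H₂⟩ := H₂; ⟨s + t + 1, by omega, .atomEq H₁ H₂⟩

theorem ite_of_ne (H₁ : Ev F ρ c a T₁) (ha : a ≠ .nil) (H₂ : Ev F ρ e v T₂) :
    Ev F ρ (.ite c e f) v (T₁ + T₂) :=
  let ⟨s, hs, H₁⟩ := H₁; let ⟨t, ht, H₂⟩ := H₂; ⟨s + t + 1, by omega, .ite_true H₁ ha H₂⟩

theorem ite_nil (H₁ : Ev F ρ c .nil T₁) (H₂ : Ev F ρ f v T₂) :
    Ev F ρ (.ite c e f) v (T₁ + T₂) :=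
  let ⟨s, hs, H₁⟩ := H₁; let ⟨t, ht, H₂⟩ := H₂; ⟨s + t + 1, by omega, .ite_false H₁ H₂⟩

theorem ite_pos {p : Prop} (hp : p) (H₁ : Ev F ρ c (Val.ofProp p) T₁) (H₂ : Ev F ρ e v T₂) :
    Ev F ρ (.ite c e f) v (T₁ + T₂) :=
  ite_of_ne H₁ (by simp [Val.ofProp, hp]) H₂

theorem ite_neg {p : Prop} (hp : ¬ p) (H₁ : Ev F ρ c (Val.ofProp p) T₁) (H₂ : Ev F ρ f v T₂) :
    Ev F ρ (.ite c e f) v (T₁ + T₂) :=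
  ite_nil (by simpa [Val.ofProp, hp] using H₁) H₂

/-- A test for a pair that succeeds. -/
theorem ite_cons (H₁ : Ev F ρ c (.cons a b) T₁) (H₂ : Ev F ρ e v T₂) :
    Ev F ρ (.ite (.isPair c) e f) v (T₁ + 1 + T₂) := ite_pos trivial H₁.isPair H₂

/-- A test for a pair that fails on the empty tree. -/
theorem ite_end (H₁ : Ev F ρ c .nil T₁) (H₂ : Ev F ρ f v T₂) :
    Ev F ρ (.ite (.isPair c) e f) v (T₁ + 1 + T₂) := ite_neg id H₁.isPair H₂

theorem call {g : ℕ} {x : Val K} (H₁ : Ev F ρ e x T₁) (H₂ : Fn F g x v T₂) :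
    Ev F ρ (.call g e) v (T₁ + T₂) :=
  let ⟨s, hs, H₁⟩ := H₁; let ⟨_, hd, t, ht, H₂⟩ := H₂; ⟨s + t + 1, by omega, .call H₁ hd H₂⟩

end Ev

theorem Fn.mono {g : ℕ} {x : Val K} (H : Fn F g x v T₁) (hT : T₁ ≤ T₂) : Fn F g x v T₂ :=
  let ⟨d, hd, H⟩ := H; ⟨d, hd, H.mono hT⟩

theorem Fh.mono {g k : ℕ} {x : Val K} (H : Fh F g x v h) (hk : h ≤ k) : Fh F g x v k :=
  Fn.mono H (Nat.pow_le_pow_right (by omega) hk)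

namespace Eh

theorem mono {k : ℕ} (H : Eh F ρ e v h) (hk : h ≤ k) : Eh F ρ e v k :=
  Ev.mono H (Nat.pow_le_pow_right (by omega) hk)

theorem two_le : 2 ≤ 2 ^ (h + 1) := by have := Nat.one_le_two_pow (n := h); rw [pow_succ]; omega

theorem join (H : Ev F ρ e v (2 ^ h + 2 ^ h)) : Eh F ρ e v (h + 1) :=
  Ev.mono H (by rw [pow_succ]; omega)

theorem join_one (H : Ev F ρ e v (2 ^ h + 1)) : Eh F ρ e v (h + 1) :=
  Ev.mono H (by have := Nat.one_le_two_pow (n := h); rw [pow_succ]; omega)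

theorem var0 : Eh F (a :: ρ) (.var 0) a (h + 1) := Ev.var0.mono two_le

theorem nil : Eh F ρ .nil .nil (h + 1) := Ev.nil.mono two_le

theorem zero : Eh F ρ .zero (.atom 0) (h + 1) := Ev.zero.mono two_le

theorem one : Eh F ρ .one (.atom 1) (h + 1) := Ev.one.mono two_le

theorem cons (H₁ : Eh F ρ e a h) (H₂ : Eh F ρ f b h) :
    Eh F ρ (.cons e f) (.cons a b) (h + 1) := join (Ev.cons H₁ H₂)

theorem fst (H : Eh F ρ e (.cons a b) h) : Eh F ρ (.fst e) a (h + 1) := join_one (Ev.fst H)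

theorem snd (H : Eh F ρ e (.cons a b) h) : Eh F ρ (.snd e) b (h + 1) := join_one (Ev.snd H)

theorem isPair (H : Eh F ρ e v h) : Eh F ρ (.isPair e) (Val.ofProp v.IsPair) (h + 1) :=
  join_one (Ev.isPair H)

theorem add {x y : K} (H₁ : Eh F ρ e (.atom x) h) (H₂ : Eh F ρ f (.atom y) h) :
    Eh F ρ (.add e f) (.atom (x + y)) (h + 1) := join (Ev.add H₁ H₂)

theorem mul {x y : K} (H₁ : Eh F ρ e (.atom x) h) (H₂ : Eh F ρ f (.atom y) h) :
    Eh F ρ (.mul e f) (.atom (x * y)) (h + 1) := join (Ev.mul H₁ H₂)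

theorem atomEq (H₁ : Eh F ρ e a h) (H₂ : Eh F ρ f b h) :
    Eh F ρ (.atomEq e f) (Val.ofProp (a.AtomEq b)) (h + 1) := join (Ev.atomEq H₁ H₂)

theorem ite_of_ne (ha : a ≠ .nil) (H₁ : Eh F ρ c a h) (H₂ : Eh F ρ e v h) :
    Eh F ρ (.ite c e f) v (h + 1) := join (Ev.ite_of_ne H₁ ha H₂)

theorem ite_nil (H₁ : Eh F ρ c .nil h) (H₂ : Eh F ρ f v h) :
    Eh F ρ (.ite c e f) v (h + 1) := join (Ev.ite_nil H₁ H₂)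

theorem ite_pos {p : Prop} (hp : p) (H₁ : Eh F ρ c (Val.ofProp p) h) (H₂ : Eh F ρ e v h) :
    Eh F ρ (.ite c e f) v (h + 1) := join (Ev.ite_pos hp H₁ H₂)

theorem ite_neg {p : Prop} (hp : ¬ p) (H₁ : Eh F ρ c (Val.ofProp p) h) (H₂ : Eh F ρ f v h) :
    Eh F ρ (.ite c e f) v (h + 1) := join (Ev.ite_neg hp H₁ H₂)

theorem ite_cons (H₁ : Eh F ρ c (.cons a b) h) (H₂ : Eh F ρ e v (h + 1)) :
    Eh F ρ (.ite (.isPair c) e f) v (h + 2) := ite_pos trivial H₁.isPair H₂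

theorem ite_end (H₁ : Eh F ρ c .nil h) (H₂ : Eh F ρ f v (h + 1)) :
    Eh F ρ (.ite (.isPair c) e f) v (h + 2) := ite_neg id H₁.isPair H₂

theorem call {g : ℕ} {x : Val K} (H₁ : Eh F ρ e x h) (H₂ : Fh F g x v h) :
    Eh F ρ (.call g e) v (h + 1) := join (Ev.call H₁ H₂)

end Eh

end Evaluation

/-! ### Depth and injectivity of codes -/

section Depth

variable {K : Type u}

/-- The depth of a tree; leaves have depth `0`. -/
def Val.dep : Val K → ℕ
  | .nil | .atom _ => 0
  | .cons a b => max a.dep b.dep + 1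

theorem Val.dep_list_le (l : List (Val K)) (d : ℕ) (h : ∀ x ∈ l, x.dep ≤ d) :
    (Val.list l).dep ≤ d + l.length := by
  induction l with
  | nil => simp [list, dep]
  | cons a l ih =>
    have h1 := h a (by simp)
    have h2 := ih fun x hx => h x (by simp [hx])
    simp only [list, dep, List.length_cons]
    omega

theorem Val.dep_nat_le (m : ℕ) : (Val.nat m : Val K).dep ≤ Nat.size m + 1 := by
  unfold Val.nat
  refine (Val.dep_list_le _ 1 ?_).trans ?_
  · intro x hx
    obtain ⟨b, _, rfl⟩ := List.mem_map.1 hx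
    cases b <;> simp [dep]
  · rw [List.length_map, Nat.size_eq_bits_len]; omega

theorem Val.list_injective : Function.Injective (Val.list (K := K)) := by
  intro l m h
  induction l generalizing m with
  | nil => cases m with
    | nil => rfl
    | cons => simp [list] at h
  | cons a l ih => cases m with
    | nil => simp [list] at h
    | cons b m =>
      simp only [list, Val.cons.injEq] at h
      rw [h.1, ih h.2]

theorem bits_injective : Function.Injective Nat.bits := by
  intro m
  induction m using Nat.strong_induction_on with
  | _ m ih =>
    intro k h
    have h1 : m.bodd = k.bodd := by rw [Nat.bodd_eq_bits_head, Nat.bodd_eq_bits_head, h]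
    have h2 : m.div2.bits = k.div2.bits := by
      rw [Nat.div2_bits_eq_tail, Nat.div2_bits_eq_tail, h]
    rcases Nat.eq_zero_or_pos m with rfl | hm
    · have : k.size = 0 := by rw [← Nat.size_eq_bits_len, ← h]; rfl
      exact (Nat.size_eq_zero.1 this).symm
    · have h3 := ih m.div2 (by rw [Nat.div2_val]; omega) h2
      rw [← Nat.bodd_add_div2 m, ← Nat.bodd_add_div2 k, h1, h3]

theorem Val.nat_injective : Function.Injective (Val.nat (K := K)) := by
  intro m k h
  have h1 := Val.list_injective h
  have h2 : Function.Injective fun b : Bool => if b then (Val.cons .nil .nil : Val K) else .nil := by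
    intro a b hab
    cases a <;> cases b <;> simp_all
  have h3 := List.map_injective_iff.2 h2 h1
  exact bits_injective h3

end Depth

/-! ### The program -/

namespace Expr

/-- The expression that constructs a given tree (with `0` at the leaves from `K`). -/
def quote {K : Type u} : Val K → Expr
  | .nil => .nil
  | .atom _ => .zero
  | .cons a b => .cons (quote a) (quote b)

/-- The code of a number. It contains no elements of a semiring, so the choice of `PUnit` is irrelevant. -/
def natE (m : ℕ) : Expr := quote (Val.nat m : Val PUnit.{1})

/-- The list of the values of the given expressions. -/
def listE : List Expr → Expr
  | [] => .nil
  | e :: l => .cons e (listE l)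

/-- The syntax tree node with label `m` and the given children. -/
def nodeE (m : ℕ) (l : List Expr) : Expr := .cons (natE m) (listE l)

/-- The truth value `true`; every tree except `nil` counts as true. -/
def tt : Expr := .cons .nil .nil

/-- The argument of a function. The names of its components are read from the right: `A` takes the first
and `D` the second component of a pair. -/
def X : Expr := .var 0
def A : Expr := .fst X
def D : Expr := .snd X
def AA : Expr := .fst A
def DA : Expr := .snd A
def AD : Expr := .fst D
def DD : Expr := .snd D
def ADD : Expr := .fst DD
def DDD : Expr := .snd DD
def ADDD : Expr := .fst DDD
def DDDD : Expr := .snd DDD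

/-- The children of a syntax tree node. -/
def c1 (e : Expr) : Expr := .fst (.snd e)
def c2 (e : Expr) : Expr := .fst (.snd (.snd e))
def c3 (e : Expr) : Expr := .fst (.snd (.snd (.snd e)))

/-- Case distinction on a number `m, m + 1, …`, the value of `t`. -/
def sw (t : Expr) : ℕ → List Expr → Expr
  | _, [] => .nil
  | m, e :: l => .ite (.call 0 (.cons t (natE m))) e (sw t (m + 1) l)

/-- The formal difference `(1, 0)`; the pair `(a, b)` stands for `a - b`. -/
def ringOne : Expr := .cons .one .zero
/-- The formal difference `(0, 0)`. -/
def ringZero : Expr := .cons .zero .zero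

/-- The code of the expression `const 1`. -/
def rexTop : Expr := nodeE 0 [ringOne]
/-- The code of the expression `pil []`, whose series is zero. -/
def rexBot : Expr := nodeE 2 [.nil]
/-- The code of the expression `eps`. -/
def rexEps : Expr := nodeE 1 []

/-- Negation of truth values. -/
def not (e : Expr) : Expr := .ite e .nil tt
/-- Conjunction of truth values. -/
def and (e f : Expr) : Expr := .ite e f .nil
/-- Disjunction of truth values; `f` is evaluated only if `e` fails. -/
def or (e f : Expr) : Expr := .ite e tt f

/-- A call with two arguments, passed as a pair. -/
def call₂ (g : ℕ) (e f : Expr) : Expr := .call g (.cons e f)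
/-- A call with three arguments, passed as nested pairs. -/
def call₃ (g : ℕ) (e f k : Expr) : Expr := .call g (.cons e (.cons f k))

end Expr

namespace Prog

open WFOEIL.Expr

/-- The names `iEq`, `iMem`, … are the positions of the functions in the list `bodies`; the body of the
function `iF` is called `bF`. -/
abbrev iEq := 0
abbrev iMem := 1
abbrev iApp := 2
abbrev iDedup := 3
abbrev iLook := 4
abbrev iPsat := 5
abbrev iFilt := 6
abbrev iTrue := 7
abbrev iZeta := 8
abbrev iEpil := 9
abbrev iForm := 10
abbrev iForms := 11
abbrev iWform := 12
abbrev iWforms := 13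
abbrev iFold := 14
abbrev iSumOp := 15
abbrev iNul := 16
abbrev iNulAny := 17
abbrev iOut := 18
abbrev iMul := 19
abbrev iAdd := 20
abbrev iNeg := 21
abbrev iIsZero := 22
abbrev iMapL := 23
abbrev iMapR := 24
abbrev iHadRow := 25
abbrev iHad := 26
abbrev iScale := 27
abbrev iStates := 28
abbrev iPd := 29
abbrev iPdAny := 30
abbrev iIns := 31
abbrev iAxpy := 32
abbrev iCoef := 33
abbrev iNz := 34
abbrev iRed := 35
abbrev iStep := 36
abbrev iOutV := 37
abbrev iDv := 38
abbrev iDall := 39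
abbrev iLoop := 40
abbrev iLoopStep := 41

/-- `(a, b) ↦ (a = b)`. The built-in test compares only leaves from `K`; trees are compared
recursively. -/
def bEq : Expr :=
  .ite (.isPair A)
    (.ite (.isPair D)
      (.ite (call₂ iEq AA AD) (call₂ iEq DA DD) .nil) .nil)
    (.ite A (.atomEq A D) (.ite D .nil tt))

/-- `(x, l) ↦ (x ∈ l)` -/
def bMem : Expr :=
  .ite (.isPair D) (.ite (call₂ iEq A AD) tt (call₂ iMem A DD)) .nil

/-- `(l, m) ↦ l ++ m` -/
def bApp : Expr := .ite (.isPair A) (.cons AA (call₂ iApp DA D)) D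

/-- `l ↦ l.dedup` -/
def bDedup : Expr :=
  .ite (.isPair X) (.ite (call₂ iMem A D) (.call iDedup D) (.cons A (.call iDedup D))) .nil

/-- The value of a key in an association list. -/
def bLook : Expr :=
  .ite (.isPair D) (.ite (call₂ iEq A (.fst AD)) (.snd AD) (call₂ iLook A DD)) .nil

/-- `(φ, σ, a) ↦ φ.Sat (active σ) a` -/
def bPsat : Expr :=
  sw (.fst A) 0 [
    tt,
    .ite (call₂ iLook (.cons (.fst (c1 A)) (c2 (c1 A))) AD)
      (call₂ iMem (.cons (.fst (c1 A)) (.cons (c1 (c1 A))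
        (call₂ iLook (.cons (.fst (c1 A)) (c2 (c1 A))) AD))) (.snd DD)) .nil,
    not (call₂ iPsat (c1 A) D),
    or (call₂ iPsat (c1 A) D) (call₂ iPsat (c2 A) D)]

/-- `(φ, σ, l) ↦ l.filter (φ.Sat (active σ))` -/
def bFilt : Expr :=
  .ite (.isPair DD)
    (.ite (call₃ iPsat A AD ADD) (.cons ADD (call₃ iFilt A AD DDD)) (call₃ iFilt A AD DDD)) .nil

/-- `φ ↦ φ.IsTrue` -/
def bTrue : Expr :=
  sw A 0 [tt, .nil, sw (.fst (c1 X)) 0 [.nil, .nil, .call iTrue (c1 (c1 X)), .nil], .nil]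

/-- `(ζ, σ, letters, instances) ↦ ζ.inst` -/
def bZeta : Expr :=
  sw (.fst A) 0 [
    .ite (.call iTrue (c1 A)) rexTop (nodeE 2 [call₃ iFilt (c1 A) AD ADD]),
    nodeE 3 [nodeE 6 [call₂ iZeta (c1 A) D, call₂ iZeta (c2 A) D]]]

/-- `(φ, σ, letters, instances) ↦ φ.inst` -/
def bEpil : Expr :=
  sw (.fst A) 0 [
    call₂ iZeta (c1 A) D,
    nodeE 3 [nodeE 9 [listE [call₂ iZeta (c1 A) D]]],
    nodeE 3 [nodeE 4 [call₂ iEpil (c1 A) D, call₂ iEpil (c2 A) D]],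
    nodeE 3 [nodeE 5 [call₂ iEpil (c1 A) D, call₂ iEpil (c2 A) D]],
    nodeE 3 [nodeE 6 [call₂ iEpil (c1 A) D, call₂ iEpil (c2 A) D]],
    nodeE 3 [nodeE 7 [call₂ iEpil (c1 A) D, call₂ iEpil (c2 A) D]]]

/-- The instances of the scope of a quantifier; `g` is the function for its formulas. -/
def insts (g : ℕ) : Expr :=
  call₃ g (c3 A) (.cons (c1 A) (c2 A)) (.cons (call₂ iLook (c1 A) DDD) D)

/-- `(ψ, σ, letters, instances) ↦ ψ.inst` for FOEIL formulas -/
def bForm : Expr :=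
  sw (.fst A) 0 [
    call₂ iEpil (c1 A) D,
    .ite (call₂ iEq (call₂ iLook (.cons (c1 A) (c2 A)) AD) (call₂ iLook (.cons (c1 A) (c3 A)) AD))
      rexTop rexBot,
    .ite (call₂ iEq (call₂ iLook (.cons (c1 A) (c2 A)) AD) (call₂ iLook (.cons (c1 A) (c3 A)) AD))
      rexBot rexTop,
    nodeE 4 [call₂ iForm (c1 A) D, call₂ iForm (c2 A) D],
    nodeE 5 [call₂ iForm (c1 A) D, call₂ iForm (c2 A) D],
    nodeE 6 [call₂ iForm (c1 A) D, call₂ iForm (c2 A) D],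
    nodeE 7 [call₂ iForm (c1 A) D, call₂ iForm (c2 A) D],
    call₃ iFold (natE 4) rexBot (insts iForms),
    call₃ iFold (natE 5) rexTop (insts iForms),
    call₂ iSumOp (natE 6) (insts iForms),
    call₃ iFold (natE 6) rexEps (insts iForms),
    call₂ iSumOp (natE 7) (insts iForms),
    call₃ iFold (natE 7) rexEps (insts iForms)]

/-- The list of the instances of a formula; `g` is the function for one instance, `h` this function. -/
def instList (g h : ℕ) : Expr :=
  .ite (.isPair ADD)
    (.cons (call₃ g A (.cons (.cons AD (.fst ADD)) ADDD) DDDD)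
      (call₃ h A AD (.cons (.snd ADD) DDD))) .nil

/-- `(ψ, σ, letters, instances) ↦ ψ.inst` for wFOEIL formulas -/
def bWform : Expr :=
  sw (.fst A) 0 [
    nodeE 0 [.cons (c1 A) .zero],
    nodeE 8 [listE [call₂ iForm (c1 A) D]],
    nodeE 4 [call₂ iWform (c1 A) D, call₂ iWform (c2 A) D],
    nodeE 5 [call₂ iWform (c1 A) D, call₂ iWform (c2 A) D],
    nodeE 6 [call₂ iWform (c1 A) D, call₂ iWform (c2 A) D],
    nodeE 7 [call₂ iWform (c1 A) D, call₂ iWform (c2 A) D],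
    call₃ iFold (natE 4) rexBot (insts iWforms),
    call₃ iFold (natE 5) rexTop (insts iWforms),
    call₂ iSumOp (natE 6) (insts iWforms),
    call₃ iFold (natE 6) rexEps (insts iWforms),
    call₂ iSumOp (natE 7) (insts iWforms),
    call₃ iFold (natE 7) rexEps (insts iWforms)]

/-- `(m, b, l) ↦ l.foldr op b`, where `m` is the label of `op` -/
def bFold : Expr :=
  .ite (.isPair DD) (.cons A (listE [ADD, call₃ iFold A AD DDD])) AD

/-- `(m, l) ↦ sumOp op l`, where `m` is the label of `op` -/
def bSumOp : Expr :=
  .ite (.isPair D)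
    (.ite (.isPair DD)
      (nodeE 4 [nodeE 4 [AD, call₂ iSumOp A DD], .cons A (listE [AD, call₂ iSumOp A DD])]) AD)
    rexBot

/-- `e ↦ e.nul` -/
def bNul : Expr :=
  sw A 0 [tt, tt, .nil, .nil,
    or (.call iNul (c1 X)) (.call iNul (c2 X)),
    and (.call iNul (c1 X)) (.call iNul (c2 X)),
    and (.call iNul (c1 X)) (.call iNul (c2 X)),
    and (.call iNul (c1 X)) (.call iNul (c2 X)),
    .call iNulAny (c1 X),
    not (.call iNulAny (c1 X))]

/-- `l ↦ nulAny l` -/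
def bNulAny : Expr := .ite (.isPair X) (or (.call iNul A) (.call iNulAny D)) .nil

/-- `e ↦ e.out` -/
def bOut : Expr :=
  sw A 0 [c1 X, ringOne, ringZero, ringZero,
    call₂ iAdd (.call iOut (c1 X)) (.call iOut (c2 X)),
    call₂ iMul (.call iOut (c1 X)) (.call iOut (c2 X)),
    call₂ iMul (.call iOut (c1 X)) (.call iOut (c2 X)),
    call₂ iMul (.call iOut (c1 X)) (.call iOut (c2 X)),
    .ite (.call iNulAny (c1 X)) ringOne ringZero,
    .ite (.call iNulAny (c1 X)) ringZero ringOne]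

/-- `(a - b) * (c - d)` -/
def bMul : Expr :=
  .cons (.add (.mul AA AD) (.mul DA DD)) (.add (.mul AA DD) (.mul DA AD))

/-- `(a - b) + (c - d)` -/
def bAdd : Expr := .cons (.add AA AD) (.add DA DD)

/-- `-(a - b)` -/
def bNeg : Expr := .cons D A

/-- `a - b = 0` -/
def bIsZero : Expr := .atomEq A D

/-- `(m, f, v)`: replaces the states `e` in `v` by `op e f`, where `m` is the label of `op`. -/
def bMapL : Expr :=
  .ite (.isPair DD)
    (.cons (.cons (.fst ADD) (.cons A (listE [.snd ADD, AD]))) (call₃ iMapL A AD DDD)) .nil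

/-- `(m, e, v)`: replaces the states `f` in `v` by `op e f`, where `m` is the label of `op`. -/
def bMapR : Expr :=
  .ite (.isPair DD)
    (.cons (.cons (.fst ADD) (.cons A (listE [AD, .snd ADD]))) (call₃ iMapR A AD DDD)) .nil

/-- `(x, u)`: the Hadamard products of the entry `x` with the entries of `u`. -/
def bHadRow : Expr :=
  .ite (.isPair D)
    (.cons (.cons (call₂ iMul AA (.fst AD)) (nodeE 5 [DA, .snd AD])) (call₂ iHadRow A DD)) .nil

/-- `(v, u)`: the Hadamard products of the entries. -/
def bHad : Expr :=
  .ite (.isPair A) (call₂ iApp (call₂ iHadRow AA D) (call₂ iHad DA D)) .nil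

/-- `(c, v) ↦ c • v` -/
def bScale : Expr :=
  .ite (.isPair D)
    (.cons (.cons (call₂ iMul A (.fst AD)) (.snd AD)) (call₂ iScale A DD)) .nil

/-- `(v, l)`: the states of `v`, followed by `l`. -/
def bStates : Expr := .ite (.isPair A) (.cons (.snd AA) (call₂ iStates DA D)) D

/-- `(a, e) ↦ e.pd a` -/
def bPd : Expr :=
  sw AD 0 [
    listE [.cons ringOne D],
    .nil,
    .ite (call₂ iMem A (c1 D)) (listE [.cons ringOne rexEps]) .nil,
    call₂ iPd A (c1 D),
    call₂ iApp (call₂ iPd A (c1 D)) (call₂ iPd A (c2 D)),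
    call₂ iHad (call₂ iPd A (c1 D)) (call₂ iPd A (c2 D)),
    call₂ iApp (call₃ iMapL (natE 6) (c2 D) (call₂ iPd A (c1 D)))
      (.ite (.call iNul (c1 D)) (call₂ iScale (.call iOut (c1 D)) (call₂ iPd A (c2 D))) .nil),
    call₂ iApp (call₃ iMapL (natE 7) (c2 D) (call₂ iPd A (c1 D)))
      (call₃ iMapR (natE 7) (c1 D) (call₂ iPd A (c2 D))),
    listE [.cons ringOne (nodeE 8 [.call iDedup (call₂ iPdAny A (c1 D))])],
    listE [.cons ringOne (nodeE 9 [.call iDedup (call₂ iPdAny A (c1 D))])]]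

/-- `(a, l) ↦ pdAny a l` -/
def bPdAny : Expr :=
  .ite (.isPair D) (call₂ iStates (call₂ iPd A AD) (call₂ iPdAny A DD)) .nil

/-- `(x, v)`: adds the entry `x` to the vector `v`. -/
def bIns : Expr :=
  .ite (.isPair D)
    (.ite (call₂ iEq DA (.snd AD))
      (.cons (.cons (call₂ iAdd AA (.fst AD)) (.snd AD)) DD)
      (.cons AD (call₂ iIns A DD)))
    (.cons A .nil)

/-- `(c, v, u) ↦ c • v + u` -/
def bAxpy : Expr :=
  .ite (.isPair AD)
    (call₂ iIns (.cons (call₂ iMul A (.fst (.fst AD))) (.snd (.fst AD)))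
      (call₃ iAxpy A (.snd AD) DD)) DD

/-- `(v, p)`: the coefficient of the vector `v` at the state `p`. -/
def bCoef : Expr :=
  .ite (.isPair A)
    (.ite (call₂ iEq (.snd AA) D) (call₂ iAdd (.fst AA) (call₂ iCoef DA D)) (call₂ iCoef DA D))
    ringZero

/-- Omits the entries with coefficient zero. -/
def bNz : Expr :=
  .ite (.isPair X) (.ite (.call iIsZero AA) (.call iNz D) (.cons A (.call iNz D))) .nil

/-- `(v, B)`: reduces `v` by the vectors in `B`, beginning with the last. -/
def bRed : Expr := .ite (.isPair D) (call₂ iStep (call₂ iRed A DD) AD) A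

/-- `(v, b)`: eliminates in `v` the first state of `b`. -/
def bStep : Expr :=
  call₃ iAxpy (.call iNeg (call₂ iCoef A (.snd AD))) D (call₂ iScale (.fst AD) A)

/-- The value of a vector on the empty word. -/
def bOutV : Expr :=
  .ite (.isPair X) (call₂ iAdd (call₂ iMul AA (.call iOut DA)) (.call iOutV D)) ringZero

/-- `(a, v)`: the derivative of the vector `v`. -/
def bDv : Expr :=
  .ite (.isPair D)
    (call₃ iAxpy (.fst AD) (call₂ iPd A (.snd AD)) (call₂ iDv A DD)) .nil

/-- `(letters, v, W)`: the derivatives of `v`, followed by `W`. -/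
def bDall : Expr :=
  .ite (.isPair A) (.cons (call₂ iDv AA AD) (call₂ iDall DA D)) DD

/-- `(letters, W, B)`: whether all vectors in `W` are null, given the basis `B`. -/
def bLoop : Expr :=
  .ite (.isPair AD) (call₂ iLoopStep (.call iNz (call₂ iRed (.fst AD) DD)) X) tt

/-- `(v, letters, W, B)`: one step of the loop, where `v` is the reduced first vector of `W`. -/
def bLoopStep : Expr :=
  .ite (.isPair A)
    (.ite (.call iIsZero (.call iOutV A))
      (call₃ iLoop AD (call₃ iDall AD A (.snd ADD)) (.cons A DDD)) .nil)
    (call₃ iLoop AD (.snd ADD) DDD)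

/-- The functions of the program. The arguments `(σ, letters, instances)` of the functions for
instantiation are the association list of the assignment, the list of all letters, and the association
list of the instances of each type. Association lists and vectors are lists of pairs. -/
def bodies : List Expr :=
  [bEq, bMem, bApp, bDedup, bLook, bPsat, bFilt, bTrue, bZeta, bEpil, bForm,
    instList iForm iForms, bWform, instList iWform iWforms, bFold, bSumOp, bNul, bNulAny, bOut,
    bMul, bAdd, bNeg, bIsZero, bMapL, bMapR, bHadRow, bHad, bScale, bStates, bPd, bPdAny, bIns,
    bAxpy, bCoef, bNz, bRed, bStep, bOutV, bDv, bDall, bLoop, bLoopStep]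

end Prog

/-! ### Lists and tables -/

section Basics

theorem Val.ofProp_true {K : Type u} {p : Prop} (hp : p) :
    (Val.ofProp p : Val K) = Val.ofProp True := by
  simp [ofProp, hp]

theorem Val.ofProp_false {K : Type u} {p : Prop} (hp : ¬ p) : (Val.ofProp p : Val K) = .nil := by
  simp [ofProp, hp]

open WFOEIL.Expr Prog

variable {K : Type u} [CommSemiring K] {ρ : List (Val K)} {h k m : ℕ} {e f e' : Expr}
  {a b c d x y z v w : Val K}

/-- Here and below, `fh_f` states what the function `iF` of the program computes, with a bound for the
height of the evaluation. In the proofs, a variable part `X` of the bound is abstracted, so that the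
heights of subexpressions are of the form `X + c` with a numeral `c` and unify without arithmetic. -/
theorem Fh.intro {g : ℕ} {d : Expr} (hd : bodies[g]? = some d) (hk : h ≤ k)
    (H : Eh bodies [x] d v h) : Fh bodies g x v k :=
  ⟨d, hd, H.mono hk⟩

namespace Eh

theorem X : Eh bodies [x] X x (h + 1) := var0
theorem A : Eh bodies [.cons a b] A a (h + 2) := fst X
theorem D : Eh bodies [.cons a b] D b (h + 2) := snd X
theorem AA : Eh bodies [.cons (.cons a b) c] AA a (h + 3) := fst A
theorem DA : Eh bodies [.cons (.cons a b) c] DA b (h + 3) := snd A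
theorem AD : Eh bodies [.cons a (.cons b c)] AD b (h + 3) := fst D
theorem DD : Eh bodies [.cons a (.cons b c)] DD c (h + 3) := snd D
theorem ADD : Eh bodies [.cons a (.cons b (.cons c d))] ADD c (h + 4) := fst DD
theorem DDD : Eh bodies [.cons a (.cons b (.cons c d))] DDD d (h + 4) := snd DD
theorem ADDD : Eh bodies [.cons a (.cons b (.cons c (.cons d x)))] ADDD d (h + 5) := fst DDD
theorem DDDD : Eh bodies [.cons a (.cons b (.cons c (.cons d x)))] DDDD x (h + 5) := snd DDD

theorem c1 {l : List (Val K)} (H : Eh bodies ρ e (.node m (a :: l)) h) :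
    Eh bodies ρ (c1 e) a (h + 2) := fst (snd H)

theorem c2 {l : List (Val K)} (H : Eh bodies ρ e (.node m (a :: b :: l)) h) :
    Eh bodies ρ (c2 e) b (h + 3) := fst (snd (snd H))

theorem c3 {l : List (Val K)} (H : Eh bodies ρ e (.node m (a :: b :: c :: l)) h) :
    Eh bodies ρ (c3 e) c (h + 4) := fst (snd (snd (snd H)))

theorem call₂ {g : ℕ} (H : Fh bodies g (.cons a b) v k) (hk : k ≤ h + 1) (he : Eh bodies ρ e a h)
    (hf : Eh bodies ρ f b h) : Eh bodies ρ (call₂ g e f) v (h + 2) :=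
  call (cons he hf) (H.mono hk)

theorem call₃ {g : ℕ} (H : Fh bodies g (.cons a (.cons b d)) v k) (hk : k ≤ h + 2)
    (he : Eh bodies ρ e a h) (hf : Eh bodies ρ f b h) (hc : Eh bodies ρ e' d h) :
    Eh bodies ρ (call₃ g e f e') v (h + 3) :=
  call (cons (he.mono (by omega)) (cons hf hc)) (H.mono hk)

theorem call₁ {g : ℕ} (H : Fh bodies g a v k) (hk : k ≤ h) (he : Eh bodies ρ e a h) :
    Eh bodies ρ (.call g e) v (h + 1) :=
  call he (H.mono hk)

theorem tt : Eh bodies ρ Expr.tt (Val.ofProp True) (h + 2) := by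
  have : (Val.ofProp True : Val K) = .cons .nil .nil := by simp [Val.ofProp]
  rw [this]
  exact cons nil nil

theorem not {p : Prop} (H : Eh bodies ρ e (.ofProp p) h) :
    Eh bodies ρ (Expr.not e) (.ofProp ¬ p) (h + 3) := by
  by_cases hp : p
  · rw [Val.ofProp_false (not_not.2 hp)]
    exact ite_pos hp (H.mono (by omega)) nil
  · rw [Val.ofProp_true hp]
    exact ite_neg hp (H.mono (by omega)) tt

theorem or {p q : Prop} (H : Eh bodies ρ e (.ofProp p) h) (H' : Eh bodies ρ f (.ofProp q) h) :
    Eh bodies ρ (Expr.or e f) (.ofProp (p ∨ q)) (h + 3) := by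
  by_cases hp : p
  · rw [Val.ofProp_true (Or.inl hp)]
    exact ite_pos hp (H.mono (by omega)) tt
  · rw [or_iff_right hp |> propext]
    exact ite_neg hp (H.mono (by omega)) (H'.mono (by omega))

theorem and {p q : Prop} (H : Eh bodies ρ e (.ofProp p) h) (H' : Eh bodies ρ f (.ofProp q) h) :
    Eh bodies ρ (Expr.and e f) (.ofProp (p ∧ q)) (h + 3) := by
  by_cases hp : p
  · rw [and_iff_right hp |> propext]
    exact ite_pos hp (H.mono (by omega)) (H'.mono (by omega))
  · rw [Val.ofProp_false fun hpq => hp hpq.1]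
    exact ite_neg hp (H.mono (by omega)) nil

theorem natE (hm : m < 16) : Eh bodies ρ (natE m) (.nat m) (h + 7) := by
  have key : ∀ l : List Bool, Eh bodies ρ (quote (Val.list
      (l.map fun b => if b then .cons .nil .nil else .nil) : Val PUnit.{1}))
      (Val.list (l.map fun b => if b then .cons .nil .nil else .nil)) (h + l.length + 3) := by
    intro l
    induction l with
    | nil => exact nil
    | cons b l ih =>
      refine Eh.mono (cons (h := h + l.length + 3) ?_ ih) (by simp only [List.length_cons]; omega)
      cases b
      · exact nil
      · exact cons nil nil
  refine (key m.bits).mono ?_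
  have : m.size ≤ 4 := Nat.size_le.2 (by omega)
  rw [Nat.size_eq_bits_len]
  omega

theorem node₀ (hm : m < 16) : Eh bodies ρ (nodeE m []) (.node m []) (h + 8) :=
  cons (natE hm) nil

theorem node₁ (hm : m < 16) (H : Eh bodies ρ e a (h + 6)) :
    Eh bodies ρ (nodeE m [e]) (.node m [a]) (h + 8) :=
  cons (natE hm) (cons H nil)

theorem node₂ (hm : m < 16) (H : Eh bodies ρ e a (h + 6)) (H' : Eh bodies ρ f b (h + 6)) :
    Eh bodies ρ (nodeE m [e, f]) (.node m [a, b]) (h + 9) :=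
  cons (natE hm) (cons (H.mono (by omega)) (cons H' nil))

theorem list₁ (H : Eh bodies ρ e a (h + 1)) : Eh bodies ρ (listE [e]) (.list [a]) (h + 2) :=
  cons H nil

theorem list₂ (H : Eh bodies ρ e a (h + 1)) (H' : Eh bodies ρ f b (h + 1)) :
    Eh bodies ρ (listE [e, f]) (.list [a, b]) (h + 3) :=
  cons (H.mono (by omega)) (cons H' nil)

end Eh

/-- A tree is compared along its paths, so the height of the evaluation is linear in its depth. -/
theorem fh_eq (a b : Val K) : Fh bodies iEq (.cons a b) (.ofProp (a = b)) (12 * a.dep + 12) := by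
  induction a generalizing b with
  | nil =>
    refine Fh.intro (h := 0 + 12) rfl (by omega) ?_
    refine Eh.ite_end Eh.A (Eh.ite_nil Eh.A ?_)
    cases b with
    | nil =>
      rw [Val.ofProp_true rfl]
      exact Eh.ite_nil Eh.D Eh.tt
    | atom | cons =>
      rw [Val.ofProp_false (by simp)]
      exact Eh.ite_of_ne (by simp) Eh.D Eh.nil
  | atom k =>
    refine Fh.intro (h := 0 + 12) rfl (by omega) ?_
    refine Eh.ite_neg (p := (Val.atom k).IsPair) id (Eh.isPair Eh.A)
      (Eh.ite_of_ne (by simp) Eh.A ?_)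
    have : (Val.atom k = b) = (Val.atom k).AtomEq b := by cases b <;> simp [Val.AtomEq]
    rw [this]
    exact Eh.atomEq Eh.A Eh.D
  | cons a a' ih ih' =>
    obtain ⟨X, hX⟩ : ∃ X, X = 12 * max a.dep a'.dep + 12 := ⟨_, rfl⟩
    refine Fh.intro (h := X + 12) rfl (by simp only [Val.dep]; omega) ?_
    refine Eh.ite_cons Eh.A ?_
    cases b with
    | nil =>
      rw [Val.ofProp_false (by simp)]
      exact Eh.ite_end Eh.D Eh.nil
    | atom k =>
      rw [Val.ofProp_false (by simp)]
      exact Eh.ite_neg (p := (Val.atom k).IsPair) id (Eh.isPair Eh.D) Eh.nil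
    | cons b b' =>
      refine Eh.ite_cons Eh.D ?_
      have h1 : Eh bodies [.cons (.cons a a') (.cons b b')] (call₂ iEq Expr.AA Expr.AD) _ (X + 9) :=
        Eh.call₂ (ih b) (by omega) Eh.AA Eh.AD
      by_cases hab : a = b
      · refine Eh.ite_pos hab h1 ?_
        simp only [Val.cons.injEq, hab, true_and]
        exact Eh.call₂ (ih' b') (by omega) Eh.DA Eh.DD
      · refine Eh.ite_neg hab h1 ?_
        rw [Val.ofProp_false (by simp [hab])]
        exact Eh.nil

theorem Eh.sw_aux (l : List Expr) (i j : ℕ) (hl : l[j]? = some e) (hj : i + j < 16)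
    (ht : Eh bodies ρ f (.nat (i + j)) h) (he : Eh bodies ρ e v h) (hh : 100 ≤ h) :
    Eh bodies ρ (sw f i l) v (h + j + 3) := by
  have hd : (Val.nat (i + j) : Val K).dep ≤ 5 :=
    (Val.dep_nat_le _).trans (Nat.succ_le_succ (Nat.size_le.2 (by omega)))
  have hc : Eh bodies ρ (.call 0 (.cons f (Expr.natE i))) (.ofProp ((Val.nat (i + j) : Val K) = .nat i))
      (h + 2) :=
    Eh.call₂ (fh_eq _ _) (by omega) ht ((Eh.natE (h := 0) (m := _) (by omega)).mono (by omega))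
  induction l generalizing i j with
  | nil => simp at hl
  | cons e' l ih =>
    cases j with
    | zero =>
      obtain rfl : e' = e := by simpa using hl
      exact Eh.ite_pos rfl hc (he.mono (by omega))
    | succ j =>
      have hne : ¬ (Val.nat (i + (j + 1)) : Val K) = .nat i := fun h0 => by
        have := Val.nat_injective h0
        omega
      refine Eh.ite_neg hne (hc.mono (by omega)) ?_
      have e1 : i + 1 + j = i + (j + 1) := by omega
      refine Eh.mono (ih (i + 1) j (by simpa using hl) (by omega) (by rwa [e1]) (by rwa [e1]) ?_)
        (by omega)
      rw [e1]
      exact Eh.call₂ (fh_eq _ _) (by omega) ht ((Eh.natE (h := 0) (m := _) (by omega)).mono (by omega))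

/-- Selection of the case with the number `j`. -/
theorem Eh.sw {l : List Expr} (j : ℕ) (hl : l[j]? = some e) (hj : j < 16) (hh : 100 ≤ h)
    (ht : Eh bodies ρ f (.nat j) h) (he : Eh bodies ρ e v h) :
    Eh bodies ρ (sw f 0 l) v (h + 20) :=
  (Eh.sw_aux l 0 j hl (by omega) (by rwa [Nat.zero_add]) he hh).mono (by omega)

theorem fh_mem (x : Val K) (l : List (Val K)) :
    Fh bodies iMem (.cons x (.list l)) (.ofProp (x ∈ l)) (12 * x.dep + 20 * l.length + 40) := by
  induction l with
  | nil =>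
    refine Fh.intro (h := 12 * x.dep + 12) rfl (by omega) ?_
    rw [Val.ofProp_false (by simp)]
    exact Eh.ite_end Eh.D Eh.nil
  | cons y l ih =>
    obtain ⟨X, hX⟩ : ∃ X, X = 12 * x.dep + 20 * l.length + 40 := ⟨_, rfl⟩
    refine Fh.intro (h := X + 20) rfl (by simp only [List.length_cons]; omega) ?_
    refine Eh.ite_cons Eh.D ?_
    have h1 : Eh bodies [.cons x (.list (y :: l))] (call₂ iEq Expr.A Expr.AD) _ (X + 18) :=
      Eh.call₂ (fh_eq x y) (by omega) Eh.A Eh.AD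
    by_cases hxy : x = y
    · refine Eh.ite_pos hxy h1 ?_
      rw [Val.ofProp_true (by simp [hxy])]
      exact Eh.tt
    · refine Eh.ite_neg hxy h1 ?_
      simp only [List.mem_cons, hxy, false_or]
      exact Eh.call₂ ih (by omega) Eh.A Eh.DD

theorem fh_app (l m : List (Val K)) :
    Fh bodies iApp (.cons (.list l) (.list m)) (.list (l ++ m)) (20 * l.length + 20) := by
  induction l with
  | nil => exact Fh.intro (h := 0 + 10) rfl (by omega) (Eh.ite_end Eh.A Eh.D)
  | cons y l ih =>
    refine Fh.intro (h := 20 * l.length + 20 + 20) rfl (by simp only [List.length_cons]; omega) ?_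
    exact Eh.ite_cons Eh.A (Eh.cons Eh.AA (Eh.call₂ ih (by omega) Eh.DA Eh.D))

theorem fh_dedup [DecidableEq (Val K)] (l : List (Val K)) (N : ℕ) (hl : ∀ x ∈ l, x.dep ≤ N) :
    Fh bodies iDedup (.list l) (.list l.dedup) (12 * N + 20 * l.length + 60) := by
  induction l with
  | nil => exact Fh.intro (h := 0 + 10) rfl (by omega) (Eh.ite_end Eh.X Eh.nil)
  | cons y l ih =>
    obtain ⟨X, hX⟩ : ∃ X, X = 12 * N + 20 * l.length + 60 := ⟨_, rfl⟩
    have hy := hl y (by simp)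
    have h1 : Eh bodies [.list (y :: l)] (call₂ iMem Expr.A Expr.D) _ (X + 17) :=
      Eh.call₂ (fh_mem y l) (by omega) Eh.A Eh.D
    have ih := ih fun x hx => hl x (by simp [hx])
    refine Fh.intro (h := X + 20) rfl (by simp only [List.length_cons]; omega) ?_
    refine Eh.ite_cons Eh.X ?_
    by_cases hyl : y ∈ l
    · refine Eh.ite_pos hyl (h1.mono (by omega)) ?_
      rw [List.dedup_cons_of_mem hyl]
      exact Eh.call₁ ih (by omega) Eh.D
    · refine Eh.ite_neg hyl (h1.mono (by omega)) ?_
      rw [List.dedup_cons_of_notMem hyl]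
      exact Eh.cons Eh.A (Eh.call₁ ih (by omega) Eh.D)

open Classical in
/-- The value of a key in an association list (`nil` if there is none). -/
noncomputable def Val.look {K : Type u} (k : Val K) : List (Val K × Val K) → Val K
  | [] => .nil
  | p :: l => if k = p.1 then p.2 else look k l

theorem fh_look (k : Val K) (l : List (Val K × Val K)) :
    Fh bodies iLook (.cons k (.list (l.map fun p => .cons p.1 p.2))) (.look k l)
      (12 * k.dep + 20 * l.length + 40) := by
  induction l with
  | nil => exact Fh.intro (h := 0 + 10) rfl (by omega) (Eh.ite_end Eh.D Eh.nil)
  | cons p l ih =>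
    obtain ⟨X, hX⟩ : ∃ X, X = 12 * k.dep + 20 * l.length + 40 := ⟨_, rfl⟩
    refine Fh.intro (h := X + 20) rfl (by simp only [List.length_cons]; omega) ?_
    refine Eh.ite_cons Eh.D ?_
    have h1 : Eh bodies [.cons k (.list ((p :: l).map fun p => .cons p.1 p.2))]
        (call₂ iEq Expr.A (.fst Expr.AD)) _ (X + 18) :=
      Eh.call₂ (fh_eq k p.1) (by omega) Eh.A (Eh.fst Eh.AD)
    rw [Val.look]
    split_ifs with hk
    · exact Eh.ite_pos hk h1 (Eh.snd Eh.AD)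
    · exact Eh.ite_neg hk h1 (Eh.call₂ ih (by omega) Eh.A Eh.DD)

end Basics

/-! ### Codes of letters, assignments and expressions -/

section Codes

variable {K : Type u} {A : Type}

mutual
/-- The code of an expression, where `cA` codes the letters. -/
def Rex.code [Zero K] (cA : A → Val K) : Rex K A → Val K
  | .const k => .node 0 [.cons (.atom k) (.atom 0)]
  | .eps => .node 1 []
  | .pil S => .node 2 [.list (S.map cA)]
  | .ne e => .node 3 [e.code cA]
  | .alt e f => .node 4 [e.code cA, f.code cA]
  | .had e f => .node 5 [e.code cA, f.code cA]
  | .conc e f => .node 6 [e.code cA, f.code cA]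
  | .shuf e f => .node 7 [e.code cA, f.code cA]
  | .det l => .node 8 [Rex.codeAny cA l]
  | .ndet l => .node 9 [Rex.codeAny cA l]

/-- The list of the codes of expressions. -/
def Rex.codeAny [Zero K] (cA : A → Val K) : List (Rex K A) → Val K
  | [] => .nil
  | e :: l => .cons (e.code cA) (Rex.codeAny cA l)
end

theorem Rex.codeAny_eq [Zero K] (cA : A → Val K) (l : List (Rex K A)) :
    Rex.codeAny cA l = .list (l.map (Rex.code cA)) := by
  induction l with
  | nil => rfl
  | cons e l ih => rw [Rex.codeAny, ih]; rfl

variable {n : ℕ} {P : Fin n → Type} {r : Fin n → ℕ}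

theorem Val.look_map {ι : Type*} (f g : ι → Val K) (hf : Function.Injective f) (l : List ι) (i : ι)
    (hi : i ∈ l) : Val.look (f i) (l.map fun j => (f j, g j)) = g i := by
  induction l with
  | nil => simp at hi
  | cons j l ih =>
    rw [List.map_cons, look]
    split_ifs with h
    · rw [hf h]
    · exact ih ((List.mem_cons.1 hi).resolve_left fun e => h (by rw [e]))

/-- The code of an instance. It is a pair, and so differs from `nil`, the result of a search for a
variable without value. -/
def instCode {m : ℕ} (j : Fin m) : Val K := .cons .nil (.nat j)

theorem instCode_injective {m : ℕ} : Function.Injective (instCode (K := K) (m := m)) := by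
  intro a b h
  simp only [instCode, Val.cons.injEq, true_and] at h
  exact Fin.ext (Val.nat_injective h)

/-- The assignment given by a list of updates. -/
def asg : List (Σ i : Fin n, ℕ × Fin (r i)) → Assignment r
  | [] => Assignment.empty r
  | q :: L => (asg L).update q.1 q.2.1 q.2.2

/-- The code of the variable with number `x` of type `i`. -/
def varKey (i : Fin n) (x : ℕ) : Val K := .cons (.nat i) (.nat x)

/-- The list of updates of an assignment as an association list. -/
def envPairs (L : List (Σ i : Fin n, ℕ × Fin (r i))) : List (Val K × Val K) :=
  L.map fun q => (varKey q.1 q.2.1, instCode q.2.2)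

/-- The code of a list of updates. -/
def envVal (L : List (Σ i : Fin n, ℕ × Fin (r i))) : Val K :=
  .list ((envPairs L).map fun p => .cons p.1 p.2)

/-- The code of the value of a variable, `nil` if there is none. -/
def optCode {m : ℕ} : Option (Fin m) → Val K
  | none => .nil
  | some j => instCode j

theorem optCode_injective {m : ℕ} : Function.Injective (optCode (K := K) (m := m)) := by
  intro a b h
  cases a <;> cases b
  · rfl
  · simp [optCode, instCode] at h
  · simp [optCode, instCode] at h
  · rw [instCode_injective (K := K) h]

theorem Assignment.update_apply_self (σ : Assignment r) (i : Fin n) (x : ℕ) (j : Fin (r i)) :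
    σ.update i x j i x = some j :=
  (congrFun (Function.update_self (β := fun i => ℕ → Option (Fin (r i))) i _ σ) x).trans
    (Function.update_self _ _ _)

theorem Assignment.update_apply_of_ne (σ : Assignment r) {i i' : Fin n} {x x' : ℕ} (j : Fin (r i'))
    (h : ¬ (i = i' ∧ x = x')) : σ.update i' x' j i x = σ i x := by
  by_cases hi : i = i'
  · subst hi
    exact (congrFun (Function.update_self (β := fun i => ℕ → Option (Fin (r i))) i _ σ) x).trans
      (Function.update_of_ne (fun hx => h ⟨rfl, hx⟩) _ _)
  · exact congrFun (Function.update_of_ne (β := fun i => ℕ → Option (Fin (r i))) hi _ σ) x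

theorem look_envPairs (L : List (Σ i : Fin n, ℕ × Fin (r i))) (i : Fin n) (x : ℕ) :
    Val.look (varKey i x) (envPairs L) = (optCode (asg L i x) : Val K) := by
  induction L with
  | nil => rfl
  | cons q L ih =>
    obtain ⟨i', x', j⟩ := q
    rw [envPairs, List.map_cons, Val.look, ← envPairs, ih]
    simp only [varKey, Val.cons.injEq, Val.nat_injective.eq_iff, Fin.val_inj, asg]
    split_ifs with h
    · obtain ⟨rfl, rfl⟩ := h
      rw [Assignment.update_apply_self]
      rfl
    · rw [Assignment.update_apply_of_ne _ _ h]

variable [∀ i, Fintype (P i)]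

instance : Finite (InstPort P r) :=
  Finite.of_injective (β := Σ i : Fin n, P i × Fin (r i)) (fun q => ⟨q.type, q.port, q.inst⟩) (by
    rintro ⟨i, p, j⟩ ⟨i', p', j'⟩ h
    simp only [Sigma.mk.injEq] at h
    obtain ⟨rfl, h⟩ := h
    simp_all)

instance : Finite (Interaction P r) := inferInstanceAs (Finite {_a : Set (InstPort P r) // _})

noncomputable instance : Fintype (InstPort P r) := Fintype.ofFinite _

noncomputable instance : Fintype (Interaction P r) := Fintype.ofFinite _

/-- A port is coded by its type, its number, and its instance. -/
noncomputable def portCode (q : InstPort P r) : Val K :=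
  .cons (.nat q.type) (.cons (.nat (Fintype.equivFin (P q.type) q.port)) (instCode q.inst))

theorem portCode_injective : Function.Injective (portCode (K := K) (P := P) (r := r)) := by
  rintro ⟨i, p, j⟩ ⟨i', p', j'⟩ h
  simp only [portCode, Val.cons.injEq, Val.nat_injective.eq_iff, Fin.val_inj] at h
  obtain ⟨rfl, hp, hj⟩ := h
  rw [Fin.val_inj, EmbeddingLike.apply_eq_iff_eq] at hp
  rw [hp, instCode_injective hj]

open Classical in
/-- The ports of an interaction. -/
noncomputable def activePorts (a : Interaction P r) : List (InstPort P r) :=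
  (Finset.univ.filter fun q => q ∈ a.1).toList

/-- A letter is coded by its number and the list of its ports. -/
noncomputable def letterCode (a : Interaction P r) : Val K :=
  .cons (.nat (Fintype.equivFin (Interaction P r) a)) (.list ((activePorts a).map portCode))

theorem letterCode_injective : Function.Injective (letterCode (K := K) (P := P) (r := r)) := by
  intro a b h
  simp only [letterCode, Val.cons.injEq, Val.nat_injective.eq_iff, Fin.val_inj,
    EmbeddingLike.apply_eq_iff_eq] at h
  exact h.1

variable (P r) in
/-- The alphabet: all interactions. -/
noncomputable def letters : List (Interaction P r) := Finset.univ.toList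

theorem mem_letters (a : Interaction P r) : a ∈ letters P r := by simp [letters]

variable (r) in
/-- The association list of the instances of each type. -/
def rangePairs : List (Val K × Val K) :=
  (List.finRange n).map fun i : Fin n => (.nat i, .list ((List.finRange (r i)).map instCode))

theorem look_rangePairs (i : Fin n) : Val.look (.nat i) (rangePairs (K := K) r) =
    .list ((List.finRange (r i)).map instCode) :=
  Val.look_map (fun i : Fin n => Val.nat i)
    (fun i => .list ((List.finRange (r i)).map instCode)) (fun _ _ h => Fin.ext (Val.nat_injective h)) _ _
    (List.mem_finRange i)

variable (P r) in
/-- The letters, and the instances of each type. -/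
noncomputable def context : Val K :=
  .cons (.list ((letters P r).map letterCode))
    (.list ((rangePairs r).map fun p => .cons p.1 p.2))

variable (K P r) in
/-- `B` bounds everything that depends on `P` and `r` only. -/
structure IsBound (B : ℕ) : Prop where
  type : ∀ i : Fin n, (Val.nat i : Val K).dep ≤ B
  port : ∀ q : InstPort P r, (portCode q : Val K).dep ≤ B
  active : ∀ a : Interaction P r, (activePorts a).length ≤ B
  letter : ∀ a : Interaction P r, (letterCode a : Val K).dep ≤ B
  letters : (letters P r).length ≤ B
  types : n ≤ B
  inst : ∀ i, r i ≤ B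

theorem exists_le_of_finite {ι : Type*} [Finite ι] (f : ι → ℕ) : ∃ B, ∀ i, f i ≤ B := by
  obtain ⟨B, hB⟩ := (Set.finite_range f).bddAbove
  exact ⟨B, fun i => hB ⟨i, rfl⟩⟩

variable (K P r) in
theorem exists_isBound : ∃ B, IsBound K P r B := by
  obtain ⟨B₁, h₁⟩ := exists_le_of_finite fun i : Fin n => (Val.nat i : Val K).dep
  obtain ⟨B₂, h₂⟩ := exists_le_of_finite fun q : InstPort P r => (portCode q : Val K).dep
  obtain ⟨B₃, h₃⟩ := exists_le_of_finite fun a : Interaction P r => (activePorts a).length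
  obtain ⟨B₄, h₄⟩ := exists_le_of_finite fun a : Interaction P r => (letterCode a : Val K).dep
  obtain ⟨B₅, h₅⟩ := exists_le_of_finite r
  refine ⟨B₁ + B₂ + B₃ + B₄ + B₅ + (WFOEIL.letters P r).length + n,
    fun i => ?_, fun q => ?_, fun a => ?_, fun a => ?_, ?_, ?_, fun i => ?_⟩
  · have := h₁ i; omega
  · have := h₂ q; omega
  · have := h₃ a; omega
  · have := h₄ a; omega
  · omega
  · omega
  · have := h₅ i; omega

end Codes

/-! ### The program for instantiation -/

section InstProgram

open WFOEIL.Expr Prog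

variable {K : Type u} [CommSemiring K] {n : ℕ} {P : Fin n → Type} {r : Fin n → ℕ}
  [∀ i, Fintype (P i)] {B : ℕ}

/-- Lists of updates, which represent assignments (`asg`). The last update comes first and is the one
that a search finds. -/
abbrev Env (r : Fin n → ℕ) := List (Σ i : Fin n, ℕ × Fin (r i))

theorem fh_lookVar (hB : IsBound K P r B) (L : Env r) (i : Fin n) (x : ℕ) :
    Fh bodies iLook (.cons (varKey i x) (envVal L)) (optCode (asg L i x) : Val K)
      (12 * B + 12 * x.size + 20 * L.length + 80) := by
  rw [← look_envPairs]
  refine (fh_look (varKey i x) (envPairs L)).mono ?_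
  have h1 := hB.type i
  have h2 := Val.dep_nat_le (K := K) x
  have h3 : (envPairs (K := K) L).length = L.length := by simp [envPairs]
  simp only [varKey, Val.dep]
  omega

theorem fh_psat (hB : IsBound K P r B) (L : Env r) (a : Interaction P r) (φ : PIL (VarPort P)) :
    Fh bodies iPsat (.cons φ.code (.cons (envVal L) (letterCode a)) : Val K)
      (.ofProp (φ.Sat (active (asg L)) a)) (100 * φ.size + 20 * L.length + 40 * B + 200) := by
  induction φ with
  | tru =>
    obtain ⟨X, hX⟩ : ∃ X, X = 20 * L.length + 40 * B + 100 := ⟨_, rfl⟩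
    refine Fh.intro (h := X + 100 + 20) rfl (by simp only [PIL.size]; omega) ?_
    exact Eh.sw 0 rfl (by omega) (by omega) (Eh.fst Eh.A) Eh.tt
  | port q =>
    obtain ⟨X, hX⟩ : ∃ X, X = 100 * PIL.size (.port q) + 20 * L.length + 40 * B + 50 := ⟨_, rfl⟩
    refine Fh.intro (h := X + 100 + 20) rfl (by simp only [PIL.size] at hX ⊢; omega) ?_
    refine Eh.sw 1 rfl (by omega) (by omega) (Eh.fst Eh.A) ?_
    have h1 : Eh bodies [.cons (PIL.code (.port q)) (.cons (envVal L) (letterCode a) : Val K)]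
        (call₂ iLook (.cons (.fst (Expr.c1 Expr.A)) (Expr.c2 (Expr.c1 Expr.A))) Expr.AD)
        (optCode (asg L q.type q.var)) (X + 50) := by
      refine Eh.call₂ (fh_lookVar hB L q.type q.var) (by simp only [PIL.size] at hX; omega)
        (Eh.cons (Eh.fst (Eh.c1 Eh.A)) (Eh.c2 (m := q.type) (Eh.c1 Eh.A))) Eh.AD
    simp only [PIL.Sat, active]
    cases hj : asg L q.type q.var with
    | none =>
      rw [hj] at h1
      rw [Val.ofProp_false (by simp)]
      exact Eh.ite_nil (h1.mono (by omega)) Eh.nil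
    | some j =>
      rw [hj] at h1
      refine Eh.ite_of_ne (a := optCode (some j)) (by simp [optCode, instCode])
        (h1.mono (by omega)) ?_
      have h2 := fh_mem (portCode ⟨q.type, q.port, j⟩ : Val K) ((activePorts a).map portCode)
      have e1 : (∃ j', some j = some j' ∧ (⟨q.type, q.port, j'⟩ : InstPort P r) ∈ a.1) =
          ((portCode ⟨q.type, q.port, j⟩ : Val K) ∈ (activePorts a).map portCode) := by
        rw [List.mem_map_of_injective portCode_injective]
        simp [activePorts]
      rw [e1]
      have h3 := hB.port ⟨q.type, q.port, j⟩
      have h4 := hB.active a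
      rw [List.length_map] at h2
      exact Eh.call₂ h2 (by omega) (Eh.cons (Eh.fst (Eh.c1 Eh.A))
        (Eh.cons (Eh.c1 (m := q.type) (Eh.c1 Eh.A)) (h1.mono (by omega)))) (Eh.snd Eh.DD)
  | neg φ ih =>
    obtain ⟨X, hX⟩ : ∃ X, X = 100 * φ.size + 20 * L.length + 40 * B + 200 := ⟨_, rfl⟩
    refine Fh.intro (h := X + 50 + 20) rfl (by simp only [PIL.size]; omega) ?_
    exact Eh.sw 2 rfl (by omega) (by omega) (Eh.fst Eh.A)
      (Eh.not (Eh.call₂ ih (by omega) (Eh.c1 Eh.A) Eh.D))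
  | or φ₁ φ₂ ih₁ ih₂ =>
    obtain ⟨X, hX⟩ : ∃ X, X = 100 * φ₁.size + 100 * φ₂.size + 20 * L.length + 40 * B + 200 :=
      ⟨_, rfl⟩
    refine Fh.intro (h := X + 50 + 20) rfl (by simp only [PIL.size]; omega) ?_
    exact Eh.sw 3 rfl (by omega) (by omega) (Eh.fst Eh.A)
      (Eh.or (Eh.call₂ ih₁ (by omega) (Eh.c1 Eh.A) Eh.D)
        (Eh.call₂ ih₂ (by omega) (Eh.c2 Eh.A) Eh.D))

open Classical in
theorem fh_filt (hB : IsBound K P r B) (L : Env r) (φ : PIL (VarPort P))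
    (l : List (Interaction P r)) :
    Fh bodies iFilt (.cons φ.code (.cons (envVal L) (.list (l.map letterCode))) : Val K)
      (.list ((l.filter fun a => φ.Sat (active (asg L)) a).map letterCode))
      (100 * φ.size + 20 * L.length + 40 * B + 200 + 30 * l.length + 30) := by
  induction l with
  | nil =>
    obtain ⟨X, hX⟩ : ∃ X, X = 100 * φ.size + 20 * L.length + 40 * B + 200 := ⟨_, rfl⟩
    exact Fh.intro (h := X + 30) rfl (by simp only [List.length_nil]; omega)
      (Eh.ite_end Eh.DD Eh.nil)
  | cons a l ih =>
    obtain ⟨X, hX⟩ : ∃ X, X = 100 * φ.size + 20 * L.length + 40 * B + 200 + 30 * l.length + 30 :=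
      ⟨_, rfl⟩
    refine Fh.intro (h := X + 30) rfl (by simp only [List.length_cons]; omega) ?_
    refine Eh.ite_cons Eh.DD ?_
    by_cases ha : φ.Sat (active (asg L)) a
    · refine Eh.ite_pos ha (Eh.call₃ (fh_psat hB L a φ) (by omega) Eh.A Eh.AD Eh.ADD) ?_
      rw [List.filter_cons_of_pos (by simpa using ha)]
      exact Eh.cons Eh.ADD (Eh.call₃ ih (by omega) Eh.A Eh.AD Eh.DDD)
    · refine Eh.ite_neg ha (Eh.call₃ (fh_psat hB L a φ) (by omega) Eh.A Eh.AD Eh.ADD) ?_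
      rw [List.filter_cons_of_neg (by simpa using ha)]
      exact Eh.call₃ ih (by omega) Eh.A Eh.AD Eh.DDD

theorem fh_isTrue (φ : PIL (VarPort P)) :
    Fh bodies iTrue (φ.code : Val K) (.ofProp φ.IsTrue) (100 * φ.size + 100) := by
  match φ with
  | .tru =>
    refine Fh.intro (h := 0 + 150 + 20) rfl (by simp only [PIL.size]; omega) ?_
    exact Eh.sw 0 rfl (by omega) (by omega) Eh.A Eh.tt
  | .port q =>
    refine Fh.intro (h := 0 + 150 + 20) rfl (by simp only [PIL.size]; omega) ?_
    rw [Val.ofProp_false (by simp [PIL.IsTrue])]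
    exact Eh.sw 1 rfl (by omega) (by omega) Eh.A Eh.nil
  | .or φ₁ φ₂ =>
    refine Fh.intro (h := 0 + 150 + 20) rfl (by simp only [PIL.size]; omega) ?_
    rw [Val.ofProp_false (by simp [PIL.IsTrue])]
    exact Eh.sw 3 rfl (by omega) (by omega) Eh.A Eh.nil
  | .neg .tru =>
    refine Fh.intro (h := 0 + 150 + 20 + 20) rfl (by simp only [PIL.size]; omega) ?_
    rw [Val.ofProp_false (by simp [PIL.IsTrue])]
    exact Eh.sw 2 rfl (by omega) (by omega) Eh.A
      (Eh.sw 0 rfl (by omega) (by omega) (Eh.fst (Eh.c1 Eh.X)) Eh.nil)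
  | .neg (.port q) =>
    refine Fh.intro (h := 0 + 150 + 20 + 20) rfl (by simp only [PIL.size]; omega) ?_
    rw [Val.ofProp_false (by simp [PIL.IsTrue])]
    exact Eh.sw 2 rfl (by omega) (by omega) Eh.A
      (Eh.sw 1 rfl (by omega) (by omega) (Eh.fst (Eh.c1 Eh.X)) Eh.nil)
  | .neg (.or φ₁ φ₂) =>
    refine Fh.intro (h := 0 + 150 + 20 + 20) rfl (by simp only [PIL.size]; omega) ?_
    rw [Val.ofProp_false (by simp [PIL.IsTrue])]
    exact Eh.sw 2 rfl (by omega) (by omega) Eh.A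
      (Eh.sw 3 rfl (by omega) (by omega) (Eh.fst (Eh.c1 Eh.X)) Eh.nil)
  | .neg (.neg φ) =>
    have ih := fh_isTrue φ
    obtain ⟨X, hX⟩ : ∃ X, X = 100 * φ.size + 100 := ⟨_, rfl⟩
    refine Fh.intro (h := X + 50 + 20 + 20) rfl (by simp only [PIL.size]; omega) ?_
    exact Eh.sw 2 rfl (by omega) (by omega) Eh.A
      (Eh.sw 2 rfl (by omega) (by omega) (Eh.fst (Eh.c1 Eh.X))
        (Eh.call₁ ih (by omega) (Eh.c1 (m := 2) (Eh.c1 Eh.X))))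

theorem Eh.rexTop {ρ : List (Val K)} {h : ℕ} {A : Type} {cA : A → Val K} :
    Eh bodies ρ rexTop (Rex.code cA (.const 1)) (h + 10) :=
  Eh.node₁ (by omega) (Eh.cons Eh.one Eh.zero)

theorem Eh.rexBot {ρ : List (Val K)} {h : ℕ} {A : Type} {cA : A → Val K} :
    Eh bodies ρ rexBot (Rex.code cA (.pil [])) (h + 10) :=
  Eh.node₁ (by omega) Eh.nil

theorem Eh.rexEps {ρ : List (Val K)} {h : ℕ} {A : Type} {cA : A → Val K} :
    Eh bodies ρ rexEps (Rex.code cA .eps) (h + 10) :=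
  Eh.node₀ (by omega)

theorem fh_zeta (hB : IsBound K P r B) (L : Env r) (ζ : Zeta (VarPort P)) :
    Fh bodies iZeta (.cons ζ.code (.cons (envVal L) (context P r)) : Val K)
      ((ζ.inst K (letters P r) (asg L)).code letterCode)
      (100 * ζ.size + 20 * L.length + 100 * B + 400) := by
  classical
  induction ζ with
  | pil φ =>
    obtain ⟨X, hX⟩ : ∃ X, X = 100 * φ.size + 20 * L.length + 100 * B + 300 := ⟨_, rfl⟩
    refine Fh.intro (h := X + 50 + 20) rfl (by simp only [Zeta.size]; omega) ?_
    refine Eh.sw 0 rfl (by omega) (by omega) (Eh.fst Eh.A) ?_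
    have h1 : Eh bodies [.cons (Zeta.code (.pil φ)) (.cons (envVal L) (context P r) : Val K)]
        (.call iTrue (Expr.c1 Expr.A)) _ (X + 40) :=
      Eh.call₁ (fh_isTrue φ) (by omega) (Eh.c1 Eh.A)
    have h2 := hB.letters
    by_cases hφ : φ.IsTrue
    · simp only [Zeta.inst, if_pos hφ]
      exact Eh.ite_pos hφ (h1.mono (by omega)) Eh.rexTop
    · simp only [Zeta.inst, if_neg hφ]
      exact Eh.ite_neg hφ (h1.mono (by omega)) (Eh.node₁ (by omega)
        (Eh.call₃ (fh_filt hB L φ (letters P r)) (by omega) (Eh.c1 Eh.A) Eh.AD Eh.ADD))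
  | conc ζ₁ ζ₂ ih₁ ih₂ =>
    obtain ⟨X, hX⟩ : ∃ X, X = 100 * ζ₁.size + 100 * ζ₂.size + 20 * L.length + 100 * B + 400 :=
      ⟨_, rfl⟩
    refine Fh.intro (h := X + 50 + 20) rfl (by simp only [Zeta.size]; omega) ?_
    exact Eh.sw 1 rfl (by omega) (by omega) (Eh.fst Eh.A) (Eh.node₁ (by omega)
      (Eh.node₂ (by omega) (Eh.call₂ ih₁ (by omega) (Eh.c1 Eh.A) Eh.D)
        (Eh.call₂ ih₂ (by omega) (Eh.c2 Eh.A) Eh.D)))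

theorem fh_epil (hB : IsBound K P r B) (L : Env r) (φ : EPIL (VarPort P)) :
    Fh bodies iEpil (.cons φ.code (.cons (envVal L) (context P r)) : Val K)
      ((φ.inst K (letters P r) (asg L)).code letterCode)
      (100 * φ.size + 20 * L.length + 100 * B + 500) := by
  induction φ with
  | zeta ζ =>
    obtain ⟨X, hX⟩ : ∃ X, X = 100 * ζ.size + 20 * L.length + 100 * B + 400 := ⟨_, rfl⟩
    refine Fh.intro (h := X + 50 + 20) rfl (by simp only [EPIL.size]; omega) ?_
    exact Eh.sw 0 rfl (by omega) (by omega) (Eh.fst Eh.A)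
      (Eh.call₂ (fh_zeta hB L ζ) (by omega) (Eh.c1 Eh.A) Eh.D)
  | neg ζ =>
    obtain ⟨X, hX⟩ : ∃ X, X = 100 * ζ.size + 20 * L.length + 100 * B + 400 := ⟨_, rfl⟩
    refine Fh.intro (h := X + 50 + 20) rfl (by simp only [EPIL.size]; omega) ?_
    exact Eh.sw 1 rfl (by omega) (by omega) (Eh.fst Eh.A) (Eh.node₁ (by omega)
      (Eh.node₁ (by omega) (Eh.list₁ (Eh.call₂ (fh_zeta hB L ζ) (by omega) (Eh.c1 Eh.A) Eh.D))))
  | or φ₁ φ₂ ih₁ ih₂ | and φ₁ φ₂ ih₁ ih₂ | conc φ₁ φ₂ ih₁ ih₂ | shuf φ₁ φ₂ ih₁ ih₂ =>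
    obtain ⟨X, hX⟩ : ∃ X, X = 100 * φ₁.size + 100 * φ₂.size + 20 * L.length + 100 * B + 500 :=
      ⟨_, rfl⟩
    refine Fh.intro (h := X + 50 + 20) rfl (by simp only [EPIL.size]; omega) ?_
    first
    | refine Eh.sw 2 rfl (by omega) (by omega) (Eh.fst Eh.A) (Eh.node₁ (by omega)
        (Eh.node₂ (by omega) (Eh.call₂ ih₁ (by omega) (Eh.c1 Eh.A) Eh.D)
          (Eh.call₂ ih₂ (by omega) (Eh.c2 Eh.A) Eh.D)))
    | refine Eh.sw 3 rfl (by omega) (by omega) (Eh.fst Eh.A) (Eh.node₁ (by omega)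
        (Eh.node₂ (by omega) (Eh.call₂ ih₁ (by omega) (Eh.c1 Eh.A) Eh.D)
          (Eh.call₂ ih₂ (by omega) (Eh.c2 Eh.A) Eh.D)))
    | refine Eh.sw 4 rfl (by omega) (by omega) (Eh.fst Eh.A) (Eh.node₁ (by omega)
        (Eh.node₂ (by omega) (Eh.call₂ ih₁ (by omega) (Eh.c1 Eh.A) Eh.D)
          (Eh.call₂ ih₂ (by omega) (Eh.c2 Eh.A) Eh.D)))
    | refine Eh.sw 5 rfl (by omega) (by omega) (Eh.fst Eh.A) (Eh.node₁ (by omega)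
        (Eh.node₂ (by omega) (Eh.call₂ ih₁ (by omega) (Eh.c1 Eh.A) Eh.D)
          (Eh.call₂ ih₂ (by omega) (Eh.c2 Eh.A) Eh.D)))

section Folds

variable {A : Type} {cA : A → Val K}

theorem fh_fold {m : ℕ} (op : Rex K A → Rex K A → Rex K A)
    (hop : ∀ e f, (op e f).code cA = .node m [e.code cA, f.code cA]) (b : Rex K A)
    (l : List (Rex K A)) :
    Fh bodies iFold (.cons (.nat m) (.cons (b.code cA) (Rex.codeAny cA l)))
      ((l.foldr op b).code cA) (20 * l.length + 20) := by
  induction l with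
  | nil => exact Fh.intro (h := 0 + 20) rfl (by omega) (Eh.ite_end Eh.DD Eh.AD)
  | cons e l ih =>
    refine Fh.intro (h := 20 * l.length + 20 + 20) rfl (by simp only [List.length_cons]; omega) ?_
    rw [List.foldr_cons, hop]
    exact Eh.ite_cons Eh.DD (Eh.cons Eh.A (Eh.list₂ Eh.ADD
      (Eh.call₃ ih (by omega) Eh.A Eh.AD Eh.DDD)))

theorem fh_sumOp {m : ℕ} (op : Rex K A → Rex K A → Rex K A)
    (hop : ∀ e f, (op e f).code cA = .node m [e.code cA, f.code cA]) (l : List (Rex K A)) :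
    Fh bodies iSumOp (.cons (.nat m) (Rex.codeAny cA l))
      ((Rex.sumOp op l).code cA) (50 * l.length + 20) := by
  induction l with
  | nil => exact Fh.intro (h := 0 + 20) rfl (by omega) (Eh.ite_end Eh.D Eh.rexBot)
  | cons e l ih =>
    refine Fh.intro (h := 50 * l.length + 20 + 50) rfl (by simp only [List.length_cons]; omega) ?_
    refine Eh.ite_cons Eh.D ?_
    cases l with
    | nil => exact Eh.ite_end Eh.DD Eh.AD
    | cons f l =>
      generalize (f :: l).length = k at ih ⊢
      refine Eh.ite_cons Eh.DD ?_
      rw [Rex.sumOp, Rex.code, hop]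
      have h1 : Eh bodies [.cons (.nat m) (Rex.codeAny cA (e :: f :: l))] (call₂ iSumOp Expr.A Expr.DD)
          ((Rex.sumOp op (f :: l)).code cA) (50 * k + 20 + 10) :=
        Eh.call₂ ih (by omega) Eh.A Eh.DD
      refine Eh.node₂ (by omega) (Eh.node₂ (by omega) Eh.AD (h1.mono (by omega))) ?_
      exact Eh.cons Eh.A (Eh.list₂ Eh.AD (h1.mono (by omega)))

end Folds

theorem fh_instList {g h : ℕ} (hd : bodies[h]? = some (instList g h)) (ψ : Val K) (L : Env r)
    (i : Fin n) (x : ℕ) (e : Fin (r i) → Rex K (Interaction P r)) (k : ℕ)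
    (H : ∀ j, Fh bodies g (.cons ψ (.cons (envVal (⟨i, x, j⟩ :: L)) (context P r)) : Val K)
      ((e j).code letterCode) k) (l : List (Fin (r i))) :
    Fh bodies h (.cons ψ (.cons (varKey i x) (.cons (.list (l.map instCode))
      (.cons (envVal L) (context P r)))) : Val K)
      (Rex.codeAny letterCode (l.map e)) (k + 20 * l.length + 20) := by
  induction l with
  | nil => exact Fh.intro (h := k + 20) hd (by omega) (Eh.ite_end Eh.ADD Eh.nil)
  | cons j l ih =>
    obtain ⟨X, hX⟩ : ∃ X, X = k + 20 * l.length + 20 := ⟨_, rfl⟩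
    refine Fh.intro (h := X + 20) hd (by simp only [List.length_cons]; omega) ?_
    exact Eh.ite_cons Eh.ADD (Eh.cons
      (Eh.call₃ (H j) (by omega) Eh.A (Eh.cons (Eh.cons Eh.AD (Eh.fst Eh.ADD)) Eh.ADDD) Eh.DDDD)
      (Eh.call₃ ih (by omega) Eh.A Eh.AD (Eh.cons (Eh.snd Eh.ADD) Eh.DDD)))

/-- The list of the instances of the scope of a quantifier. -/
theorem Eh.insts {g h t k X : ℕ} (hB : IsBound K P r B)
    (hd : bodies[h]? = some (instList g h)) (ψ : Val K) (L : Env r)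
    (i : Fin n) (x : ℕ) (e : Fin (r i) → Rex K (Interaction P r))
    (H : ∀ j, Fh bodies g (.cons ψ (.cons (envVal (⟨i, x, j⟩ :: L)) (context P r)) : Val K)
      ((e j).code letterCode) k) (hX : k + 50 * B + 40 ≤ X) :
    Eh bodies [.cons (.node t [.nat i, .nat x, ψ]) (.cons (envVal L) (context P r))] (insts h)
      (Rex.codeAny letterCode ((List.finRange (r i)).map e)) (X + 20) := by
  have h1 := fh_instList hd ψ L i x e k H (List.finRange (r i))
  have h2 := fh_look (.nat i : Val K) (rangePairs r)
  rw [look_rangePairs] at h2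
  have h3 : (rangePairs (K := K) r).length = n := by simp [rangePairs]
  have h4 := hB.types
  have h5 := hB.inst i
  have h6 := hB.type i
  rw [List.length_finRange] at h1
  exact Eh.call₃ h1 (by omega) (Eh.c3 Eh.A) (Eh.cons (Eh.c1 Eh.A) (Eh.c2 Eh.A))
    (Eh.cons (Eh.call₂ h2 (by omega) (Eh.c1 Eh.A) Eh.DDD) Eh.D)

end InstProgram

/-! ### The program for instantiation of quantified formulas -/

section InstFormula

open WFOEIL.Expr Prog

variable {K : Type u} {n : ℕ} {P : Fin n → Type} {r : Fin n → ℕ}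
  [∀ i, Fintype (P i)] {B Q : ℕ}

theorem dep_optCode_le (hB : IsBound K P r B) {i : Fin n} (j : Option (Fin (r i))) :
    (optCode j : Val K).dep ≤ B + 2 := by
  cases j with
  | none => exact Nat.zero_le _
  | some j =>
    have h1 := Val.dep_nat_le (K := K) j
    have h2 : Nat.size j ≤ j := Nat.size_le.2 Nat.lt_two_pow_self
    have h3 := j.2
    have h4 := hB.inst i
    simp only [optCode, instCode, Val.dep]
    omega

variable [CommSemiring K]

/-- Comparison of the values of two variables. -/
theorem Eh.eqVar (hB : IsBound K P r B) (L : Env r) (t : ℕ) (i : Fin n) (x y X : ℕ)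
    (hX : 12 * B + 12 * x.size + 12 * y.size + 20 * L.length + 100 ≤ X) :
    Eh bodies [.cons (.node t [.nat i, .nat x, .nat y]) (.cons (envVal L) (context P r) : Val K)]
      (Expr.call₂ iEq (Expr.call₂ iLook (.cons (Expr.c1 Expr.A) (Expr.c2 Expr.A)) Expr.AD)
        (Expr.call₂ iLook (.cons (Expr.c1 Expr.A) (Expr.c3 Expr.A)) Expr.AD))
      (.ofProp (asg L i x = asg L i y)) (X + 30) := by
  have h1 := fh_eq (optCode (asg L i x)) (optCode (asg L i y) : Val K)
  have h2 := dep_optCode_le hB (asg L i x)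
  rw [optCode_injective.eq_iff] at h1
  exact Eh.call₂ h1 (by omega)
    (Eh.call₂ (fh_lookVar hB L i x) (by omega) (Eh.cons (Eh.c1 Eh.A) (Eh.c2 Eh.A)) Eh.AD)
    (Eh.call₂ (fh_lookVar hB L i y) (by omega) (Eh.cons (Eh.c1 Eh.A) (Eh.c3 Eh.A)) Eh.AD)

theorem mul_quantifier_le (Q z k s : ℕ) : Q + Q * s ≤ Q * (1 + z + max 1 k * s) := by
  have h1 : s ≤ max 1 k * s := Nat.le_mul_of_pos_left _ (by omega)
  have h2 : Q * (1 + s) ≤ Q * (1 + z + max 1 k * s) := Nat.mul_le_mul_left _ (by omega)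
  rwa [Nat.mul_add, Nat.mul_one] at h2

theorem fh_form (hB : IsBound K P r B) (hQ : 400 + 200 * B ≤ Q) (ψ : Formula P) (L : Env r) :
    Fh bodies iForm (.cons ψ.code (.cons (envVal L) (context P r)) : Val K)
      ((ψ.inst K (letters P r) (asg L)).code letterCode)
      (Q * ψ.size r + 20 * L.length + 200 * B + 1000) := by
  classical
  induction ψ generalizing L with
  | epil φ =>
    have h1 : 100 * φ.size ≤ Q * φ.size := Nat.mul_le_mul_right _ (by omega)
    obtain ⟨X, hX⟩ : ∃ X, X = Q * φ.size + 20 * L.length + 200 * B + 900 := ⟨_, rfl⟩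
    refine Fh.intro (h := X + 50 + 20) rfl (by simp only [Formula.size]; omega) ?_
    exact Eh.sw 0 rfl (by omega) (by omega) (Eh.fst Eh.A)
      (Eh.call₂ (fh_epil hB L φ) (by omega) (Eh.c1 Eh.A) Eh.D)
  | eq i x y =>
    have h1 : 100 * (1 + x.size + y.size) ≤ Q * (1 + x.size + y.size) :=
      Nat.mul_le_mul_right _ (by omega)
    obtain ⟨X, hX⟩ : ∃ X, X = Q * (1 + x.size + y.size) + 20 * L.length + 200 * B + 900 := ⟨_, rfl⟩
    refine Fh.intro (h := X + 50 + 20) rfl (by simp only [Formula.size]; omega) ?_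
    refine Eh.sw 1 rfl (by omega) (by omega) (Eh.fst Eh.A) ?_
    have h2 := Eh.eqVar hB L 1 i x y X (by omega)
    by_cases hxy : asg L i x = asg L i y
    · simp only [Formula.inst, if_pos hxy]
      exact Eh.ite_pos hxy (h2.mono (by omega)) Eh.rexTop
    · simp only [Formula.inst, if_neg hxy]
      exact Eh.ite_neg hxy (h2.mono (by omega)) Eh.rexBot
  | neq i x y =>
    have h1 : 100 * (1 + x.size + y.size) ≤ Q * (1 + x.size + y.size) :=
      Nat.mul_le_mul_right _ (by omega)
    obtain ⟨X, hX⟩ : ∃ X, X = Q * (1 + x.size + y.size) + 20 * L.length + 200 * B + 900 := ⟨_, rfl⟩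
    refine Fh.intro (h := X + 50 + 20) rfl (by simp only [Formula.size]; omega) ?_
    refine Eh.sw 2 rfl (by omega) (by omega) (Eh.fst Eh.A) ?_
    have h2 := Eh.eqVar hB L 2 i x y X (by omega)
    by_cases hxy : asg L i x = asg L i y
    · simp only [Formula.inst, if_pos hxy]
      exact Eh.ite_pos hxy (h2.mono (by omega)) Eh.rexBot
    · simp only [Formula.inst, if_neg hxy]
      exact Eh.ite_neg hxy (h2.mono (by omega)) Eh.rexTop
  | or ψ₁ ψ₂ ih₁ ih₂ =>
    have ih₁ := ih₁ L
    have ih₂ := ih₂ L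
    obtain ⟨X, hX⟩ : ∃ X, X = Q * ψ₁.size r + Q * ψ₂.size r + 20 * L.length + 200 * B + 1000 :=
      ⟨_, rfl⟩
    refine Fh.intro (h := X + 50 + 20) rfl
      (by simp only [Formula.size, Nat.mul_add, Nat.mul_one]; omega) ?_
    exact Eh.sw 3 rfl (by omega) (by omega) (Eh.fst Eh.A)
      (Eh.node₂ (by omega) (Eh.call₂ ih₁ (by omega) (Eh.c1 Eh.A) Eh.D)
        (Eh.call₂ ih₂ (by omega) (Eh.c2 Eh.A) Eh.D))
  | and ψ₁ ψ₂ ih₁ ih₂ =>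
    have ih₁ := ih₁ L
    have ih₂ := ih₂ L
    obtain ⟨X, hX⟩ : ∃ X, X = Q * ψ₁.size r + Q * ψ₂.size r + 20 * L.length + 200 * B + 1000 :=
      ⟨_, rfl⟩
    refine Fh.intro (h := X + 50 + 20) rfl
      (by simp only [Formula.size, Nat.mul_add, Nat.mul_one]; omega) ?_
    exact Eh.sw 4 rfl (by omega) (by omega) (Eh.fst Eh.A)
      (Eh.node₂ (by omega) (Eh.call₂ ih₁ (by omega) (Eh.c1 Eh.A) Eh.D)
        (Eh.call₂ ih₂ (by omega) (Eh.c2 Eh.A) Eh.D))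
  | conc ψ₁ ψ₂ ih₁ ih₂ =>
    have ih₁ := ih₁ L
    have ih₂ := ih₂ L
    obtain ⟨X, hX⟩ : ∃ X, X = Q * ψ₁.size r + Q * ψ₂.size r + 20 * L.length + 200 * B + 1000 :=
      ⟨_, rfl⟩
    refine Fh.intro (h := X + 50 + 20) rfl
      (by simp only [Formula.size, Nat.mul_add, Nat.mul_one]; omega) ?_
    exact Eh.sw 5 rfl (by omega) (by omega) (Eh.fst Eh.A)
      (Eh.node₂ (by omega) (Eh.call₂ ih₁ (by omega) (Eh.c1 Eh.A) Eh.D)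
        (Eh.call₂ ih₂ (by omega) (Eh.c2 Eh.A) Eh.D))
  | shuf ψ₁ ψ₂ ih₁ ih₂ =>
    have ih₁ := ih₁ L
    have ih₂ := ih₂ L
    obtain ⟨X, hX⟩ : ∃ X, X = Q * ψ₁.size r + Q * ψ₂.size r + 20 * L.length + 200 * B + 1000 :=
      ⟨_, rfl⟩
    refine Fh.intro (h := X + 50 + 20) rfl
      (by simp only [Formula.size, Nat.mul_add, Nat.mul_one]; omega) ?_
    exact Eh.sw 6 rfl (by omega) (by omega) (Eh.fst Eh.A)
      (Eh.node₂ (by omega) (Eh.call₂ ih₁ (by omega) (Eh.c1 Eh.A) Eh.D)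
        (Eh.call₂ ih₂ (by omega) (Eh.c2 Eh.A) Eh.D))
  | ex i x ψ ih =>
    have hs := mul_quantifier_le Q x.size (r i) (ψ.size r)
    have hr := hB.inst i
    obtain ⟨X, hX⟩ : ∃ X, X = Q * ψ.size r + 20 * (L.length + 1) + 200 * B + 1000 + 50 * B + 40 :=
      ⟨_, rfl⟩
    have hI := Eh.insts (t := 7) (X := X) hB (g := iForm) (h := iForms) rfl ψ.code L i x
      (fun j => ψ.inst K (letters P r) ((asg L).update i x j)) (fun j =>
        (ih (⟨i, x, j⟩ :: L)).mono (k := Q * ψ.size r + 20 * (L.length + 1) + 200 * B + 1000)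
          (by simp only [List.length_cons]; omega)) (by omega)
    refine Fh.intro (h := X + 50 + 20) rfl (by simp only [Formula.size]; omega) ?_
    exact Eh.sw 7 rfl (by omega) (by omega) (Eh.fst Eh.A)
      ((Eh.call₃ (fh_fold .alt (fun _ _ => rfl) _ _) (by simp; omega)
        (Eh.natE (by omega)) Eh.rexBot hI).mono (by omega))
  | all i x ψ ih =>
    have hs := mul_quantifier_le Q x.size (r i) (ψ.size r)
    have hr := hB.inst i
    obtain ⟨X, hX⟩ : ∃ X, X = Q * ψ.size r + 20 * (L.length + 1) + 200 * B + 1000 + 50 * B + 40 :=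
      ⟨_, rfl⟩
    have hI := Eh.insts (t := 8) (X := X) hB (g := iForm) (h := iForms) rfl ψ.code L i x
      (fun j => ψ.inst K (letters P r) ((asg L).update i x j)) (fun j =>
        (ih (⟨i, x, j⟩ :: L)).mono (k := Q * ψ.size r + 20 * (L.length + 1) + 200 * B + 1000)
          (by simp only [List.length_cons]; omega)) (by omega)
    refine Fh.intro (h := X + 50 + 20) rfl (by simp only [Formula.size]; omega) ?_
    exact Eh.sw 8 rfl (by omega) (by omega) (Eh.fst Eh.A)
      ((Eh.call₃ (fh_fold .had (fun _ _ => rfl) _ _) (by simp; omega)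
        (Eh.natE (by omega)) Eh.rexTop hI).mono (by omega))
  | exConc i x ψ ih =>
    have hs := mul_quantifier_le Q x.size (r i) (ψ.size r)
    have hr := hB.inst i
    obtain ⟨X, hX⟩ : ∃ X, X = Q * ψ.size r + 20 * (L.length + 1) + 200 * B + 1000 + 50 * B + 40 :=
      ⟨_, rfl⟩
    have hI := Eh.insts (t := 9) (X := X) hB (g := iForm) (h := iForms) rfl ψ.code L i x
      (fun j => ψ.inst K (letters P r) ((asg L).update i x j)) (fun j =>
        (ih (⟨i, x, j⟩ :: L)).mono (k := Q * ψ.size r + 20 * (L.length + 1) + 200 * B + 1000)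
          (by simp only [List.length_cons]; omega)) (by omega)
    refine Fh.intro (h := X + 50 + 20) rfl (by simp only [Formula.size]; omega) ?_
    exact Eh.sw 9 rfl (by omega) (by omega) (Eh.fst Eh.A)
      ((Eh.call₂ (fh_sumOp .conc (fun _ _ => rfl) _) (by simp; omega)
        (Eh.natE (by omega)) hI).mono (by omega))
  | allConc i x ψ ih =>
    have hs := mul_quantifier_le Q x.size (r i) (ψ.size r)
    have hr := hB.inst i
    obtain ⟨X, hX⟩ : ∃ X, X = Q * ψ.size r + 20 * (L.length + 1) + 200 * B + 1000 + 50 * B + 40 :=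
      ⟨_, rfl⟩
    have hI := Eh.insts (t := 10) (X := X) hB (g := iForm) (h := iForms) rfl ψ.code L i x
      (fun j => ψ.inst K (letters P r) ((asg L).update i x j)) (fun j =>
        (ih (⟨i, x, j⟩ :: L)).mono (k := Q * ψ.size r + 20 * (L.length + 1) + 200 * B + 1000)
          (by simp only [List.length_cons]; omega)) (by omega)
    refine Fh.intro (h := X + 50 + 20) rfl (by simp only [Formula.size]; omega) ?_
    exact Eh.sw 10 rfl (by omega) (by omega) (Eh.fst Eh.A)
      ((Eh.call₃ (fh_fold .conc (fun _ _ => rfl) _ _) (by simp; omega)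
        (Eh.natE (by omega)) Eh.rexEps hI).mono (by omega))
  | exShuf i x ψ ih =>
    have hs := mul_quantifier_le Q x.size (r i) (ψ.size r)
    have hr := hB.inst i
    obtain ⟨X, hX⟩ : ∃ X, X = Q * ψ.size r + 20 * (L.length + 1) + 200 * B + 1000 + 50 * B + 40 :=
      ⟨_, rfl⟩
    have hI := Eh.insts (t := 11) (X := X) hB (g := iForm) (h := iForms) rfl ψ.code L i x
      (fun j => ψ.inst K (letters P r) ((asg L).update i x j)) (fun j =>
        (ih (⟨i, x, j⟩ :: L)).mono (k := Q * ψ.size r + 20 * (L.length + 1) + 200 * B + 1000)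
          (by simp only [List.length_cons]; omega)) (by omega)
    refine Fh.intro (h := X + 50 + 20) rfl (by simp only [Formula.size]; omega) ?_
    exact Eh.sw 11 rfl (by omega) (by omega) (Eh.fst Eh.A)
      ((Eh.call₂ (fh_sumOp .shuf (fun _ _ => rfl) _) (by simp; omega)
        (Eh.natE (by omega)) hI).mono (by omega))
  | allShuf i x ψ ih =>
    have hs := mul_quantifier_le Q x.size (r i) (ψ.size r)
    have hr := hB.inst i
    obtain ⟨X, hX⟩ : ∃ X, X = Q * ψ.size r + 20 * (L.length + 1) + 200 * B + 1000 + 50 * B + 40 :=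
      ⟨_, rfl⟩
    have hI := Eh.insts (t := 12) (X := X) hB (g := iForm) (h := iForms) rfl ψ.code L i x
      (fun j => ψ.inst K (letters P r) ((asg L).update i x j)) (fun j =>
        (ih (⟨i, x, j⟩ :: L)).mono (k := Q * ψ.size r + 20 * (L.length + 1) + 200 * B + 1000)
          (by simp only [List.length_cons]; omega)) (by omega)
    refine Fh.intro (h := X + 50 + 20) rfl (by simp only [Formula.size]; omega) ?_
    exact Eh.sw 12 rfl (by omega) (by omega) (Eh.fst Eh.A)
      ((Eh.call₃ (fh_fold .shuf (fun _ _ => rfl) _ _) (by simp; omega)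
        (Eh.natE (by omega)) Eh.rexEps hI).mono (by omega))

theorem fh_wform (hB : IsBound K P r B) (hQ : 400 + 200 * B ≤ Q) (ψ : WFormula P K) (L : Env r) :
    Fh bodies iWform (.cons ψ.code (.cons (envVal L) (context P r)) : Val K)
      ((ψ.inst (letters P r) (asg L)).code letterCode)
      (Q * ψ.size r + 20 * L.length + 200 * B + 1100) := by
  induction ψ generalizing L with
  | const k =>
    obtain ⟨X, hX⟩ : ∃ X, X = Q + 20 * L.length + 200 * B + 900 := ⟨_, rfl⟩
    refine Fh.intro (h := X + 50 + 20) rfl (by simp only [WFormula.size]; omega) ?_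
    exact Eh.sw 0 rfl (by omega) (by omega) (Eh.fst Eh.A)
      (Eh.node₁ (by omega) (Eh.cons (Eh.c1 Eh.A) Eh.zero))
  | formula ψ =>
    obtain ⟨X, hX⟩ : ∃ X, X = Q * ψ.size r + 20 * L.length + 200 * B + 1050 := ⟨_, rfl⟩
    refine Fh.intro (h := X + 30 + 20) rfl (by simp only [WFormula.size]; omega) ?_
    exact Eh.sw 1 rfl (by omega) (by omega) (Eh.fst Eh.A) (Eh.node₁ (by omega)
      (Eh.list₁ (Eh.call₂ (fh_form hB hQ ψ L) (by omega) (Eh.c1 Eh.A) Eh.D)))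
  | plus ψ₁ ψ₂ ih₁ ih₂ =>
    have ih₁ := ih₁ L
    have ih₂ := ih₂ L
    obtain ⟨X, hX⟩ : ∃ X, X = Q * ψ₁.size r + Q * ψ₂.size r + 20 * L.length + 200 * B + 1100 :=
      ⟨_, rfl⟩
    refine Fh.intro (h := X + 50 + 20) rfl
      (by simp only [WFormula.size, Nat.mul_add, Nat.mul_one]; omega) ?_
    exact Eh.sw 2 rfl (by omega) (by omega) (Eh.fst Eh.A)
      (Eh.node₂ (by omega) (Eh.call₂ ih₁ (by omega) (Eh.c1 Eh.A) Eh.D)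
        (Eh.call₂ ih₂ (by omega) (Eh.c2 Eh.A) Eh.D))
  | times ψ₁ ψ₂ ih₁ ih₂ =>
    have ih₁ := ih₁ L
    have ih₂ := ih₂ L
    obtain ⟨X, hX⟩ : ∃ X, X = Q * ψ₁.size r + Q * ψ₂.size r + 20 * L.length + 200 * B + 1100 :=
      ⟨_, rfl⟩
    refine Fh.intro (h := X + 50 + 20) rfl
      (by simp only [WFormula.size, Nat.mul_add, Nat.mul_one]; omega) ?_
    exact Eh.sw 3 rfl (by omega) (by omega) (Eh.fst Eh.A)
      (Eh.node₂ (by omega) (Eh.call₂ ih₁ (by omega) (Eh.c1 Eh.A) Eh.D)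
        (Eh.call₂ ih₂ (by omega) (Eh.c2 Eh.A) Eh.D))
  | conc ψ₁ ψ₂ ih₁ ih₂ =>
    have ih₁ := ih₁ L
    have ih₂ := ih₂ L
    obtain ⟨X, hX⟩ : ∃ X, X = Q * ψ₁.size r + Q * ψ₂.size r + 20 * L.length + 200 * B + 1100 :=
      ⟨_, rfl⟩
    refine Fh.intro (h := X + 50 + 20) rfl
      (by simp only [WFormula.size, Nat.mul_add, Nat.mul_one]; omega) ?_
    exact Eh.sw 4 rfl (by omega) (by omega) (Eh.fst Eh.A)
      (Eh.node₂ (by omega) (Eh.call₂ ih₁ (by omega) (Eh.c1 Eh.A) Eh.D)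
        (Eh.call₂ ih₂ (by omega) (Eh.c2 Eh.A) Eh.D))
  | shuf ψ₁ ψ₂ ih₁ ih₂ =>
    have ih₁ := ih₁ L
    have ih₂ := ih₂ L
    obtain ⟨X, hX⟩ : ∃ X, X = Q * ψ₁.size r + Q * ψ₂.size r + 20 * L.length + 200 * B + 1100 :=
      ⟨_, rfl⟩
    refine Fh.intro (h := X + 50 + 20) rfl
      (by simp only [WFormula.size, Nat.mul_add, Nat.mul_one]; omega) ?_
    exact Eh.sw 5 rfl (by omega) (by omega) (Eh.fst Eh.A)
      (Eh.node₂ (by omega) (Eh.call₂ ih₁ (by omega) (Eh.c1 Eh.A) Eh.D)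
        (Eh.call₂ ih₂ (by omega) (Eh.c2 Eh.A) Eh.D))
  | sum i x ψ ih =>
    have hs := mul_quantifier_le Q x.size (r i) (ψ.size r)
    have hr := hB.inst i
    obtain ⟨X, hX⟩ : ∃ X, X = Q * ψ.size r + 20 * (L.length + 1) + 200 * B + 1100 + 50 * B + 40 :=
      ⟨_, rfl⟩
    have hI := Eh.insts (t := 6) (X := X) hB (g := iWform) (h := iWforms) rfl ψ.code L i x
      (fun j => ψ.inst (letters P r) ((asg L).update i x j)) (fun j =>
        (ih (⟨i, x, j⟩ :: L)).mono (k := Q * ψ.size r + 20 * (L.length + 1) + 200 * B + 1100)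
          (by simp only [List.length_cons]; omega)) (by omega)
    refine Fh.intro (h := X + 50 + 20) rfl (by simp only [WFormula.size]; omega) ?_
    exact Eh.sw 6 rfl (by omega) (by omega) (Eh.fst Eh.A)
      ((Eh.call₃ (fh_fold .alt (fun _ _ => rfl) _ _) (by simp; omega)
        (Eh.natE (by omega)) Eh.rexBot hI).mono (by omega))
  | prod i x ψ ih =>
    have hs := mul_quantifier_le Q x.size (r i) (ψ.size r)
    have hr := hB.inst i
    obtain ⟨X, hX⟩ : ∃ X, X = Q * ψ.size r + 20 * (L.length + 1) + 200 * B + 1100 + 50 * B + 40 :=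
      ⟨_, rfl⟩
    have hI := Eh.insts (t := 7) (X := X) hB (g := iWform) (h := iWforms) rfl ψ.code L i x
      (fun j => ψ.inst (letters P r) ((asg L).update i x j)) (fun j =>
        (ih (⟨i, x, j⟩ :: L)).mono (k := Q * ψ.size r + 20 * (L.length + 1) + 200 * B + 1100)
          (by simp only [List.length_cons]; omega)) (by omega)
    refine Fh.intro (h := X + 50 + 20) rfl (by simp only [WFormula.size]; omega) ?_
    exact Eh.sw 7 rfl (by omega) (by omega) (Eh.fst Eh.A)
      ((Eh.call₃ (fh_fold .had (fun _ _ => rfl) _ _) (by simp; omega)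
        (Eh.natE (by omega)) Eh.rexTop hI).mono (by omega))
  | sumConc i x ψ ih =>
    have hs := mul_quantifier_le Q x.size (r i) (ψ.size r)
    have hr := hB.inst i
    obtain ⟨X, hX⟩ : ∃ X, X = Q * ψ.size r + 20 * (L.length + 1) + 200 * B + 1100 + 50 * B + 40 :=
      ⟨_, rfl⟩
    have hI := Eh.insts (t := 8) (X := X) hB (g := iWform) (h := iWforms) rfl ψ.code L i x
      (fun j => ψ.inst (letters P r) ((asg L).update i x j)) (fun j =>
        (ih (⟨i, x, j⟩ :: L)).mono (k := Q * ψ.size r + 20 * (L.length + 1) + 200 * B + 1100)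
          (by simp only [List.length_cons]; omega)) (by omega)
    refine Fh.intro (h := X + 50 + 20) rfl (by simp only [WFormula.size]; omega) ?_
    exact Eh.sw 8 rfl (by omega) (by omega) (Eh.fst Eh.A)
      ((Eh.call₂ (fh_sumOp .conc (fun _ _ => rfl) _) (by simp; omega)
        (Eh.natE (by omega)) hI).mono (by omega))
  | prodConc i x ψ ih =>
    have hs := mul_quantifier_le Q x.size (r i) (ψ.size r)
    have hr := hB.inst i
    obtain ⟨X, hX⟩ : ∃ X, X = Q * ψ.size r + 20 * (L.length + 1) + 200 * B + 1100 + 50 * B + 40 :=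
      ⟨_, rfl⟩
    have hI := Eh.insts (t := 9) (X := X) hB (g := iWform) (h := iWforms) rfl ψ.code L i x
      (fun j => ψ.inst (letters P r) ((asg L).update i x j)) (fun j =>
        (ih (⟨i, x, j⟩ :: L)).mono (k := Q * ψ.size r + 20 * (L.length + 1) + 200 * B + 1100)
          (by simp only [List.length_cons]; omega)) (by omega)
    refine Fh.intro (h := X + 50 + 20) rfl (by simp only [WFormula.size]; omega) ?_
    exact Eh.sw 9 rfl (by omega) (by omega) (Eh.fst Eh.A)
      ((Eh.call₃ (fh_fold .conc (fun _ _ => rfl) _ _) (by simp; omega)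
        (Eh.natE (by omega)) Eh.rexEps hI).mono (by omega))
  | sumShuf i x ψ ih =>
    have hs := mul_quantifier_le Q x.size (r i) (ψ.size r)
    have hr := hB.inst i
    obtain ⟨X, hX⟩ : ∃ X, X = Q * ψ.size r + 20 * (L.length + 1) + 200 * B + 1100 + 50 * B + 40 :=
      ⟨_, rfl⟩
    have hI := Eh.insts (t := 10) (X := X) hB (g := iWform) (h := iWforms) rfl ψ.code L i x
      (fun j => ψ.inst (letters P r) ((asg L).update i x j)) (fun j =>
        (ih (⟨i, x, j⟩ :: L)).mono (k := Q * ψ.size r + 20 * (L.length + 1) + 200 * B + 1100)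
          (by simp only [List.length_cons]; omega)) (by omega)
    refine Fh.intro (h := X + 30 + 20) rfl (by simp only [WFormula.size]; omega) ?_
    exact Eh.sw 10 rfl (by omega) (by omega) (Eh.fst Eh.A)
      ((Eh.call₂ (fh_sumOp .shuf (fun _ _ => rfl) _) (by simp; omega)
        (Eh.natE (by omega)) hI).mono (by omega))
  | prodShuf i x ψ ih =>
    have hs := mul_quantifier_le Q x.size (r i) (ψ.size r)
    have hr := hB.inst i
    obtain ⟨X, hX⟩ : ∃ X, X = Q * ψ.size r + 20 * (L.length + 1) + 200 * B + 1100 + 50 * B + 40 :=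
      ⟨_, rfl⟩
    have hI := Eh.insts (t := 11) (X := X) hB (g := iWform) (h := iWforms) rfl ψ.code L i x
      (fun j => ψ.inst (letters P r) ((asg L).update i x j)) (fun j =>
        (ih (⟨i, x, j⟩ :: L)).mono (k := Q * ψ.size r + 20 * (L.length + 1) + 200 * B + 1100)
          (by simp only [List.length_cons]; omega)) (by omega)
    refine Fh.intro (h := X + 30 + 20) rfl (by simp only [WFormula.size]; omega) ?_
    exact Eh.sw 11 rfl (by omega) (by omega) (Eh.fst Eh.A)
      ((Eh.call₃ (fh_fold .shuf (fun _ _ => rfl) _ _) (by simp; omega)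
        (Eh.natE (by omega)) Eh.rexEps hI).mono (by omega))

end InstFormula

/-! ### The program for partial derivatives -/

section PdProgram

open WFOEIL.Expr Prog

variable {K : Type u}

theorem Val.dep_c1_le (m : ℕ) (a : Val K) (l : List (Val K)) : a.dep + 2 ≤ (node m (a :: l)).dep := by
  simp only [node, list, dep]; omega

theorem Val.dep_c2_le (m : ℕ) (a b : Val K) (l : List (Val K)) :
    b.dep + 3 ≤ (node m (a :: b :: l)).dep := by
  simp only [node, list, dep]; omega

theorem Val.dep_node₁_le {m : ℕ} (hm : m < 16) (a : Val K) : (node m [a]).dep ≤ a.dep + 6 := by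
  have : (Val.nat m : Val K).dep ≤ 5 :=
    (Val.dep_nat_le _).trans (Nat.succ_le_succ (Nat.size_le.2 (by omega)))
  simp only [node, list, dep]; omega

theorem Val.dep_node₂_le {m : ℕ} (hm : m < 16) (a b : Val K) :
    (node m [a, b]).dep ≤ max a.dep b.dep + 7 := by
  have : (Val.nat m : Val K).dep ≤ 5 :=
    (Val.dep_nat_le _).trans (Nat.succ_le_succ (Nat.size_le.2 (by omega)))
  simp only [node, list, dep]; omega

variable [CommSemiring K]

section Ring

/-- The code of a formal difference. -/
def ringCode (c : K × K) : Val K := .cons (.atom c.1) (.atom c.2)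

/-- The product of two formal differences. -/
def pm (c d : K × K) : K × K := (c.1 * d.1 + c.2 * d.2, c.1 * d.2 + c.2 * d.1)

theorem fh_mul (c d : K × K) :
    Fh bodies iMul (.cons (ringCode c) (ringCode d)) (ringCode (pm c d)) 10 :=
  Fh.intro (h := 0 + 8) rfl (by omega)
    (Eh.cons (Eh.add (Eh.mul Eh.AA Eh.AD) (Eh.mul Eh.DA Eh.DD))
      (Eh.add (Eh.mul Eh.AA Eh.DD) (Eh.mul Eh.DA Eh.AD)))

theorem fh_add (c d : K × K) :
    Fh bodies iAdd (.cons (ringCode c) (ringCode d)) (ringCode (c + d)) 10 :=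
  Fh.intro (h := 0 + 8) rfl (by omega) (Eh.cons (Eh.add Eh.AA Eh.AD) (Eh.add Eh.DA Eh.DD))

theorem fh_neg (c : K × K) : Fh bodies iNeg (ringCode c) (ringCode c.swap) 10 :=
  Fh.intro (h := 0 + 8) rfl (by omega) (Eh.cons Eh.D Eh.A)

theorem fh_isZero (c : K × K) : Fh bodies iIsZero (ringCode c) (.ofProp (c.1 = c.2)) 10 :=
  Fh.intro (h := 0 + 8) rfl (by omega) (Eh.atomEq Eh.A Eh.D)

end Ring

variable {A : Type} (cA : A → Val K)

mutual
theorem fh_nul (e : Rex K A) :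
    Fh bodies iNul (e.code cA) (.ofProp (e.nul = true)) (40 * (e.code cA).dep + 130) := by
  cases e with
  | const k | eps =>
    refine Fh.intro (h := 0 + 110 + 20) rfl (by omega) ?_
    rw [Val.ofProp_true (by rw [Rex.nul])]
    first
    | exact Eh.sw 0 rfl (by omega) (by omega) Eh.A Eh.tt
    | exact Eh.sw 1 rfl (by omega) (by omega) Eh.A Eh.tt
  | pil S =>
    refine Fh.intro (h := 0 + 110 + 20) rfl (by omega) ?_
    rw [Val.ofProp_false (by simp [Rex.nul])]
    exact Eh.sw 2 rfl (by omega) (by omega) Eh.A Eh.nil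
  | ne e =>
    refine Fh.intro (h := 0 + 110 + 20) rfl (by omega) ?_
    rw [Val.ofProp_false (by simp [Rex.nul])]
    exact Eh.sw 3 rfl (by omega) (by omega) Eh.A Eh.nil
  | alt e f =>
    have h1 := Val.dep_c1_le 4 (e.code cA) [f.code cA]
    have h2 := Val.dep_c2_le 4 (e.code cA) (f.code cA) []
    have ih₁ := fh_nul e
    have ih₂ := fh_nul f
    simp only [Rex.nul, Rex.code, Bool.or_eq_true]
    obtain ⟨X, hX⟩ : ∃ X, X = 40 * (Val.node 4 [e.code cA, f.code cA]).dep + 100 := ⟨_, rfl⟩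
    refine Fh.intro (h := X + 10 + 20) rfl (by omega) ?_
    exact Eh.sw 4 rfl (by omega) (by omega) Eh.A
      (Eh.or (Eh.call₁ ih₁ (by omega) (Eh.c1 Eh.X)) (Eh.call₁ ih₂ (by omega) (Eh.c2 Eh.X)))
  | had e f =>
    have h1 := Val.dep_c1_le 5 (e.code cA) [f.code cA]
    have h2 := Val.dep_c2_le 5 (e.code cA) (f.code cA) []
    have ih₁ := fh_nul e
    have ih₂ := fh_nul f
    simp only [Rex.nul, Rex.code, Bool.and_eq_true]
    obtain ⟨X, hX⟩ : ∃ X, X = 40 * (Val.node 5 [e.code cA, f.code cA]).dep + 100 := ⟨_, rfl⟩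
    refine Fh.intro (h := X + 10 + 20) rfl (by omega) ?_
    exact Eh.sw 5 rfl (by omega) (by omega) Eh.A
      (Eh.and (Eh.call₁ ih₁ (by omega) (Eh.c1 Eh.X)) (Eh.call₁ ih₂ (by omega) (Eh.c2 Eh.X)))
  | conc e f =>
    have h1 := Val.dep_c1_le 6 (e.code cA) [f.code cA]
    have h2 := Val.dep_c2_le 6 (e.code cA) (f.code cA) []
    have ih₁ := fh_nul e
    have ih₂ := fh_nul f
    simp only [Rex.nul, Rex.code, Bool.and_eq_true]
    obtain ⟨X, hX⟩ : ∃ X, X = 40 * (Val.node 6 [e.code cA, f.code cA]).dep + 100 := ⟨_, rfl⟩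
    refine Fh.intro (h := X + 10 + 20) rfl (by omega) ?_
    exact Eh.sw 6 rfl (by omega) (by omega) Eh.A
      (Eh.and (Eh.call₁ ih₁ (by omega) (Eh.c1 Eh.X)) (Eh.call₁ ih₂ (by omega) (Eh.c2 Eh.X)))
  | shuf e f =>
    have h1 := Val.dep_c1_le 7 (e.code cA) [f.code cA]
    have h2 := Val.dep_c2_le 7 (e.code cA) (f.code cA) []
    have ih₁ := fh_nul e
    have ih₂ := fh_nul f
    simp only [Rex.nul, Rex.code, Bool.and_eq_true]
    obtain ⟨X, hX⟩ : ∃ X, X = 40 * (Val.node 7 [e.code cA, f.code cA]).dep + 100 := ⟨_, rfl⟩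
    refine Fh.intro (h := X + 10 + 20) rfl (by omega) ?_
    exact Eh.sw 7 rfl (by omega) (by omega) Eh.A
      (Eh.and (Eh.call₁ ih₁ (by omega) (Eh.c1 Eh.X)) (Eh.call₁ ih₂ (by omega) (Eh.c2 Eh.X)))
  | det l =>
    have h1 := Val.dep_c1_le 8 (Rex.codeAny cA l) []
    have ih := fh_nulAny l
    simp only [Rex.nul, Rex.code]
    obtain ⟨X, hX⟩ : ∃ X, X = 40 * (Val.node 8 [Rex.codeAny cA l]).dep + 100 := ⟨_, rfl⟩
    refine Fh.intro (h := X + 10 + 20) rfl (by omega) ?_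
    exact Eh.sw 8 rfl (by omega) (by omega) Eh.A (Eh.call₁ ih (by omega) (Eh.c1 Eh.X))
  | ndet l =>
    have h1 := Val.dep_c1_le 9 (Rex.codeAny cA l) []
    have ih := fh_nulAny l
    have e1 : (Rex.nul (.ndet l) = true) = ¬ (Rex.nulAny l = true) := by simp [Rex.nul]
    rw [e1]
    simp only [Rex.code]
    obtain ⟨X, hX⟩ : ∃ X, X = 40 * (Val.node 9 [Rex.codeAny cA l]).dep + 100 := ⟨_, rfl⟩
    refine Fh.intro (h := X + 10 + 20) rfl (by omega) ?_
    exact Eh.sw 9 rfl (by omega) (by omega) Eh.A (Eh.not (Eh.call₁ ih (by omega) (Eh.c1 Eh.X)))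

theorem fh_nulAny (l : List (Rex K A)) :
    Fh bodies iNulAny (Rex.codeAny cA l) (.ofProp (Rex.nulAny l = true))
      (40 * (Rex.codeAny cA l).dep + 150) := by
  cases l with
  | nil =>
    refine Fh.intro (h := 0 + 20) rfl (by omega) ?_
    rw [Val.ofProp_false (by simp [Rex.nulAny])]
    exact Eh.ite_end Eh.X Eh.nil
  | cons e l =>
    have ih₁ := fh_nul e
    have ih₂ := fh_nulAny l
    simp only [Rex.nulAny, Rex.codeAny, Bool.or_eq_true, Val.dep]
    obtain ⟨X, hX⟩ : ∃ X, X = 40 * max (e.code cA).dep (Rex.codeAny cA l).dep + 160 := ⟨_, rfl⟩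
    refine Fh.intro (h := X + 20) rfl (by omega) ?_
    exact Eh.ite_cons Eh.X (Eh.or (Eh.call₁ ih₁ (by omega) Eh.A) (Eh.call₁ ih₂ (by omega) Eh.D))
end

theorem Eh.ringOne {ρ : List (Val K)} {h : ℕ} : Eh bodies ρ ringOne (ringCode (1, 0)) (h + 2) :=
  Eh.cons Eh.one Eh.zero

theorem Eh.ringZero {ρ : List (Val K)} {h : ℕ} : Eh bodies ρ ringZero (ringCode (0, 0)) (h + 2) :=
  Eh.cons Eh.zero Eh.zero

theorem fh_out (e : Rex K A) :
    Fh bodies iOut (e.code cA) (ringCode (e.out, 0)) (40 * (e.code cA).dep + 150) := by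
  induction e using Rex.rec (motive_2 := fun _ => True) with
  | nil | cons => trivial
  | const k =>
    exact Fh.intro (h := 0 + 110 + 20) rfl (by omega)
      (Eh.sw 0 rfl (by omega) (by omega) Eh.A (Eh.c1 Eh.X))
  | eps =>
    exact Fh.intro (h := 0 + 110 + 20) rfl (by omega)
      (Eh.sw 1 rfl (by omega) (by omega) Eh.A Eh.ringOne)
  | pil S =>
    exact Fh.intro (h := 0 + 110 + 20) rfl (by omega)
      (Eh.sw 2 rfl (by omega) (by omega) Eh.A Eh.ringZero)
  | ne e =>
    exact Fh.intro (h := 0 + 110 + 20) rfl (by omega)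
      (Eh.sw 3 rfl (by omega) (by omega) Eh.A Eh.ringZero)
  | alt e f ih₁ ih₂ =>
    have h1 := Val.dep_c1_le 4 (e.code cA) [f.code cA]
    have h2 := Val.dep_c2_le 4 (e.code cA) (f.code cA) []
    have h3 := fh_add (e.out, 0) (f.out, 0)
    rw [Prod.mk_add_mk, add_zero] at h3
    simp only [Rex.out, Rex.code]
    obtain ⟨X, hX⟩ : ∃ X, X = 40 * (Val.node 4 [e.code cA, f.code cA]).dep + 100 := ⟨_, rfl⟩
    refine Fh.intro (h := X + 10 + 20) rfl (by omega) ?_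
    exact Eh.sw 4 rfl (by omega) (by omega) Eh.A (Eh.call₂ h3 (by omega)
      (Eh.call₁ ih₁ (by omega) (Eh.c1 Eh.X)) (Eh.call₁ ih₂ (by omega) (Eh.c2 Eh.X)))
  | had e f ih₁ ih₂ =>
    have h1 := Val.dep_c1_le 5 (e.code cA) [f.code cA]
    have h2 := Val.dep_c2_le 5 (e.code cA) (f.code cA) []
    have h3 := fh_mul (e.out, 0) (f.out, 0)
    simp only [pm, mul_zero, zero_mul, add_zero] at h3
    simp only [Rex.out, Rex.code]
    obtain ⟨X, hX⟩ : ∃ X, X = 40 * (Val.node 5 [e.code cA, f.code cA]).dep + 100 := ⟨_, rfl⟩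
    refine Fh.intro (h := X + 10 + 20) rfl (by omega) ?_
    exact Eh.sw 5 rfl (by omega) (by omega) Eh.A (Eh.call₂ h3 (by omega)
      (Eh.call₁ ih₁ (by omega) (Eh.c1 Eh.X)) (Eh.call₁ ih₂ (by omega) (Eh.c2 Eh.X)))
  | conc e f ih₁ ih₂ =>
    have h1 := Val.dep_c1_le 6 (e.code cA) [f.code cA]
    have h2 := Val.dep_c2_le 6 (e.code cA) (f.code cA) []
    have h3 := fh_mul (e.out, 0) (f.out, 0)
    simp only [pm, mul_zero, zero_mul, add_zero] at h3
    simp only [Rex.out, Rex.code]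
    obtain ⟨X, hX⟩ : ∃ X, X = 40 * (Val.node 6 [e.code cA, f.code cA]).dep + 100 := ⟨_, rfl⟩
    refine Fh.intro (h := X + 10 + 20) rfl (by omega) ?_
    exact Eh.sw 6 rfl (by omega) (by omega) Eh.A (Eh.call₂ h3 (by omega)
      (Eh.call₁ ih₁ (by omega) (Eh.c1 Eh.X)) (Eh.call₁ ih₂ (by omega) (Eh.c2 Eh.X)))
  | shuf e f ih₁ ih₂ =>
    have h1 := Val.dep_c1_le 7 (e.code cA) [f.code cA]
    have h2 := Val.dep_c2_le 7 (e.code cA) (f.code cA) []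
    have h3 := fh_mul (e.out, 0) (f.out, 0)
    simp only [pm, mul_zero, zero_mul, add_zero] at h3
    simp only [Rex.out, Rex.code]
    obtain ⟨X, hX⟩ : ∃ X, X = 40 * (Val.node 7 [e.code cA, f.code cA]).dep + 100 := ⟨_, rfl⟩
    refine Fh.intro (h := X + 10 + 20) rfl (by omega) ?_
    exact Eh.sw 7 rfl (by omega) (by omega) Eh.A (Eh.call₂ h3 (by omega)
      (Eh.call₁ ih₁ (by omega) (Eh.c1 Eh.X)) (Eh.call₁ ih₂ (by omega) (Eh.c2 Eh.X)))
  | det l =>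
    have h1 := Val.dep_c1_le 8 (Rex.codeAny cA l) []
    have ih := fh_nulAny cA l
    simp only [Rex.out, Rex.code]
    obtain ⟨X, hX⟩ : ∃ X, X = 40 * (Val.node 8 [Rex.codeAny cA l]).dep + 120 := ⟨_, rfl⟩
    refine Fh.intro (h := X + 10 + 20) rfl (by omega) ?_
    refine Eh.sw 8 rfl (by omega) (by omega) Eh.A ?_
    split_ifs with hl
    · exact Eh.ite_pos hl (Eh.call₁ ih (by omega) (Eh.c1 Eh.X)) Eh.ringOne
    · exact Eh.ite_neg hl (Eh.call₁ ih (by omega) (Eh.c1 Eh.X)) Eh.ringZero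
  | ndet l =>
    have h1 := Val.dep_c1_le 9 (Rex.codeAny cA l) []
    have ih := fh_nulAny cA l
    simp only [Rex.out, Rex.code]
    obtain ⟨X, hX⟩ : ∃ X, X = 40 * (Val.node 9 [Rex.codeAny cA l]).dep + 120 := ⟨_, rfl⟩
    refine Fh.intro (h := X + 10 + 20) rfl (by omega) ?_
    refine Eh.sw 9 rfl (by omega) (by omega) Eh.A ?_
    split_ifs with hl
    · exact Eh.ite_pos hl (Eh.call₁ ih (by omega) (Eh.c1 Eh.X)) Eh.ringZero
    · exact Eh.ite_neg hl (Eh.call₁ ih (by omega) (Eh.c1 Eh.X)) Eh.ringOne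

/-! ### Codes of vectors -/

/-- Vectors are lists of states with formal differences as coefficients. -/
def vecCode {S : Type u} (c : S → Val K) (v : List ((K × K) × S)) : Val K :=
  .list (v.map fun x => .cons (ringCode x.1) (c x.2))

/-- A list of entries with coefficients in `K` as a vector, where `k` becomes the formal difference `k - 0`. -/
def toVec {S : Type u} (v : List (K × S)) : List ((K × K) × S) := v.map fun x => ((x.1, 0), x.2)

/-- The multiple `c • v` of a vector. -/
def scale {S : Type u} (c : K × K) (v : List ((K × K) × S)) : List ((K × K) × S) :=
  v.map fun x => (pm c x.1, x.2)

theorem fn_scale {S : Type u} (c : S → Val K) (k : K × K) (v : List ((K × K) × S)) :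
    Fn bodies iScale (.cons (ringCode k) (vecCode c v)) (vecCode c (scale k v))
      ((v.length + 1) * 2 ^ 11) := by
  induction v with
  | nil => exact ⟨_, rfl, (Ev.ite_end (Ev.snd Ev.var0) Ev.nil).mono (by norm_num)⟩
  | cons x v ih =>
    refine ⟨_, rfl, Ev.mono (Ev.ite_cons (Ev.snd Ev.var0) (Ev.cons (Ev.cons
      (Ev.call (Ev.cons (Ev.fst Ev.var0) (Ev.fst (Ev.fst (Ev.snd Ev.var0)))) (fh_mul k x.1))
      (Ev.snd (Ev.fst (Ev.snd Ev.var0))))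
      (Ev.call (Ev.cons (Ev.fst Ev.var0) (Ev.snd (Ev.snd Ev.var0))) ih))) ?_⟩
    simp only [List.length_cons]
    omega

theorem length_mul_le_pow (m k : ℕ) : (m + 1) * 2 ^ k ≤ 2 ^ (m + k) := by
  rw [pow_add]
  exact Nat.mul_le_mul_right _ Nat.lt_two_pow_self

theorem fh_scale {S : Type u} (c : S → Val K) (k : K × K) (v : List ((K × K) × S)) :
    Fh bodies iScale (.cons (ringCode k) (vecCode c v)) (vecCode c (scale k v))
      (v.length + 11) :=
  (fn_scale c k v).mono (length_mul_le_pow _ _)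

theorem fh_mapL {m : ℕ} (op : Rex K A → Rex K A → Rex K A)
    (hop : ∀ e f, (op e f).code cA = .node m [e.code cA, f.code cA]) (f : Rex K A)
    (v : List (K × Rex K A)) :
    Fh bodies iMapL (.cons (.nat m) (.cons (f.code cA) (vecCode (Rex.code cA) (toVec v))))
      (vecCode (Rex.code cA) (toVec (v.map fun x => (x.1, op x.2 f)))) (20 * v.length + 20) := by
  induction v with
  | nil => exact Fh.intro (h := 0 + 20) rfl (by omega) (Eh.ite_end Eh.DD Eh.nil)
  | cons x v ih =>
    refine Fh.intro (h := 20 * v.length + 20 + 20) rfl (by simp only [List.length_cons]; omega) ?_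
    refine Eh.ite_cons Eh.DD (Eh.cons (Eh.cons (Eh.fst Eh.ADD) ?_)
      (Eh.call₃ ih (by omega) Eh.A Eh.AD Eh.DDD))
    rw [hop]
    exact Eh.cons Eh.A (Eh.list₂ (Eh.snd Eh.ADD) Eh.AD)

theorem fh_mapR {m : ℕ} (op : Rex K A → Rex K A → Rex K A)
    (hop : ∀ e f, (op e f).code cA = .node m [e.code cA, f.code cA]) (e : Rex K A)
    (v : List (K × Rex K A)) :
    Fh bodies iMapR (.cons (.nat m) (.cons (e.code cA) (vecCode (Rex.code cA) (toVec v))))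
      (vecCode (Rex.code cA) (toVec (v.map fun x => (x.1, op e x.2)))) (20 * v.length + 20) := by
  induction v with
  | nil => exact Fh.intro (h := 0 + 20) rfl (by omega) (Eh.ite_end Eh.DD Eh.nil)
  | cons x v ih =>
    refine Fh.intro (h := 20 * v.length + 20 + 20) rfl (by simp only [List.length_cons]; omega) ?_
    refine Eh.ite_cons Eh.DD (Eh.cons (Eh.cons (Eh.fst Eh.ADD) ?_)
      (Eh.call₃ ih (by omega) Eh.A Eh.AD Eh.DDD))
    rw [hop]
    exact Eh.cons Eh.A (Eh.list₂ Eh.AD (Eh.snd Eh.ADD))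

theorem fh_mulOne (k l : K) :
    Fh bodies iMul (.cons (ringCode (k, 0)) (ringCode (l, 0))) (ringCode (k * l, 0)) 10 := by
  have := fh_mul (k, 0) (l, 0)
  simpa only [pm, mul_zero, zero_mul, add_zero] using this

theorem fh_hadRow (x : K × Rex K A) (u : List (K × Rex K A)) :
    Fh bodies iHadRow (.cons (.cons (ringCode (x.1, 0)) (x.2.code cA))
        (vecCode (Rex.code cA) (toVec u)))
      (vecCode (Rex.code cA) (toVec (u.map fun y => (x.1 * y.1, .had x.2 y.2))))
      (20 * u.length + 20) := by
  induction u with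
  | nil => exact Fh.intro (h := 0 + 20) rfl (by omega) (Eh.ite_end Eh.D Eh.nil)
  | cons y u ih =>
    refine Fh.intro (h := 20 * u.length + 20 + 20) rfl (by simp only [List.length_cons]; omega) ?_
    exact Eh.ite_cons Eh.D (Eh.cons (Eh.cons
      (Eh.call₂ (fh_mulOne x.1 y.1) (by omega) Eh.AA (Eh.fst Eh.AD))
      (Eh.node₂ (by omega) Eh.DA (Eh.snd Eh.AD)))
      (Eh.call₂ ih (by omega) Eh.A Eh.DD))

theorem fh_appVec {S : Type u} (c : S → Val K) (v w : List (K × S)) :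
    Fh bodies iApp (.cons (vecCode c (toVec v)) (vecCode c (toVec w)))
      (vecCode c (toVec (v ++ w))) (20 * v.length + 20) := by
  have := fh_app (K := K) ((toVec v).map fun x => .cons (ringCode x.1) (c x.2))
    ((toVec w).map fun x => .cons (ringCode x.1) (c x.2))
  simpa only [← List.map_append, toVec, vecCode, List.length_map] using this

theorem fh_had (v u : List (K × Rex K A)) :
    Fh bodies iHad (.cons (vecCode (Rex.code cA) (toVec v)) (vecCode (Rex.code cA) (toVec u)))
      (vecCode (Rex.code cA) (toVec
        (v.flatMap fun x => u.map fun y => (x.1 * y.1, .had x.2 y.2))))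
      (20 * v.length + 20 * u.length + 40) := by
  induction v with
  | nil => exact Fh.intro (h := 20 * u.length + 20) rfl (by omega) (Eh.ite_end Eh.A Eh.nil)
  | cons x v ih =>
    obtain ⟨X, hX⟩ : ∃ X, X = 20 * v.length + 20 * u.length + 40 := ⟨_, rfl⟩
    refine Fh.intro (h := X + 20) rfl (by simp only [List.length_cons]; omega) ?_
    rw [List.flatMap_cons]
    refine Eh.ite_cons Eh.A (Eh.call₂ (fh_appVec _ _ _) (by rw [List.length_map]; omega)
      (Eh.call₂ (fh_hadRow cA x u) (by omega) Eh.AA Eh.D) (Eh.call₂ ih (by omega) Eh.DA Eh.D))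

theorem fh_states (v : List (K × Rex K A)) (l : List (Rex K A)) :
    Fh bodies iStates (.cons (vecCode (Rex.code cA) (toVec v)) (Rex.codeAny cA l))
      (Rex.codeAny cA (v.map (fun x => x.2) ++ l)) (20 * v.length + 20) := by
  induction v with
  | nil => exact Fh.intro (h := 0 + 20) rfl (by omega) (Eh.ite_end Eh.A Eh.D)
  | cons x v ih =>
    refine Fh.intro (h := 20 * v.length + 20 + 20) rfl (by simp only [List.length_cons]; omega) ?_
    exact Eh.ite_cons Eh.A (Eh.cons (Eh.snd Eh.AA) (Eh.call₂ ih (by omega) Eh.DA Eh.D))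

end PdProgram

/-! ### Bounds for partial derivatives -/

section PdSpec

open WFOEIL.Expr Prog

variable {K : Type u} [CommSemiring K] {A : Type} {cA : A → Val K}

mutual
theorem Rex.code_inj (hcA : Function.Injective cA) (e f : Rex K A)
    (h : e.code cA = f.code cA) : e = f := by
  cases e <;> cases f <;>
    simp only [Rex.code, Val.node, Val.list, Val.cons.injEq, Val.nat_injective.eq_iff,
      Val.atom.injEq, reduceCtorEq, Nat.reduceEqDiff, OfNat.ofNat_ne_zero, OfNat.zero_ne_ofNat,
      OfNat.ofNat_ne_one, OfNat.one_ne_ofNat, zero_ne_one, one_ne_zero, and_true, true_and,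
      false_and] at h
  case const.const => rw [h]
  case eps.eps => rfl
  case pil.pil => rw [List.map_injective_iff.2 hcA (Val.list_injective h)]
  case ne.ne => rw [Rex.code_inj hcA _ _ h]
  case det.det => rw [Rex.codeAny_inj hcA _ _ h]
  case ndet.ndet => rw [Rex.codeAny_inj hcA _ _ h]
  all_goals rw [Rex.code_inj hcA _ _ h.1, Rex.code_inj hcA _ _ h.2]

theorem Rex.codeAny_inj (hcA : Function.Injective cA) (l m : List (Rex K A))
    (h : Rex.codeAny cA l = Rex.codeAny cA m) : l = m := by
  cases l <;> cases m <;> simp only [Rex.codeAny, Val.cons.injEq, reduceCtorEq] at h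
  · rfl
  · rw [Rex.code_inj hcA _ _ h.1, Rex.codeAny_inj hcA _ _ h.2]
end

theorem Rex.code_injective (hcA : Function.Injective cA) :
    Function.Injective (Rex.code cA : Rex K A → Val K) := Rex.code_inj hcA

/-- The bounds, in terms of a number `h`, for an expression and for the computation of its partial
derivatives. -/
structure PdBound (cA : A → Val K) (B h : ℕ) (e : Rex K A) : Prop where
  dep : (e.code cA).dep ≤ (B + 20) * h
  length : ∀ a, (e.pd a).length ≤ h
  pd : ∀ a, Fh bodies iPd (.cons (cA a) (e.code cA)) (vecCode (Rex.code cA) (toVec (e.pd a)))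
    (100 * (B + 30) * h)

variable {B h h' : ℕ} {e f : Rex K A}

namespace PdBound

theorem mono (H : PdBound cA B h e) (hh : h ≤ h') : PdBound cA B h' e :=
  ⟨H.dep.trans (Nat.mul_le_mul_left _ hh), fun a => (H.length a).trans hh,
    fun a => (H.pd a).mono (Nat.mul_le_mul_left _ hh)⟩

theorem const (k : K) : PdBound cA B 2 (.const k) := by
  refine ⟨?_, fun a => by simp [Rex.pd], fun a => ?_⟩
  · have := Val.dep_node₁_le (m := 0) (by omega) (.cons (.atom k) (.atom 0))
    simp only [Val.dep] at this
    simp only [Rex.code]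
    omega
  · rw [Rex.pd]
    exact Fh.intro (h := 0 + 110 + 20) rfl (by omega)
      (Eh.sw 0 rfl (by omega) (by omega) Eh.AD (Eh.list₁ (Eh.cons Eh.ringOne Eh.D)))

theorem eps : PdBound cA B 2 (.eps : Rex K A) := by
  refine ⟨?_, fun a => by simp [Rex.pd], fun a => ?_⟩
  · have : (Val.nat 1 : Val K).dep ≤ 5 :=
      (Val.dep_nat_le _).trans (Nat.succ_le_succ (Nat.size_le.2 (by omega)))
    simp only [Rex.code, Val.node, Val.dep, Val.list]
    omega
  · rw [Rex.pd]
    exact Fh.intro (h := 0 + 110 + 20) rfl (by omega)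
      (Eh.sw 1 rfl (by omega) (by omega) Eh.AD Eh.nil)

theorem pil (hcA : Function.Injective cA) (hB : ∀ a, (cA a).dep ≤ B) (S : List A) :
    PdBound cA B (S.length + 2) (.pil S) := by
  classical
  refine ⟨?_, fun a => ?_, fun a => ?_⟩
  · have h1 := Val.dep_node₁_le (m := 2) (by omega) (.list (S.map cA))
    have h2 := Val.dep_list_le (S.map cA) B (by simpa using fun a _ => hB a)
    rw [List.length_map] at h2
    simp only [Rex.code]
    nlinarith
  · rw [Rex.pd_pil]
    split_ifs <;> simp
  · have h1 := hB a
    have h2 := fh_mem (cA a) (S.map cA)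
    rw [List.length_map, List.mem_map_of_injective hcA |> propext] at h2
    have h3 : 12 * B + 20 * S.length + 200 ≤ 100 * (B + 30) * (S.length + 2) := by
      nlinarith
    obtain ⟨X, hX⟩ : ∃ X, X = 12 * B + 20 * S.length + 100 := ⟨_, rfl⟩
    refine Fh.intro (h := X + 50 + 20) rfl (by omega) ?_
    refine Eh.sw 2 rfl (by omega) (by omega) Eh.AD ?_
    rw [Rex.pd_pil]
    split_ifs with ha
    · exact Eh.ite_pos ha (Eh.call₂ h2 (by omega) Eh.A (Eh.c1 Eh.D))
        (Eh.list₁ (Eh.cons Eh.ringOne Eh.rexEps))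
    · exact Eh.ite_neg ha (Eh.call₂ h2 (by omega) Eh.A (Eh.c1 Eh.D)) Eh.nil

theorem ne (H : PdBound cA B h e) : PdBound cA B (h + 1) (.ne e) := by
  refine ⟨?_, fun a => ?_, fun a => ?_⟩
  · have h1 := Val.dep_node₁_le (m := 3) (by omega) (e.code cA)
    have h2 := H.dep
    simp only [Rex.code, mul_add, mul_one]
    omega
  · have := H.length a
    simp only [Rex.pd]
    omega
  · have h1 := H.pd a
    rw [Rex.pd]
    rw [mul_add, mul_one]
    obtain ⟨X, hX⟩ : ∃ X, X = 100 * (B + 30) * h := ⟨_, rfl⟩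
    refine Fh.intro (h := X + 110 + 20) rfl (by omega) ?_
    exact Eh.sw 3 rfl (by omega) (by omega) Eh.AD (Eh.call₂ h1 (by omega) Eh.A (Eh.c1 Eh.D))

theorem alt (H : PdBound cA B h e) (H' : PdBound cA B h' f) :
    PdBound cA B (h + h' + 1) (.alt e f) := by
  refine ⟨?_, fun a => ?_, fun a => ?_⟩
  · have h1 := Val.dep_node₂_le (m := 4) (by omega) (e.code cA) (f.code cA)
    have h2 := H.dep
    have h3 := H'.dep
    simp only [Rex.code, mul_add, mul_one] at *
    omega
  · have := H.length a
    have := H'.length a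
    simp only [Rex.pd, List.length_append]
    omega
  · have h1 := H.pd a
    have h2 := H'.pd a
    have h3 := H.length a
    have h4 : 100 * h ≤ 100 * (B + 30) * h := Nat.mul_le_mul_right _ (by omega)
    rw [Rex.pd]
    simp only [mul_add _ (h + h') 1, mul_add _ h h', mul_one]
    obtain ⟨X, hX⟩ : ∃ X, X = 100 * (B + 30) * h + 100 * (B + 30) * h' := ⟨_, rfl⟩
    refine Fh.intro (h := X + 150 + 20) rfl (by omega) ?_
    exact Eh.sw 4 rfl (by omega) (by omega) Eh.AD (Eh.call₂ (fh_appVec _ _ _) (by omega)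
      (Eh.call₂ h1 (by omega) Eh.A (Eh.c1 Eh.D)) (Eh.call₂ h2 (by omega) Eh.A (Eh.c2 Eh.D)))

theorem add_two_le_mul (hh : 2 ≤ h) (hh' : 2 ≤ h') : h + 2 ≤ h * h' ∧ h' + 2 ≤ h * h' ∧
    h + h' ≤ h * h' := by
  refine ⟨?_, ?_, ?_⟩ <;> nlinarith

theorem mul_bound (c : ℕ) (hh : 2 ≤ h) (hh' : 2 ≤ h') : c * h + c * 2 ≤ c * (h * h') ∧
    c * h' + c * 2 ≤ c * (h * h') ∧ c * h + c * h' ≤ c * (h * h') := by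
  obtain ⟨h1, h2, h3⟩ := add_two_le_mul hh hh'
  simp only [← mul_add]
  exact ⟨Nat.mul_le_mul_left _ h1, Nat.mul_le_mul_left _ h2, Nat.mul_le_mul_left _ h3⟩

theorem dep_two {m : ℕ} (hm : m < 16) (hh : 2 ≤ h) (hh' : 2 ≤ h') (H : PdBound cA B h e)
    (H' : PdBound cA B h' f) :
    (Val.node m [e.code cA, f.code cA]).dep ≤ (B + 20) * (h * h') := by
  have h1 := Val.dep_node₂_le hm (e.code cA) (f.code cA)
  have h2 := H.dep
  have h3 := H'.dep
  have h4 := mul_bound (B + 20) hh hh'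
  omega

theorem had (hh : 2 ≤ h) (hh' : 2 ≤ h') (H : PdBound cA B h e) (H' : PdBound cA B h' f) :
    PdBound cA B (h * h') (.had e f) := by
  refine ⟨?_, fun a => ?_, fun a => ?_⟩
  · rw [Rex.code]
    exact dep_two (by omega) hh hh' H H'
  · rw [Rex.pd, List.length_flatMap]
    simp only [List.length_map, List.map_const', List.sum_replicate, smul_eq_mul]
    exact Nat.mul_le_mul (H.length a) (H'.length a)
  · have h1 := H.pd a
    have h2 := H'.pd a
    have h3 := H.length a
    have h4 := H'.length a
    have h5 := mul_bound (100 * (B + 30)) hh hh'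
    have h6 : 100 * h ≤ 100 * (B + 30) * h := Nat.mul_le_mul_right _ (by omega)
    have h7 : 100 * h' ≤ 100 * (B + 30) * h' := Nat.mul_le_mul_right _ (by omega)
    rw [Rex.pd]
    obtain ⟨X, hX⟩ : ∃ X, X + 200 = 100 * (B + 30) * (h * h') := ⟨100 * (B + 30) * (h * h') - 200, by omega⟩
    refine Fh.intro (h := X + 150 + 20) rfl (by omega) ?_
    exact Eh.sw 5 rfl (by omega) (by omega) Eh.AD (Eh.call₂ (fh_had _ _ _) (by omega)
      (Eh.call₂ h1 (by omega) Eh.A (Eh.c1 Eh.D)) (Eh.call₂ h2 (by omega) Eh.A (Eh.c2 Eh.D)))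

theorem conc (H : PdBound cA B h e) (H' : PdBound cA B h' f) :
    PdBound cA B (h + h' + 1) (.conc e f) := by
  refine ⟨?_, fun a => ?_, fun a => ?_⟩
  · have h1 := Val.dep_node₂_le (m := 6) (by omega) (e.code cA) (f.code cA)
    have h2 := H.dep
    have h3 := H'.dep
    simp only [Rex.code, mul_add, mul_one] at *
    omega
  · have := H.length a
    have := H'.length a
    rw [Rex.pd]
    split_ifs <;> simp only [List.length_append, List.length_map, List.length_nil] <;> omega
  · have h1 := H.pd a
    have h2 := H'.pd a
    have h3 := H.length a
    have h4 := H'.length a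
    have h5 := H.dep
    have h6 : 40 * ((B + 20) * h) + 60 * h ≤ 100 * (B + 30) * h := by
      nlinarith [Nat.zero_le (B * h)]
    have h7 : 100 * h' ≤ 100 * (B + 30) * h' := Nat.mul_le_mul_right _ (by omega)
    rw [Rex.pd]
    simp only [mul_add _ (h + h') 1, mul_add _ h h', mul_one]
    obtain ⟨X, hX⟩ : ∃ X, X = 100 * (B + 30) * h + 100 * (B + 30) * h' := ⟨_, rfl⟩
    refine Fh.intro (h := X + 250 + 20) rfl (by omega) ?_
    refine Eh.sw 6 rfl (by omega) (by omega) Eh.AD (Eh.call₂ (fh_appVec _ _ _)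
      (by rw [List.length_map]; omega)
      (Eh.call₃ (fh_mapL cA .conc (fun _ _ => rfl) f (e.pd a)) (by omega)
        (Eh.natE (by omega)) (Eh.c2 Eh.D) (Eh.call₂ h1 (by omega) Eh.A (Eh.c1 Eh.D))) ?_)
    have h8 := fh_nul cA e
    have h9 := fh_out cA e
    have h10 := fh_scale (Rex.code cA) (e.out, 0) (toVec (f.pd a))
    have h11 : scale (e.out, 0) (toVec (f.pd a)) =
        toVec ((f.pd a).map fun x => (e.out * x.1, x.2)) := by
      simp [scale, toVec, pm, Function.comp_def]
    rw [h11, toVec, List.length_map] at h10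
    split_ifs with hn
    · exact Eh.ite_pos hn (Eh.call₁ h8 (by omega) (Eh.c1 Eh.D))
        (Eh.call₂ h10 (by omega) (Eh.call₁ h9 (by omega) (Eh.c1 Eh.D))
          (Eh.call₂ h2 (by omega) Eh.A (Eh.c2 Eh.D)))
    · exact Eh.ite_neg hn (Eh.call₁ h8 (by omega) (Eh.c1 Eh.D)) Eh.nil

theorem shuf (hh : 2 ≤ h) (hh' : 2 ≤ h') (H : PdBound cA B h e) (H' : PdBound cA B h' f) :
    PdBound cA B (h * h') (.shuf e f) := by
  refine ⟨?_, fun a => ?_, fun a => ?_⟩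
  · rw [Rex.code]
    exact dep_two (by omega) hh hh' H H'
  · have := H.length a
    have := H'.length a
    have := add_two_le_mul hh hh'
    simp only [Rex.pd, List.length_append, List.length_map]
    omega
  · have h1 := H.pd a
    have h2 := H'.pd a
    have h3 := H.length a
    have h4 := H'.length a
    have h5 := mul_bound (100 * (B + 30)) hh hh'
    have h6 : 100 * h ≤ 100 * (B + 30) * h := Nat.mul_le_mul_right _ (by omega)
    have h7 : 100 * h' ≤ 100 * (B + 30) * h' := Nat.mul_le_mul_right _ (by omega)
    rw [Rex.pd]
    obtain ⟨X, hX⟩ : ∃ X, X + 300 = 100 * (B + 30) * (h * h') := ⟨100 * (B + 30) * (h * h') - 300, by omega⟩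
    refine Fh.intro (h := X + 200 + 20) rfl (by omega) ?_
    exact Eh.sw 7 rfl (by omega) (by omega) Eh.AD (Eh.call₂ (fh_appVec _ _ _)
      (by rw [List.length_map]; omega)
      (Eh.call₃ (fh_mapL cA .shuf (fun _ _ => rfl) f (e.pd a)) (by omega)
        (Eh.natE (by omega)) (Eh.c2 Eh.D) (Eh.call₂ h1 (by omega) Eh.A (Eh.c1 Eh.D)))
      (Eh.call₃ (fh_mapR cA .shuf (fun _ _ => rfl) e (f.pd a)) (by omega)
        (Eh.natE (by omega)) (Eh.c1 Eh.D) (Eh.call₂ h2 (by omega) Eh.A (Eh.c2 Eh.D))))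

theorem fh_pdAny {c : ℕ} (a : A) (l : List (Rex K A)) (hl : ∀ x ∈ l, PdBound cA B c x) :
    Fh bodies iPdAny (.cons (cA a) (Rex.codeAny cA l)) (Rex.codeAny cA (Rex.pdAny a l))
      (100 * (B + 30) * c + 20 * l.length + 60) := by
  induction l with
  | nil =>
    rw [Rex.pdAny]
    exact Fh.intro (h := 0 + 20) rfl (by omega) (Eh.ite_end Eh.D Eh.nil)
  | cons e l ih =>
    have ih := ih fun x hx => hl x (by simp [hx])
    have H := hl e (by simp)
    have h1 := H.pd a
    have h2 := H.length a
    have h3 : 100 * c ≤ 100 * (B + 30) * c := Nat.mul_le_mul_right _ (by omega)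
    rw [Rex.pdAny]
    obtain ⟨X, hX⟩ : ∃ X, X = 100 * (B + 30) * c + 20 * l.length + 60 := ⟨_, rfl⟩
    refine Fh.intro (h := X + 20) rfl (by simp only [List.length_cons]; omega) ?_
    exact Eh.ite_cons Eh.D (Eh.call₂ (fh_states _ _ _) (by omega)
      (Eh.call₂ h1 (by omega) Eh.A Eh.AD) (Eh.call₂ ih (by omega) Eh.A Eh.DD))

theorem length_pdAny_le {c : ℕ} (a : A) (l : List (Rex K A)) (hl : ∀ x ∈ l, PdBound cA B c x) :
    (Rex.pdAny a l).length ≤ l.length * c := by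
  induction l with
  | nil => simp [Rex.pdAny]
  | cons e l ih =>
    have ih := ih fun x hx => hl x (by simp [hx])
    have h2 := (hl e (by simp)).length a
    simp only [Rex.pdAny, List.length_append, List.length_map, List.length_cons, add_mul, one_mul]
    omega

theorem dep_any {c m : ℕ} (hm : m < 16) {l : List (Rex K A)} (hlc : l.length ≤ c)
    (hl : ∀ x ∈ l, PdBound cA B c x) :
    (Val.node m [Rex.codeAny cA l]).dep ≤ (B + 20) * (c + 2) ^ 2 := by
  have h1 := Val.dep_node₁_le hm (Rex.codeAny cA l)
  rw [Rex.codeAny_eq] at *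
  have h2 := Val.dep_list_le (l.map (Rex.code cA)) ((B + 20) * c) (by
    simpa using fun x hx => (hl x hx).dep)
  rw [List.length_map] at h2
  nlinarith [Nat.zero_le (B * c), Nat.zero_le (B * c ^ 2), Nat.zero_le (c ^ 2)]

theorem fh_dedup_pdAny {c : ℕ} (hcA : Function.Injective cA) [DecidableEq (Rex K A)] (a : A)
    {l : List (Rex K A)} (hlc : l.length ≤ c) (hl : ∀ x ∈ l, PdBound cA B c x)
    (hd : ∀ x ∈ Rex.pdAny a l, (x.code cA).dep ≤ (B + 20) * c) :
    Fh bodies iDedup (Rex.codeAny cA (Rex.pdAny a l))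
      (Rex.codeAny cA (Rex.pdAny a l).dedup) (12 * ((B + 20) * c) + 20 * (c * c) + 60) := by
  classical
  have h1 := fh_dedup ((Rex.pdAny a l).map (Rex.code cA)) ((B + 20) * c) (by simpa using hd)
  rw [List.dedup_map_of_injective (Rex.code_injective hcA), List.length_map] at h1
  rw [Rex.codeAny_eq, Rex.codeAny_eq]
  refine h1.mono ?_
  have h2 := (length_pdAny_le a l hl).trans (Nat.mul_le_mul_right c hlc)
  omega

theorem any_bound (B c : ℕ) : 100 * (B + 30) * c + 12 * ((B + 20) * c) + 20 * (c * c) + 20 * c + 400 ≤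
    100 * (B + 30) * (c + 2) ^ 2 := by
  nlinarith [Nat.zero_le (B * c), Nat.zero_le (B * c ^ 2), Nat.zero_le (c ^ 2)]

theorem det {c : ℕ} (hcA : Function.Injective cA) {l : List (Rex K A)} (hlc : l.length ≤ c)
    (hl : ∀ x ∈ l, PdBound cA B c x)
    (hd : ∀ a, ∀ x ∈ Rex.pdAny a l, (x.code cA).dep ≤ (B + 20) * c) :
    PdBound cA B ((c + 2) ^ 2) (.det l) := by
  refine ⟨dep_any (by omega) hlc hl, fun a => ?_, fun a => ?_⟩
  · simp only [Rex.pd, List.length_singleton]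
    nlinarith
  · classical
    have h1 := fh_pdAny a l hl
    have h2 := fh_dedup_pdAny hcA a hlc hl (hd a)
    have h3 := any_bound B c
    rw [Rex.pd]
    obtain ⟨X, hX⟩ : ∃ X, X + 300 = 100 * (B + 30) * (c + 2) ^ 2 := ⟨100 * (B + 30) * (c + 2) ^ 2 - 300, by omega⟩
    refine Fh.intro (h := X + 200 + 20) rfl (by omega) ?_
    exact Eh.sw 8 rfl (by omega) (by omega) Eh.AD (Eh.list₁ (Eh.cons Eh.ringOne
      (Eh.node₁ (by omega) (Eh.call₁ h2 (by omega)
        (Eh.call₂ h1 (by omega) Eh.A (Eh.c1 Eh.D))))))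

theorem ndet {c : ℕ} (hcA : Function.Injective cA) {l : List (Rex K A)} (hlc : l.length ≤ c)
    (hl : ∀ x ∈ l, PdBound cA B c x)
    (hd : ∀ a, ∀ x ∈ Rex.pdAny a l, (x.code cA).dep ≤ (B + 20) * c) :
    PdBound cA B ((c + 2) ^ 2) (.ndet l) := by
  refine ⟨dep_any (by omega) hlc hl, fun a => ?_, fun a => ?_⟩
  · simp only [Rex.pd, List.length_singleton]
    nlinarith
  · classical
    have h1 := fh_pdAny a l hl
    have h2 := fh_dedup_pdAny hcA a hlc hl (hd a)
    have h3 := any_bound B c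
    rw [Rex.pd]
    obtain ⟨X, hX⟩ : ∃ X, X + 300 = 100 * (B + 30) * (c + 2) ^ 2 := ⟨100 * (B + 30) * (c + 2) ^ 2 - 300, by omega⟩
    refine Fh.intro (h := X + 200 + 20) rfl (by omega) ?_
    exact Eh.sw 9 rfl (by omega) (by omega) Eh.AD (Eh.list₁ (Eh.cons Eh.ringOne
      (Eh.node₁ (by omega) (Eh.call₁ h2 (by omega)
        (Eh.call₂ h1 (by omega) Eh.A (Eh.c1 Eh.D))))))

end PdBound

/-- All iterated partial derivatives of `e` satisfy the bounds for `e`. -/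
theorem pdBound_of_mem_st (hcA : Function.Injective cA) (hB : ∀ a, (cA a).dep ≤ B) (e x : Rex K A)
    (hx : x ∈ e.st) : PdBound cA B e.hgt x := by
  classical
  induction e using Rex.rec (motive_2 := fun l => ∀ e ∈ l, ∀ x ∈ e.st, PdBound cA B e.hgt x)
    generalizing x with
  | const k =>
    simp only [Rex.st, Finset.mem_singleton] at hx
    rw [hx]
    exact PdBound.const k
  | eps =>
    simp only [Rex.st, Finset.mem_singleton] at hx
    rw [hx]
    exact PdBound.eps
  | pil S =>
    simp only [Rex.st, Finset.mem_insert, Finset.mem_singleton] at hx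
    rcases hx with rfl | rfl
    · exact PdBound.pil hcA hB S
    · exact PdBound.eps.mono (by simp [Rex.hgt])
  | ne e ih =>
    simp only [Rex.st, Finset.mem_insert] at hx
    rcases hx with rfl | hx
    · exact (ih _ e.self_mem_st).ne
    · exact (ih x hx).mono (by simp [Rex.hgt])
  | alt e f ih₁ ih₂ =>
    simp only [Rex.st, Finset.mem_insert, Finset.mem_union] at hx
    rcases hx with rfl | hx | hx
    · exact (ih₁ _ e.self_mem_st).alt (ih₂ _ f.self_mem_st)
    · exact (ih₁ x hx).mono (by simp only [Rex.hgt]; omega)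
    · exact (ih₂ x hx).mono (by simp only [Rex.hgt]; omega)
  | had e f ih₁ ih₂ =>
    simp only [Rex.st, Finset.mem_image₂] at hx
    obtain ⟨y, hy, z, hz, rfl⟩ := hx
    exact (ih₁ y hy).had e.two_le_hgt f.two_le_hgt (ih₂ z hz)
  | conc e f ih₁ ih₂ =>
    simp only [Rex.st, Finset.mem_image, Finset.mem_union] at hx
    rcases hx with ⟨y, hy, rfl⟩ | hx
    · exact (ih₁ y hy).conc (ih₂ _ f.self_mem_st)
    · exact (ih₂ x hx).mono (by simp only [Rex.hgt]; omega)
  | shuf e f ih₁ ih₂ =>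
    simp only [Rex.st, Finset.mem_image₂] at hx
    obtain ⟨y, hy, z, hz, rfl⟩ := hx
    exact (ih₁ y hy).shuf e.two_le_hgt f.two_le_hgt (ih₂ z hz)
  | det l ih =>
    simp only [Rex.st, Finset.mem_image] at hx
    obtain ⟨m, hm, rfl⟩ := hx
    rw [mem_boundedLists] at hm
    have key : ∀ y ∈ Rex.stAny l, PdBound cA B (Rex.cntAny l) y := fun y hy => by
      obtain ⟨e, he, hy⟩ := (Rex.mem_stAny _ _).1 hy
      exact (ih e he y hy).mono (e.hgt_le_cnt.trans (Rex.cnt_le_cntAny he))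
    refine PdBound.det hcA hm.1 (fun y hy => key y (hm.2 y hy)) fun a y hy => ?_
    obtain ⟨z, hz, p, hp, rfl⟩ := (Rex.mem_pdAny _ _ _).1 hy
    obtain ⟨e, he, hz⟩ := (Rex.mem_stAny _ _).1 (hm.2 z hz)
    exact (key _ ((Rex.mem_stAny _ _).2 ⟨e, he, Rex.pd_mem_st e z hz a p hp⟩)).dep
  | ndet l ih =>
    simp only [Rex.st, Finset.mem_image] at hx
    obtain ⟨m, hm, rfl⟩ := hx
    rw [mem_boundedLists] at hm
    have key : ∀ y ∈ Rex.stAny l, PdBound cA B (Rex.cntAny l) y := fun y hy => by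
      obtain ⟨e, he, hy⟩ := (Rex.mem_stAny _ _).1 hy
      exact (ih e he y hy).mono (e.hgt_le_cnt.trans (Rex.cnt_le_cntAny he))
    refine PdBound.ndet hcA hm.1 (fun y hy => key y (hm.2 y hy)) fun a y hy => ?_
    obtain ⟨z, hz, p, hp, rfl⟩ := (Rex.mem_pdAny _ _ _).1 hy
    obtain ⟨e, he, hz⟩ := (Rex.mem_stAny _ _).1 (hm.2 z hz)
    exact (key _ ((Rex.mem_stAny _ _).2 ⟨e, he, Rex.pd_mem_st e z hz a p hp⟩)).dep
  | nil e he => simp at he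
  | cons e l ih ih' f hf x hx =>
    rcases List.mem_cons.1 hf with rfl | hf
    · exact ih x hx
    · exact ih' f hf x hx

end PdSpec

/-! ### Sparse vectors -/

section Vectors

open Classical

variable {K S : Type u} {R : Finset S}

variable (R) in
/-- The entries of `v` have different states, all of them in `R`. -/
structure Supported (v : List ((K × K) × S)) : Prop where
  nodup : (v.map fun x => x.2).Nodup
  mem : ∀ x ∈ v, x.2 ∈ R

namespace Supported

variable {u v : List ((K × K) × S)}

protected theorem nil : Supported R ([] : List ((K × K) × S)) := ⟨by simp, by simp⟩

theorem length_le (H : Supported R v) : v.length ≤ R.card := by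
  rw [← List.length_map (fun x => x.2), ← List.toFinset_card_of_nodup H.nodup]
  refine Finset.card_le_card fun s hs => ?_
  obtain ⟨x, hx, rfl⟩ := List.mem_map.1 (List.mem_toFinset.1 hs)
  exact H.mem x hx

theorem sublist (H : Supported R v) (h : u.Sublist v) : Supported R u :=
  ⟨H.nodup.sublist (h.map _), fun x hx => H.mem x (h.subset hx)⟩

/-- Omits the entries with coefficient zero. -/
noncomputable def _root_.WFOEIL.nz (v : List ((K × K) × S)) : List ((K × K) × S) :=
  v.filter fun x => decide (x.1.1 ≠ x.1.2)

theorem nz (H : Supported R v) : Supported R (nz v) := H.sublist List.filter_sublist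

end Supported

variable [CommSemiring K]

/-- Adds the entry `x` to the vector `v`. -/
noncomputable def ins (x : (K × K) × S) : List ((K × K) × S) → List ((K × K) × S)
  | [] => [x]
  | y :: v => if x.2 = y.2 then (x.1 + y.1, y.2) :: v else y :: ins x v

/-- `c • v + u` -/
noncomputable def axpy (c : K × K) (v u : List ((K × K) × S)) : List ((K × K) × S) :=
  v.foldr (fun x u => ins (pm c x.1, x.2) u) u

/-- The coefficient of a vector at the state `p`. -/
noncomputable def coef (p : S) : List ((K × K) × S) → K × K
  | [] => (0, 0)
  | x :: v => if x.2 = p then x.1 + coef p v else coef p v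

/-- Eliminates in `v` the first state of `b`, without division. -/
noncomputable def step (v : List ((K × K) × S)) : List ((K × K) × S) → List ((K × K) × S)
  | [] => v
  | x :: b => axpy (coef x.2 v).swap (x :: b) (scale x.1 v)

/-- Reduces `v` by the vectors in `Bs`, beginning with the last. -/
noncomputable def red (v : List ((K × K) × S)) (Bs : List (List ((K × K) × S))) :
    List ((K × K) × S) :=
  Bs.foldr (fun b v => step v b) v

namespace Supported

variable {u v b : List ((K × K) × S)} {x : (K × K) × S} {Bs : List (List ((K × K) × S))}

theorem mem_map_ins {s : S} (hs : s ∈ (WFOEIL.ins x v).map fun x => x.2) :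
    s = x.2 ∨ s ∈ v.map fun x => x.2 := by
  induction v with
  | nil => simpa [WFOEIL.ins] using hs
  | cons y v ih =>
    rw [WFOEIL.ins] at hs
    split_ifs at hs
    · exact Or.inr (by simpa using hs)
    · rcases List.mem_cons.1 hs with hs | hs
      · exact Or.inr (by simp [hs])
      · exact (ih hs).imp_right fun h => List.mem_cons_of_mem _ h

theorem ins (H : Supported R v) (hx : x.2 ∈ R) : Supported R (ins x v) := by
  induction v with
  | nil => exact ⟨by simp [WFOEIL.ins], by simpa [WFOEIL.ins] using hx⟩
  | cons y v ih =>
    rw [WFOEIL.ins]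
    have hn := H.nodup
    simp only [List.map_cons, List.nodup_cons] at hn
    split_ifs with h
    · refine ⟨by simpa using hn, fun z hz => ?_⟩
      rcases List.mem_cons.1 hz with rfl | hz
      · exact H.mem y (by simp)
      · exact H.mem z (by simp [hz])
    · have ih := ih ⟨hn.2, fun z hz => H.mem z (by simp [hz])⟩
      refine ⟨?_, fun z hz => ?_⟩
      · rw [List.map_cons, List.nodup_cons]
        refine ⟨fun hs => ?_, ih.nodup⟩
        rcases mem_map_ins hs with hs | hs
        · exact h hs.symm
        · exact hn.1 hs
      · rcases List.mem_cons.1 hz with rfl | hz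
        · exact H.mem z (by simp)
        · exact ih.mem z hz

theorem axpy (c : K × K) (hv : ∀ x ∈ v, x.2 ∈ R) (H : Supported R u) :
    Supported R (axpy c v u) := by
  induction v with
  | nil => exact H
  | cons x v ih => exact (ih fun y hy => hv y (by simp [hy])).ins (hv x (by simp))

theorem scale (c : K × K) (H : Supported R v) : Supported R (scale c v) := by
  refine ⟨?_, ?_⟩
  · rw [WFOEIL.scale, List.map_map]
    exact H.nodup
  · intro x hx
    obtain ⟨y, hy, rfl⟩ := List.mem_map.1 hx
    exact H.mem y hy

theorem step (H : Supported R v) (hb : Supported R b) : Supported R (step v b) := by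
  cases b with
  | nil => exact H
  | cons x b => exact axpy _ hb.mem (H.scale _)

theorem red (H : Supported R v) (hb : ∀ b ∈ Bs, Supported R b) : Supported R (red v Bs) := by
  induction Bs with
  | nil => exact H
  | cons b Bs ih => exact (ih fun b hb' => hb b (by simp [hb'])).step (hb b (by simp))

end Supported

section Pairing

variable {L : Type v} [CommRing L] (ι : K →+* L)

/-- The element of `L` that a formal difference stands for. -/
def ev (c : K × K) : L := ι c.1 - ι c.2

theorem ev_zero : ev ι (0, 0) = 0 := by simp [ev]

theorem ev_add (c d : K × K) : ev ι (c + d) = ev ι c + ev ι d := by simp [ev]; ring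

theorem ev_pm (c d : K × K) : ev ι (pm c d) = ev ι c * ev ι d := by simp [ev, pm]; ring

theorem ev_swap (c : K × K) : ev ι c.swap = -ev ι c := by simp [ev]

theorem ev_coe (k : K) : ev ι (k, 0) = ι k := by simp [ev]

theorem ev_eq_zero (hι : Function.Injective ι) (c : K × K) : ev ι c = 0 ↔ c.1 = c.2 := by
  rw [ev, sub_eq_zero, hι.eq_iff]

/-- The value of the linear form `φ` on the vector `v`. -/
def pair (φ : S → L) (v : List ((K × K) × S)) : L := (v.map fun x => ev ι x.1 * φ x.2).sum

variable (φ : S → L)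

theorem pair_nil : pair ι φ [] = 0 := rfl

theorem pair_cons (x : (K × K) × S) (v : List ((K × K) × S)) :
    pair ι φ (x :: v) = ev ι x.1 * φ x.2 + pair ι φ v := by simp [pair]

theorem pair_ins (x : (K × K) × S) (v : List ((K × K) × S)) :
    pair ι φ (ins x v) = ev ι x.1 * φ x.2 + pair ι φ v := by
  induction v with
  | nil => rw [ins, pair_cons]
  | cons y v ih =>
    rw [ins]
    split_ifs with h
    · rw [pair_cons, pair_cons, ev_add, h]; ring
    · rw [pair_cons, pair_cons, ih]; ring

theorem pair_axpy (c : K × K) (v u : List ((K × K) × S)) :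
    pair ι φ (axpy c v u) = ev ι c * pair ι φ v + pair ι φ u := by
  induction v with
  | nil => simp [axpy, pair_nil]
  | cons x v ih =>
    rw [axpy] at ih
    rw [axpy, List.foldr_cons, pair_ins, ih, pair_cons, ev_pm]
    ring

theorem pair_scale (c : K × K) (v : List ((K × K) × S)) :
    pair ι φ (scale c v) = ev ι c * pair ι φ v := by
  simp only [pair, scale, List.map_map, Function.comp_def, ev_pm, mul_assoc,
    List.sum_map_mul_left]

theorem ev_coef (p : S) (v : List ((K × K) × S)) :
    ev ι (coef p v) = pair ι (fun s => if s = p then 1 else 0) v := by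
  induction v with
  | nil => simp [coef, pair_nil, ev_zero]
  | cons x v ih =>
    rw [coef, pair_cons]
    split_ifs with h
    · rw [ev_add, ih, mul_one]
    · rw [ih, mul_zero, zero_add]

theorem pair_nz (v : List ((K × K) × S)) : pair ι φ (nz v) = pair ι φ v := by
  induction v with
  | nil => rfl
  | cons x v ih =>
    rw [nz] at ih
    rw [nz, List.filter_cons, pair_cons]
    split_ifs with h
    · rw [pair_cons, ih]
    · have : x.1.1 = x.1.2 := by simpa using h
      rw [ih, ev, this]
      simp

theorem pair_step (v : List ((K × K) × S)) (x : (K × K) × S) (b : List ((K × K) × S)) :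
    pair ι φ (step v (x :: b)) =
      ev ι x.1 * pair ι φ v - ev ι (coef x.2 v) * pair ι φ (x :: b) := by
  rw [step, pair_axpy, pair_scale, ev_swap]
  ring

/-- The first entry of a supported vector gives its coefficient at the first state. -/
theorem coef_head {x : (K × K) × S} {b : List ((K × K) × S)} (H : Supported R (x :: b)) :
    ev ι (coef x.2 (x :: b)) = ev ι x.1 := by
  have hn := H.nodup
  simp only [List.map_cons, List.nodup_cons] at hn
  rw [ev_coef, pair_cons, if_pos rfl, mul_one, add_eq_left, pair]
  refine List.sum_eq_zero fun y hy => ?_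
  obtain ⟨z, hz, rfl⟩ := List.mem_map.1 hy
  rw [if_neg, mul_zero]
  intro h
  exact hn.1 (h ▸ List.mem_map_of_mem hz)

variable (R) in
/-- The basis vectors are supported by `R`, their first coefficients do not vanish, and their
coefficients at the first states of the vectors that come later in the list do. -/
structure IsEchelon (Bs : List (List ((K × K) × S))) : Prop where
  supported : ∀ b ∈ Bs, Supported R b
  head : ∀ b ∈ Bs, ∃ x b', b = x :: b' ∧ ev ι x.1 ≠ 0
  pairwise : Bs.Pairwise fun b b' => ∀ y ∈ b'.head?, ev ι (coef y.2 b) = 0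

variable {ι} {Bs : List (List ((K × K) × S))}

theorem IsEchelon.nil : IsEchelon R ι [] := ⟨by simp, by simp, .nil⟩

theorem IsEchelon.tail {b : List ((K × K) × S)} (H : IsEchelon R ι (b :: Bs)) :
    IsEchelon R ι Bs :=
  ⟨fun b hb => H.supported b (by simp [hb]), fun b hb => H.head b (by simp [hb]),
    (List.pairwise_cons.1 H.pairwise).2⟩

/-- The first states of the basis vectors are different. -/
theorem IsEchelon.length_le (H : IsEchelon R ι Bs) : Bs.length ≤ R.card := by
  have h1 : (Bs.filterMap fun b => b.head?.map fun x => x.2).length = Bs.length := by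
    induction Bs with
    | nil => rfl
    | cons b Bs ih =>
      obtain ⟨x, b', rfl, _⟩ := H.head b (by simp)
      simp [ih H.tail]
  have h2 : (Bs.filterMap fun b => b.head?.map fun x => x.2).Nodup := by
    clear h1
    induction Bs with
    | nil => simp
    | cons b Bs ih =>
      obtain ⟨x, b', rfl, hx⟩ := H.head b (by simp)
      simp only [List.filterMap_cons, List.head?_cons, Option.map_some, List.nodup_cons]
      refine ⟨fun hm => hx ?_, ih H.tail⟩
      obtain ⟨b, hb, hbx⟩ := List.mem_filterMap.1 hm
      obtain ⟨y, hy, hyx⟩ := Option.map_eq_some_iff.1 hbx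
      have := (List.pairwise_cons.1 H.pairwise).1 b hb y hy
      rwa [hyx, coef_head ι (H.supported _ (by simp))] at this
  rw [← h1, ← List.toFinset_card_of_nodup h2]
  refine Finset.card_le_card fun s hs => ?_
  obtain ⟨b, hb, hbs⟩ := List.mem_filterMap.1 (List.mem_toFinset.1 hs)
  obtain ⟨y, hy, rfl⟩ := Option.map_eq_some_iff.1 hbs
  exact (H.supported b hb).mem y (List.mem_of_mem_head? hy)

/-- Reduction eliminates the first states of the basis vectors. -/
theorem IsEchelon.coef_red (H : IsEchelon R ι Bs) (v : List ((K × K) × S)) :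
    ∀ b ∈ Bs, ∀ y ∈ b.head?, ev ι (coef y.2 (red v Bs)) = 0 := by
  induction Bs with
  | nil => simp
  | cons b Bs ih =>
    obtain ⟨x, b', rfl, hx⟩ := H.head b (by simp)
    have ih := ih H.tail
    have hr : red v ((x :: b') :: Bs) = step (red v Bs) (x :: b') := rfl
    intro b hb y hy
    rw [hr, ev_coef, pair_step, ← ev_coef, ← ev_coef]
    rcases List.mem_cons.1 hb with rfl | hb
    · simp only [List.head?_cons, Option.mem_some_iff] at hy
      subst hy
      rw [coef_head ι (H.supported _ (by simp))]
      ring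
    · rw [ih b hb y hy, (List.pairwise_cons.1 H.pairwise).1 b hb y hy]
      ring

/-- Adding a reduced vector that is not zero gives again a basis in echelon form. -/
theorem IsEchelon.cons (H : IsEchelon R ι Bs) (hι : Function.Injective ι)
    {v w : List ((K × K) × S)} (hv : Supported R v) (hw : nz (red v Bs) = w) (hw0 : w ≠ []) :
    IsEchelon R ι (w :: Bs) := by
  refine ⟨?_, ?_, List.pairwise_cons.2 ⟨fun b hb y hy => ?_, H.pairwise⟩⟩
  · intro b hb
    rcases List.mem_cons.1 hb with rfl | hb
    · exact hw ▸ (hv.red H.supported).nz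
    · exact H.supported b hb
  · intro b hb
    rcases List.mem_cons.1 hb with rfl | hb
    · obtain ⟨x, w', rfl⟩ := List.exists_cons_of_ne_nil hw0
      refine ⟨x, w', rfl, fun h => ?_⟩
      have hx : x ∈ nz (red v Bs) := by rw [hw]; simp
      have := (List.mem_filter.1 hx).2
      rw [ev_eq_zero ι hι] at h
      simp [h] at this
    · exact H.head b hb
  · rw [← hw, ev_coef, pair_nz, ← ev_coef]
    exact H.coef_red v b hb y hy

/-- Reduction multiplies a vector by a nonzero number, modulo the basis. -/
theorem IsEchelon.exists_pair_red [IsDomain L] (H : IsEchelon R ι Bs) (v : List ((K × K) × S)) :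
    ∃ m : L, m ≠ 0 ∧ ∀ φ : S → L, (∀ b ∈ Bs, pair ι φ b = 0) →
      pair ι φ (nz (red v Bs)) = m * pair ι φ v := by
  simp only [pair_nz]
  induction Bs with
  | nil => exact ⟨1, one_ne_zero, fun φ _ => by simp [red]⟩
  | cons b Bs ih =>
    obtain ⟨x, b', rfl, hx⟩ := H.head b (by simp)
    obtain ⟨m, hm, h⟩ := ih H.tail
    refine ⟨ev ι x.1 * m, mul_ne_zero hx hm, fun φ hφ => ?_⟩
    have hr : red v ((x :: b') :: Bs) = step (red v Bs) (x :: b') := rfl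
    rw [hr, pair_step, h φ fun b hb => hφ b (by simp [hb]), hφ (x :: b') (by simp)]
    ring

end Pairing

end Vectors

/-! ### The program for vectors -/

section VectorProgram

open WFOEIL.Expr Prog

/-- Running through a list that is shorter than `X` raises the exponent of the time by one. -/
theorem mul_pow_le {m X : ℕ} (hm : m + 1 ≤ X) (k : ℕ) : (m + 1) * X ^ k ≤ X ^ (k + 1) := by
  rw [pow_succ, mul_comm]
  exact Nat.mul_le_mul_left _ hm

variable {K : Type u} [CommSemiring K] {A : Type}

/-- The operations on formal differences have evaluations of height `10`, and so take constant time. -/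
theorem Fh.fn {g : ℕ} {x v : Val K} (H : Fh bodies g x v 10) : Fn bodies g x v 1024 :=
  Fn.mono H (by norm_num)

/-- The value of a vector on the empty word. -/
def outV : List ((K × K) × Rex K A) → K × K
  | [] => (0, 0)
  | x :: v => pm x.1 (x.2.out, 0) + outV v

/-- The derivative of a vector with respect to a letter. -/
noncomputable def derivV (a : A) : List ((K × K) × Rex K A) → List ((K × K) × Rex K A)
  | [] => []
  | x :: v => axpy x.1 (toVec (x.2.pd a)) (derivV a v)

/-- `R` is a set of states that is closed under partial derivatives, and `X` bounds its size, the
number of letters, and the times for the elementary computations with states in `R`. -/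
structure IsTimeBound (cA : A → Val K) (lets : List A) (R : Finset (Rex K A)) (X : ℕ) : Prop where
  inj : Function.Injective cA
  large : 2 ^ 12 ≤ X
  card : R.card + 2 ≤ X
  lets : lets.length + 2 ≤ X
  dep : ∀ s ∈ R, 2 ^ (40 * (s.code cA).dep + 150) ≤ X
  length : ∀ s ∈ R, ∀ a, (s.pd a).length + 2 ≤ X
  pd : ∀ s ∈ R, ∀ a,
    Fn bodies iPd (.cons (cA a) (s.code cA)) (vecCode (Rex.code cA) (toVec (s.pd a))) X
  closed : ∀ s ∈ R, ∀ a, ∀ y ∈ s.pd a, y.2 ∈ R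

variable {cA : A → Val K} {lets : List A} {R : Finset (Rex K A)} {X : ℕ}

theorem mem_toVec {v : List (K × Rex K A)} {x : (K × K) × Rex K A} (hx : x ∈ toVec v) :
    ∃ y ∈ v, y.2 = x.2 := by
  obtain ⟨y, hy, rfl⟩ := List.mem_map.1 hx
  exact ⟨y, hy, rfl⟩

theorem Supported.derivV (hX : IsTimeBound cA lets R X) (a : A) {v : List ((K × K) × Rex K A)}
    (hv : ∀ x ∈ v, x.2 ∈ R) : Supported R (derivV a v) := by
  induction v with
  | nil => exact Supported.nil
  | cons x v ih =>
    refine Supported.axpy _ (fun y hy => ?_) (ih fun y hy => hv y (by simp [hy]))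
    obtain ⟨z, hz, h⟩ := mem_toVec hy
    exact h ▸ hX.closed _ (hv x (by simp)) a z hz

namespace IsTimeBound

variable (hX : IsTimeBound cA lets R X)
include hX

theorem pow (k : ℕ) : 1000 * X ^ k ≤ X ^ (k + 1) := by
  rw [pow_succ, mul_comm]
  exact Nat.mul_le_mul_left _ (le_trans (by norm_num) hX.large)

theorem length_lt {v : List ((K × K) × Rex K A)} (hv : Supported R v) : v.length + 2 ≤ X := by
  have := hv.length_le
  have := hX.card
  omega

theorem fn_eq {s : Rex K A} (hs : s ∈ R) (t : Rex K A) :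
    Fn bodies iEq (.cons (s.code cA) (t.code cA)) (.ofProp (s = t)) X := by
  have := fh_eq (s.code cA) (t.code cA)
  rw [(Rex.code_injective hX.inj).eq_iff] at this
  exact Fn.mono this ((Nat.pow_le_pow_right (by omega) (by omega)).trans (hX.dep s hs))

theorem fn_ins (x : (K × K) × Rex K A) (hx : x.2 ∈ R) (v : List ((K × K) × Rex K A)) :
    Fn bodies iIns (.cons (.cons (ringCode x.1) (x.2.code cA)) (vecCode (Rex.code cA) v))
      (vecCode (Rex.code cA) (ins x v)) ((v.length + 1) * X ^ 2) := by
  have h0 : 4096 ≤ X := le_trans (by norm_num) hX.large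
  have h1 : 1000 * X ^ 1 ≤ X ^ 2 := hX.pow 1
  rw [pow_one] at h1
  induction v with
  | nil => exact ⟨_, rfl, (Ev.ite_end (Ev.snd Ev.var0) (Ev.cons (Ev.fst Ev.var0) Ev.nil)).mono
      (by simp only [List.length_nil]; omega)⟩
  | cons y v ih =>
    have h2 : Ev bodies [.cons (.cons (ringCode x.1) (x.2.code cA))
        (vecCode (Rex.code cA) (y :: v))] (call₂ iEq DA (.snd AD)) (.ofProp (x.2 = y.2)) _ :=
      Ev.call (Ev.cons (Ev.snd (Ev.fst Ev.var0)) (Ev.snd (Ev.fst (Ev.snd Ev.var0))))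
        (hX.fn_eq hx y.2)
    rw [ins]
    simp only [List.length_cons, add_mul, one_mul] at *
    split_ifs with h
    · exact ⟨_, rfl, Ev.mono (Ev.ite_cons (Ev.snd Ev.var0) (Ev.ite_pos h h2 (Ev.cons (Ev.cons
        (Ev.call (Ev.cons (Ev.fst (Ev.fst Ev.var0)) (Ev.fst (Ev.fst (Ev.snd Ev.var0))))
          (Fh.fn (fh_add x.1 y.1))) (Ev.snd (Ev.fst (Ev.snd Ev.var0)))) (Ev.snd (Ev.snd Ev.var0)))))
        (by linarith [Nat.zero_le (v.length * X ^ 2)])⟩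
    · have h3 : Ev bodies [.cons (.cons (ringCode x.1) (x.2.code cA))
          (vecCode (Rex.code cA) (y :: v))] (call₂ iIns Expr.A DD) _ _ :=
        Ev.call (Ev.cons (Ev.fst Ev.var0) (Ev.snd (Ev.snd Ev.var0))) ih
      exact ⟨_, rfl, Ev.mono (Ev.ite_cons (Ev.snd Ev.var0) (Ev.ite_neg h h2 (Ev.cons
        (Ev.fst (Ev.snd Ev.var0)) h3))) (by omega)⟩

theorem fn_axpy (c : K × K) (v u : List ((K × K) × Rex K A)) (hv : ∀ x ∈ v, x.2 ∈ R)
    (hl : v.length + 2 ≤ X) (hu : Supported R u) :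
    Fn bodies iAxpy (.cons (ringCode c) (.cons (vecCode (Rex.code cA) v)
      (vecCode (Rex.code cA) u))) (vecCode (Rex.code cA) (axpy c v u)) (X ^ 5) := by
  suffices H : Fn bodies iAxpy (.cons (ringCode c) (.cons (vecCode (Rex.code cA) v)
      (vecCode (Rex.code cA) u))) (vecCode (Rex.code cA) (axpy c v u)) ((v.length + 1) * X ^ 4) from
    H.mono (mul_pow_le (by omega) 4)
  clear hl
  have h0 : 4096 ≤ X := le_trans (by norm_num) hX.large
  have h1 : 1000 * X ^ 1 ≤ X ^ 2 := hX.pow 1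
  have h2 : 1000 * X ^ 2 ≤ X ^ 3 := hX.pow 2
  have h3 : 1000 * X ^ 3 ≤ X ^ 4 := hX.pow 3
  rw [pow_one] at h1
  induction v with
  | nil => exact ⟨_, rfl, (Ev.ite_end (Ev.fst (Ev.snd Ev.var0)) (Ev.snd (Ev.snd Ev.var0))).mono
      (by simp only [List.length_nil]; omega)⟩
  | cons x v ih =>
    have hv' : ∀ x ∈ v, x.2 ∈ R := fun y hy => hv y (by simp [hy])
    have ih := ih hv'
    have h4 := (hX.fn_ins (pm c x.1, x.2) (hv x (by simp)) (axpy c v u)).mono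
      (show _ ≤ X ^ 3 from mul_pow_le (by have := hX.length_lt (Supported.axpy c hv' hu); omega) 2)
    refine ⟨_, rfl, Ev.mono (Ev.ite_cons (Ev.fst (Ev.snd Ev.var0)) (Ev.call (Ev.cons (Ev.cons
      (Ev.call (Ev.cons (Ev.fst Ev.var0) (Ev.fst (Ev.fst (Ev.fst (Ev.snd Ev.var0)))))
        (Fh.fn (fh_mul c x.1))) (Ev.snd (Ev.fst (Ev.fst (Ev.snd Ev.var0)))))
      (Ev.call (Ev.cons (Ev.fst Ev.var0) (Ev.cons (Ev.snd (Ev.fst (Ev.snd Ev.var0)))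
        (Ev.snd (Ev.snd Ev.var0)))) ih)) h4)) ?_⟩
    simp only [List.length_cons, add_mul, one_mul]
    omega

theorem fn_coef (p : Rex K A) (v : List ((K × K) × Rex K A)) (hv : Supported R v) :
    Fn bodies iCoef (.cons (vecCode (Rex.code cA) v) (p.code cA)) (ringCode (coef p v)) (X ^ 3) := by
  suffices H : Fn bodies iCoef (.cons (vecCode (Rex.code cA) v) (p.code cA)) (ringCode (coef p v))
      ((v.length + 1) * X ^ 2) from
    H.mono (mul_pow_le (by have := hX.length_lt hv; omega) 2)
  have h0 : 4096 ≤ X := le_trans (by norm_num) hX.large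
  have h1 : 1000 * X ^ 1 ≤ X ^ 2 := hX.pow 1
  rw [pow_one] at h1
  replace hv := hv.mem
  induction v with
  | nil => exact ⟨_, rfl, (Ev.ite_end (Ev.fst Ev.var0) (Ev.cons Ev.zero Ev.zero)).mono
      (by simp only [List.length_nil]; omega)⟩
  | cons x v ih =>
    have ih := ih fun y hy => hv y (by simp [hy])
    have h2 : Ev bodies [.cons (vecCode (Rex.code cA) (x :: v)) (p.code cA)]
        (call₂ iEq (.snd AA) D) (.ofProp (x.2 = p)) _ :=
      Ev.call (Ev.cons (Ev.snd (Ev.fst (Ev.fst Ev.var0))) (Ev.snd Ev.var0))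
        (hX.fn_eq (hv x (by simp)) p)
    have h3 : Ev bodies [.cons (vecCode (Rex.code cA) (x :: v)) (p.code cA)]
        (call₂ iCoef DA D) (ringCode (coef p v)) _ :=
      Ev.call (Ev.cons (Ev.snd (Ev.fst Ev.var0)) (Ev.snd Ev.var0)) ih
    rw [coef]
    simp only [List.length_cons, add_mul, one_mul] at *
    split_ifs with h
    · exact ⟨_, rfl, Ev.mono (Ev.ite_cons (Ev.fst Ev.var0) (Ev.ite_pos h h2
        (Ev.call (Ev.cons (Ev.fst (Ev.fst (Ev.fst Ev.var0))) h3) (Fh.fn (fh_add x.1 (coef p v))))))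
        (by linarith)⟩
    · exact ⟨_, rfl, Ev.mono (Ev.ite_cons (Ev.fst Ev.var0) (Ev.ite_neg h h2 h3)) (by omega)⟩

theorem fn_nz (v : List ((K × K) × Rex K A)) (hv : Supported R v) :
    Fn bodies iNz (vecCode (Rex.code cA) v) (vecCode (Rex.code cA) (nz v)) (X ^ 3) := by
  suffices H : Fn bodies iNz (vecCode (Rex.code cA) v) (vecCode (Rex.code cA) (nz v))
      ((v.length + 1) * X ^ 2) from
    H.mono (mul_pow_le (by have := hX.length_lt hv; omega) 2)
  have h0 : 4096 ≤ X := le_trans (by norm_num) hX.large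
  have h1 : 1000 * X ^ 1 ≤ X ^ 2 := hX.pow 1
  rw [pow_one] at h1
  clear hv
  induction v with
  | nil => exact ⟨_, rfl, (Ev.ite_end Ev.var0 Ev.nil).mono
      (by simp only [List.length_nil]; omega)⟩
  | cons x v ih =>
    have h2 : Ev bodies [vecCode (Rex.code cA) (x :: v)] (.call iIsZero AA)
        (.ofProp (x.1.1 = x.1.2)) _ :=
      Ev.call (Ev.fst (Ev.fst Ev.var0)) (Fh.fn (fh_isZero x.1))
    have h3 : Ev bodies [vecCode (Rex.code cA) (x :: v)] (.call iNz D)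
        (vecCode (Rex.code cA) (nz v)) _ := Ev.call (Ev.snd Ev.var0) ih
    by_cases h : x.1.1 = x.1.2
    · have h4 : nz (x :: v) = nz v := by simp [nz, h]
      rw [h4]
      exact ⟨_, rfl, Ev.mono (Ev.ite_cons Ev.var0 (Ev.ite_pos h h2 h3))
        (by simp only [List.length_cons, add_mul, one_mul]; omega)⟩
    · have h4 : nz (x :: v) = x :: nz v := by simp [nz, h]
      rw [h4]
      exact ⟨_, rfl, Ev.mono (Ev.ite_cons Ev.var0 (Ev.ite_neg h h2 (Ev.cons (Ev.fst Ev.var0) h3)))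
        (by simp only [List.length_cons, add_mul, one_mul]; omega)⟩

theorem fn_step (v b : List ((K × K) × Rex K A)) (hv : Supported R v) (hb : Supported R b)
    (hb0 : b ≠ []) :
    Fn bodies iStep (.cons (vecCode (Rex.code cA) v) (vecCode (Rex.code cA) b))
      (vecCode (Rex.code cA) (step v b)) (X ^ 6) := by
  obtain ⟨x, b, rfl⟩ := List.exists_cons_of_ne_nil hb0
  have h0 : 4096 ≤ X := le_trans (by norm_num) hX.large
  have h1 : 1000 * X ^ 1 ≤ X ^ 2 := hX.pow 1
  have h2 : 1000 * X ^ 2 ≤ X ^ 3 := hX.pow 2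
  have h3 : 1000 * X ^ 3 ≤ X ^ 4 := hX.pow 3
  have h4 : 1000 * X ^ 4 ≤ X ^ 5 := hX.pow 4
  have h5 : 1000 * X ^ 5 ≤ X ^ 6 := hX.pow 5
  have h6 : (v.length + 1) * X ^ 1 ≤ X ^ 2 :=
    mul_pow_le (by have := hX.length_lt hv; omega) 1
  rw [pow_one] at h1 h6
  have h7 : (v.length + 1) * 2 ^ 11 ≤ (v.length + 1) * X := Nat.mul_le_mul_left _ (by omega)
  refine ⟨_, rfl, Ev.mono (Ev.call (Ev.cons (Ev.call (Ev.call (Ev.cons (Ev.fst Ev.var0)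
    (Ev.snd (Ev.fst (Ev.snd Ev.var0)))) (hX.fn_coef x.2 v hv)) (Fh.fn (fh_neg _)))
    (Ev.cons (Ev.snd Ev.var0) (Ev.call (Ev.cons (Ev.fst (Ev.fst (Ev.snd Ev.var0)))
      (Ev.fst Ev.var0)) (fn_scale (Rex.code cA) x.1 v))))
    (hX.fn_axpy _ (x :: b) _ hb.mem (hX.length_lt hb) (hv.scale _))) (by omega)⟩

theorem fn_red (v : List ((K × K) × Rex K A)) (hv : Supported R v)
    (Bs : List (List ((K × K) × Rex K A))) (hB : ∀ b ∈ Bs, Supported R b ∧ b ≠ [])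
    (hl : Bs.length + 1 ≤ X) :
    Fn bodies iRed (.cons (vecCode (Rex.code cA) v) (.list (Bs.map (vecCode (Rex.code cA)))))
      (vecCode (Rex.code cA) (red v Bs)) (X ^ 8) := by
  suffices H : Fn bodies iRed
      (.cons (vecCode (Rex.code cA) v) (.list (Bs.map (vecCode (Rex.code cA)))))
      (vecCode (Rex.code cA) (red v Bs)) ((Bs.length + 1) * X ^ 7) from H.mono (mul_pow_le hl 7)
  clear hl
  have h0 : 4096 ≤ X := le_trans (by norm_num) hX.large
  have h1 : 1000 * X ^ 0 ≤ X ^ 1 := hX.pow 0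
  have h5 : 1000 * X ^ 6 ≤ X ^ 7 := hX.pow 6
  have h6 : 1 ≤ X ^ 6 := Nat.one_le_pow _ _ (by omega)
  induction Bs with
  | nil => exact ⟨_, rfl, (Ev.ite_end (Ev.snd Ev.var0) (Ev.fst Ev.var0)).mono
      (by simp only [List.length_nil]; omega)⟩
  | cons b Bs ih =>
    have ih := ih fun b hb => hB b (by simp [hb])
    refine ⟨_, rfl, Ev.mono (Ev.ite_cons (Ev.snd Ev.var0) (Ev.call (Ev.cons (Ev.call (Ev.cons
      (Ev.fst Ev.var0) (Ev.snd (Ev.snd Ev.var0))) ih) (Ev.fst (Ev.snd Ev.var0)))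
      (hX.fn_step _ b (hv.red fun b hb => (hB b (by simp [hb])).1) (hB b (by simp)).1
        (hB b (by simp)).2))) ?_⟩
    simp only [List.length_cons, add_mul, one_mul]
    omega

theorem fn_outV (v : List ((K × K) × Rex K A)) (hv : Supported R v) :
    Fn bodies iOutV (vecCode (Rex.code cA) v) (ringCode (outV v)) (X ^ 3) := by
  suffices H : Fn bodies iOutV (vecCode (Rex.code cA) v) (ringCode (outV v))
      ((v.length + 1) * X ^ 2) from
    H.mono (mul_pow_le (by have := hX.length_lt hv; omega) 2)
  have h0 : 4096 ≤ X := le_trans (by norm_num) hX.large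
  have h1 : 1000 * X ^ 1 ≤ X ^ 2 := hX.pow 1
  rw [pow_one] at h1
  replace hv := hv.mem
  induction v with
  | nil => exact ⟨_, rfl, (Ev.ite_end Ev.var0 (Ev.cons Ev.zero Ev.zero)).mono
      (by simp only [List.length_nil]; omega)⟩
  | cons x v ih =>
    have ih := ih fun y hy => hv y (by simp [hy])
    refine ⟨_, rfl, Ev.mono (Ev.ite_cons Ev.var0 (Ev.call (Ev.cons (Ev.call (Ev.cons
      (Ev.fst (Ev.fst Ev.var0)) (Ev.call (Ev.snd (Ev.fst Ev.var0))
        (Fn.mono (fh_out cA x.2) (hX.dep x.2 (hv x (by simp)))))) (Fh.fn (fh_mul x.1 (x.2.out, 0))))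
      (Ev.call (Ev.snd Ev.var0) ih)) (Fh.fn (fh_add _ _)))) ?_⟩
    simp only [List.length_cons, add_mul, one_mul]
    linarith

theorem fn_derivV (a : A) (v : List ((K × K) × Rex K A)) (hv : Supported R v) :
    Fn bodies iDv (.cons (cA a) (vecCode (Rex.code cA) v)) (vecCode (Rex.code cA) (derivV a v))
      (X ^ 7) := by
  suffices H : Fn bodies iDv (.cons (cA a) (vecCode (Rex.code cA) v))
      (vecCode (Rex.code cA) (derivV a v)) ((v.length + 1) * X ^ 6) from
    H.mono (mul_pow_le (by have := hX.length_lt hv; omega) 6)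
  have h0 : 4096 ≤ X := le_trans (by norm_num) hX.large
  have h1 : 1000 * X ^ 1 ≤ X ^ 2 := hX.pow 1
  have h2 : 1000 * X ^ 2 ≤ X ^ 3 := hX.pow 2
  have h3 : 1000 * X ^ 3 ≤ X ^ 4 := hX.pow 3
  have h4 : 1000 * X ^ 4 ≤ X ^ 5 := hX.pow 4
  have h5 : 1000 * X ^ 5 ≤ X ^ 6 := hX.pow 5
  rw [pow_one] at h1
  replace hv := hv.mem
  induction v with
  | nil => exact ⟨_, rfl, (Ev.ite_end (Ev.snd Ev.var0) Ev.nil).mono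
      (by simp only [List.length_nil]; omega)⟩
  | cons x v ih =>
    have hv' : ∀ y ∈ v, y.2 ∈ R := fun y hy => hv y (by simp [hy])
    have ih := ih hv'
    have hx := hv x (by simp)
    refine ⟨_, rfl, Ev.mono (Ev.ite_cons (Ev.snd Ev.var0) (Ev.call (Ev.cons
      (Ev.fst (Ev.fst (Ev.snd Ev.var0))) (Ev.cons (Ev.call (Ev.cons (Ev.fst Ev.var0)
        (Ev.snd (Ev.fst (Ev.snd Ev.var0)))) (hX.pd x.2 hx a))
        (Ev.call (Ev.cons (Ev.fst Ev.var0) (Ev.snd (Ev.snd Ev.var0))) ih)))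
      (hX.fn_axpy x.1 (toVec (x.2.pd a)) (derivV a v) (fun y hy => ?_) ?_
        (Supported.derivV hX a hv')))) ?_⟩
    · obtain ⟨z, hz, h⟩ := mem_toVec hy
      exact h ▸ hX.closed _ hx a z hz
    · rw [toVec, List.length_map]
      exact hX.length x.2 hx a
    · simp only [List.length_cons, add_mul, one_mul]
      omega

theorem fn_derivs (v : List ((K × K) × Rex K A)) (hv : Supported R v)
    (W : List (List ((K × K) × Rex K A))) :
    Fn bodies iDall (.cons (.list (lets.map cA)) (.cons (vecCode (Rex.code cA) v)
        (.list (W.map (vecCode (Rex.code cA))))))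
      (.list ((lets.map (fun a => derivV a v) ++ W).map (vecCode (Rex.code cA)))) (X ^ 9) := by
  have h0 : 4096 ≤ X := le_trans (by norm_num) hX.large
  have h1 : 1000 * X ^ 0 ≤ X ^ 1 := hX.pow 0
  have h5 : 1000 * X ^ 7 ≤ X ^ 8 := hX.pow 7
  have h6 : 1 ≤ X ^ 7 := Nat.one_le_pow _ _ (by omega)
  have key : ∀ l : List A, Fn bodies iDall (.cons (.list (l.map cA)) (.cons
      (vecCode (Rex.code cA) v) (.list (W.map (vecCode (Rex.code cA))))))
      (.list ((l.map (fun a => derivV a v) ++ W).map (vecCode (Rex.code cA))))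
      ((l.length + 1) * X ^ 8) := by
    intro l
    induction l with
    | nil => exact ⟨_, rfl, (Ev.ite_end (Ev.fst Ev.var0) (Ev.snd (Ev.snd Ev.var0))).mono
      (by simp only [List.length_nil]; omega)⟩
    | cons a l ih =>
      refine ⟨_, rfl, Ev.mono (Ev.ite_cons (Ev.fst Ev.var0) (Ev.cons (Ev.call (Ev.cons
        (Ev.fst (Ev.fst Ev.var0)) (Ev.fst (Ev.snd Ev.var0))) (hX.fn_derivV a v hv))
        (Ev.call (Ev.cons (Ev.snd (Ev.fst Ev.var0)) (Ev.snd Ev.var0)) ih))) ?_⟩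
      simp only [List.length_cons, add_mul, one_mul]
      omega
  exact (key lets).mono (mul_pow_le (by have := hX.lets; omega) 8)

end IsTimeBound

/-! ### The test for null vectors -/

section Loop

variable {L : Type v} [CommRing L] {ι : K →+* L}

theorem ev_outV (v : List ((K × K) × Rex K A)) :
    ev ι (outV v) = pair ι (fun s => ι (Rex.val [] s)) v := by
  induction v with
  | nil => simp [outV, ev, pair]
  | cons x v ih =>
    rw [outV, ev_add, ih, pair_cons, ev_pm, ev_coe]
    rfl

theorem pair_derivV (φ : Rex K A → L) (a : A) (v : List ((K × K) × Rex K A)) :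
    pair ι φ (derivV a v) = pair ι (fun s => pair ι φ (toVec (s.pd a))) v := by
  induction v with
  | nil => rfl
  | cons x v ih => rw [derivV, pair_axpy, ih, pair_cons]

variable (ι) in
/-- The series of the vector `v` vanishes. -/
def IsNull (v : List ((K × K) × Rex K A)) : Prop :=
  ∀ w, pair ι (fun s => ι (Rex.val w s)) v = 0

theorem pair_val_cons (a : A) (w : List A) (v : List ((K × K) × Rex K A)) :
    pair ι (fun s => ι (Rex.val (a :: w) s)) v =
      pair ι (fun s => ι (Rex.val w s)) (derivV a v) := by
  rw [pair_derivV]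
  congr 1
  funext s
  rw [Rex.val, map_list_sum]
  simp [pair, toVec, Function.comp_def, ev_coe]

variable (ι) in
/-- `v` lies in the span of `Bs`, up to a nonzero factor: every linear form that vanishes on `Bs`
vanishes on `v`. -/
def Spanned (Bs : List (List ((K × K) × Rex K A))) (v : List ((K × K) × Rex K A)) : Prop :=
  ∀ φ : Rex K A → L, (∀ b ∈ Bs, pair ι φ b = 0) → pair ι φ v = 0

variable [IsDomain L]

/-- The invariant of the loop on the list `W` of vectors to be examined and the basis `Bs`. The number
`m` bounds the remaining rounds: each one removes a vector from `W`, and each vector added to the basis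
adds `lets.length` vectors. If the answer is positive, `Bs` extends to a list `Bs'` that spans `W`, whose
new members vanish on the empty word and have their derivatives in the span; if `Bs` is empty, the span of
`Bs'` is thus closed under derivatives and consists of null vectors. If the answer is negative and the
vectors in `Bs` are null, some vector in `W` is not. -/
theorem IsTimeBound.fn_loop (hX : IsTimeBound cA lets R X) (hι : Function.Injective ι) (m : ℕ)
    (W Bs : List (List ((K × K) × Rex K A))) (hB : IsEchelon R ι Bs) (hW : ∀ v ∈ W, Supported R v)
    (hm : (R.card - Bs.length) * (lets.length + 1) + W.length ≤ m) :
    ∃ ans : Prop, Fn bodies iLoop (.cons (.list (lets.map cA)) (.cons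
        (.list (W.map (vecCode (Rex.code cA)))) (.list (Bs.map (vecCode (Rex.code cA))))))
        (.ofProp ans) ((m + 1) * X ^ 10) ∧
      (ans → ∃ Bs', Bs ⊆ Bs' ∧ (∀ v ∈ W, Spanned ι Bs' v) ∧ ∀ b ∈ Bs', b ∈ Bs ∨
        (pair ι (fun s => ι (Rex.val [] s)) b = 0 ∧ ∀ a ∈ lets, Spanned ι Bs' (derivV a b))) ∧
      (¬ ans → (∀ b ∈ Bs, IsNull ι b) → ∃ v ∈ W, ¬ IsNull ι v) := by
  have h0 : 4096 ≤ X := le_trans (by norm_num) hX.large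
  have h1 : 1000 * X ^ 0 ≤ X ^ 1 := hX.pow 0
  have h3 : 1000 * X ^ 3 ≤ X ^ 4 := hX.pow 3
  have h4 : 1000 * X ^ 4 ≤ X ^ 5 := hX.pow 4
  have h5 : 1000 * X ^ 5 ≤ X ^ 6 := hX.pow 5
  have h6 : 1000 * X ^ 6 ≤ X ^ 7 := hX.pow 6
  have h7 : 1000 * X ^ 7 ≤ X ^ 8 := hX.pow 7
  have h8 : 1000 * X ^ 8 ≤ X ^ 9 := hX.pow 8
  have h9 : 1000 * X ^ 9 ≤ X ^ 10 := hX.pow 9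
  have h10 : 1 ≤ X ^ 3 := Nat.one_le_pow _ _ (by omega)
  induction m generalizing W Bs with
  | zero =>
    obtain rfl : W = [] := List.length_eq_zero_iff.1 (by omega)
    refine ⟨True, ⟨_, rfl, Ev.mono (Ev.ite_end (T₂ := 4) (Ev.fst (Ev.snd Ev.var0)) ?_) ?_⟩,
      fun _ => ⟨Bs, fun _ h => h, by simp, fun b hb => Or.inl hb⟩, fun h => absurd trivial h⟩
    · rw [Val.ofProp, if_pos trivial]
      exact Ev.cons Ev.nil Ev.nil
    · omega
  | succ m ih =>
    cases W with
    | nil =>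
      refine ⟨True, ⟨_, rfl, Ev.mono (Ev.ite_end (T₂ := 4) (Ev.fst (Ev.snd Ev.var0)) ?_) ?_⟩,
        fun _ => ⟨Bs, fun _ h => h, by simp, fun b hb => Or.inl hb⟩, fun h => absurd trivial h⟩
      · rw [Val.ofProp, if_pos trivial]
        exact Ev.cons Ev.nil Ev.nil
      · simp only [add_mul, one_mul]
        omega
    | cons v W =>
      obtain ⟨w, hw⟩ : ∃ w, nz (red v Bs) = w := ⟨_, rfl⟩
      have hv := hW v (by simp)
      have hW' : ∀ v ∈ W, Supported R v := fun v hv => hW v (by simp [hv])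
      obtain ⟨c, hc, hcv⟩ := hB.exists_pair_red v
      rw [hw] at hcv
      have hwR : Supported R w := hw ▸ (hv.red hB.supported).nz
      have hBl := hB.length_le
      have hcard := hX.card
      have e1 := hX.fn_red v hv Bs (fun b hb => ⟨hB.supported b hb, by
        obtain ⟨x, b', rfl, _⟩ := hB.head b hb; simp⟩) (by omega)
      have e2 := hX.fn_nz _ (hv.red hB.supported)
      rw [hw] at e2
      rw [List.length_cons] at hm
      -- It suffices to follow one step of the loop.
      suffices H : ∃ ans : Prop, Fn bodies iLoopStep (.cons (vecCode (Rex.code cA) w)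
          (.cons (.list (lets.map cA)) (.cons (.list ((v :: W).map (vecCode (Rex.code cA))))
            (.list (Bs.map (vecCode (Rex.code cA)))))))
          (.ofProp ans) ((m + 1) * X ^ 10 + 3 * X ^ 9) ∧
          (ans → ∃ Bs', Bs ⊆ Bs' ∧ (∀ u ∈ v :: W, Spanned ι Bs' u) ∧ ∀ b ∈ Bs', b ∈ Bs ∨
            (pair ι (fun s => ι (Rex.val [] s)) b = 0 ∧
              ∀ a ∈ lets, Spanned ι Bs' (derivV a b))) ∧
          (¬ ans → (∀ b ∈ Bs, IsNull ι b) → ∃ u ∈ v :: W, ¬ IsNull ι u) by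
        obtain ⟨ans, H, H'⟩ := H
        refine ⟨ans, ⟨_, rfl, Ev.mono (Ev.ite_cons (Ev.fst (Ev.snd Ev.var0)) (Ev.call (Ev.cons
          (Ev.call (Ev.call (Ev.cons (Ev.fst (Ev.fst (Ev.snd Ev.var0))) (Ev.snd (Ev.snd Ev.var0)))
            e1) e2) Ev.var0) H)) ?_⟩, H'⟩
        simp only [add_mul, one_mul]
        omega
      by_cases hw0 : w = []
      · subst hw0
        obtain ⟨ans, H, H₁, H₂⟩ := ih W Bs hB hW' (by omega)
        refine ⟨ans, ⟨_, rfl, Ev.mono (Ev.ite_end (Ev.fst Ev.var0) (Ev.call (Ev.cons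
          (Ev.fst (Ev.snd Ev.var0)) (Ev.cons (Ev.snd (Ev.fst (Ev.snd (Ev.snd Ev.var0))))
            (Ev.snd (Ev.snd (Ev.snd Ev.var0))))) H)) (by omega)⟩, fun ha => ?_, fun ha hn => ?_⟩
        · obtain ⟨Bs', hs, hd, hb⟩ := H₁ ha
          refine ⟨Bs', hs, fun u hu => ?_, hb⟩
          rcases List.mem_cons.1 hu with rfl | hu
          · intro φ hφ
            have := hcv φ fun b hb => hφ b (hs hb)
            rw [pair_nil] at this
            exact (mul_eq_zero.1 this.symm).resolve_left hc
          · exact hd u hu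
        · obtain ⟨u, hu, h⟩ := H₂ ha hn
          exact ⟨u, by simp [hu], h⟩
      · have hnull : (∀ b ∈ Bs, IsNull ι b) → ¬ IsNull ι w → ¬ IsNull ι v := fun hn h h' =>
          h fun z => by rw [hcv _ fun b hb => hn b hb z, h' z, mul_zero]
        have hB' := hB.cons hι hv hw hw0
        have hBl' := hB'.length_le
        rw [List.length_cons] at hBl'
        obtain ⟨x, w', hxw⟩ := List.exists_cons_of_ne_nil hw0
        have e3 := hX.fn_outV w hwR
        have e4 := Fh.fn (fh_isZero (outV w))
        rw [← ev_eq_zero ι hι, ev_outV] at e4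
        have e5 : Ev bodies [.cons (vecCode (Rex.code cA) w)
          (.cons (.list (lets.map cA)) (.cons (.list ((v :: W).map (vecCode (Rex.code cA))))
            (.list (Bs.map (vecCode (Rex.code cA))))))] (.call iIsZero (.call iOutV Expr.A)) _ _ :=
          Ev.call (Ev.call (Ev.fst Ev.var0) e3) e4
        have e6 : Ev bodies [.cons (vecCode (Rex.code cA) w)
          (.cons (.list (lets.map cA)) (.cons (.list ((v :: W).map (vecCode (Rex.code cA))))
            (.list (Bs.map (vecCode (Rex.code cA))))))] Expr.A
            (.cons (.cons (ringCode x.1) (x.2.code cA)) (vecCode (Rex.code cA) w')) 3 := by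
          rw [hxw]
          exact Ev.fst Ev.var0
        by_cases ho : pair ι (fun s => ι (Rex.val [] s)) w = 0
        · obtain ⟨ans, H, H₁, H₂⟩ := ih (lets.map (fun a => derivV a w) ++ W) (w :: Bs) hB' (by
              intro u hu
              rcases List.mem_append.1 hu with hu | hu
              · obtain ⟨a, _, rfl⟩ := List.mem_map.1 hu
                exact Supported.derivV hX a hwR.mem
              · exact hW' u hu) (by
              obtain ⟨k, hk⟩ : ∃ k, R.card = Bs.length + 1 + k := ⟨_, (Nat.add_sub_cancel' hBl').symm⟩
              have k1 : R.card - Bs.length = k + 1 := by omega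
              have k2 : R.card - (w :: Bs).length = k := by rw [List.length_cons]; omega
              rw [k1, add_mul, one_mul] at hm
              rw [k2, List.length_append, List.length_map]
              omega)
          refine ⟨ans, ⟨_, rfl, Ev.mono (Ev.ite_cons e6 (Ev.ite_pos ho e5 (Ev.call (Ev.cons
            (Ev.fst (Ev.snd Ev.var0)) (Ev.cons (Ev.call (Ev.cons (Ev.fst (Ev.snd Ev.var0))
              (Ev.cons (Ev.fst Ev.var0) (Ev.snd (Ev.fst (Ev.snd (Ev.snd Ev.var0))))))
              (hX.fn_derivs w hwR W)) (Ev.cons (Ev.fst Ev.var0)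
                (Ev.snd (Ev.snd (Ev.snd Ev.var0)))))) H))) (by omega)⟩, fun ha => ?_,
                fun ha hn => ?_⟩
          · obtain ⟨Bs', hs, hd, hb⟩ := H₁ ha
            refine ⟨Bs', fun b hb => hs (by simp [hb]), fun u hu => ?_, fun b hbB => ?_⟩
            · rcases List.mem_cons.1 hu with rfl | hu
              · intro φ hφ
                have := hcv φ fun b hb => hφ b (hs (by simp [hb]))
                rw [hφ w (hs (by simp))] at this
                exact (mul_eq_zero.1 this.symm).resolve_left hc
              · exact hd u (by simp [hu])
            · rcases hb b hbB with hb | hb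
              · rcases List.mem_cons.1 hb with rfl | hb
                · exact Or.inr ⟨ho, fun a ha => hd _
                    (List.mem_append_left _ (List.mem_map_of_mem ha))⟩
                · exact Or.inl hb
              · exact Or.inr hb
          · by_cases hwn : IsNull ι w
            · obtain ⟨u, hu, h⟩ := H₂ ha (by simpa using ⟨hwn, hn⟩)
              rcases List.mem_append.1 hu with hu | hu
              · obtain ⟨a, _, rfl⟩ := List.mem_map.1 hu
                exact absurd (fun z => by rw [← pair_val_cons]; exact hwn _) h
              · exact ⟨u, by simp [hu], h⟩
            · exact ⟨v, by simp, hnull hn hwn⟩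
        · refine ⟨False, ⟨_, rfl, Ev.mono (Ev.ite_cons e6 (Ev.ite_neg (T₂ := 2) ho e5 ?_)) ?_⟩,
            fun h => h.elim, fun _ hn => ⟨v, by simp, hnull hn fun h => ho (h [])⟩⟩
          · rw [Val.ofProp_false id]
            exact Ev.nil
          · linarith [Nat.zero_le (m * X ^ 10)]

/-- Started on the single vector `v` and the empty basis, the loop decides whether `v` is null. -/
theorem IsTimeBound.fn_loop_isNull (hX : IsTimeBound cA lets R X) (hι : Function.Injective ι)
    (hlets : ∀ a, a ∈ lets) (v : List ((K × K) × Rex K A)) (hv : Supported R v) :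
    Fn bodies iLoop (.cons (.list (lets.map cA)) (.cons
      (.list [vecCode (Rex.code cA) v]) .nil)) (.ofProp (IsNull ι v)) (X ^ 13) := by
  obtain ⟨ans, H, H₁, H₂⟩ := hX.fn_loop hι (R.card * (lets.length + 1) + 1) [v] []
    IsEchelon.nil (by simpa using hv) (by simp)
  have key : ans ↔ IsNull ι v := by
    constructor
    · intro ha
      obtain ⟨Bs, -, hd, hb⟩ := H₁ ha
      have hB : ∀ w, ∀ b ∈ Bs, pair ι (fun s => ι (Rex.val w s)) b = 0 := by
        intro w
        induction w with
        | nil => exact fun b h => ((hb b h).resolve_left (by simp)).1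
        | cons a w ih =>
          intro b h
          rw [pair_val_cons]
          exact ((hb b h).resolve_left (by simp)).2 a (hlets a) _ ih
      exact fun w => hd v (by simp) _ (hB w)
    · intro hn
      by_contra ha
      obtain ⟨u, hu, h⟩ := H₂ ha (by simp)
      simp only [List.mem_singleton] at hu
      exact h (hu ▸ hn)
  rw [← key]
  refine H.mono ?_
  have h1 := hX.card
  have h2 := hX.lets
  have h3 := hX.large
  have h4 : R.card * (lets.length + 1) + 1 + 1 ≤ X ^ 3 := by
    calc R.card * (lets.length + 1) + 1 + 1 ≤ X * X + X * X := by
          have := Nat.mul_le_mul (show R.card ≤ X by omega) (show lets.length + 1 ≤ X by omega)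
          nlinarith
      _ ≤ X ^ 3 := by
          rw [pow_succ, sq]
          nlinarith [Nat.mul_le_mul_left (X * X) h3]
  calc _ ≤ X ^ 3 * X ^ 10 := Nat.mul_le_mul_right _ h4
    _ = X ^ 13 := by ring

end Loop

end VectorProgram

/-! ### The decision procedure -/

section Quote

open WFOEIL.Expr Prog

variable {K : Type u}

/-- No leaf is an element of `K`. -/
def Val.AtomFree : Val K → Prop
  | .nil => True
  | .atom _ => False
  | .cons a b => a.AtomFree ∧ b.AtomFree

theorem Val.atomFree_list {l : List (Val K)} (h : ∀ x ∈ l, x.AtomFree) : (list l).AtomFree := by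
  induction l with
  | nil => trivial
  | cons a l ih => exact ⟨h a (by simp), ih fun x hx => h x (by simp [hx])⟩

theorem Val.atomFree_nat (m : ℕ) : (nat m : Val K).AtomFree := by
  refine atomFree_list fun x hx => ?_
  obtain ⟨b, _, rfl⟩ := List.mem_map.1 hx
  cases b <;> simp [AtomFree]

variable {n : ℕ} {P : Fin n → Type} {r : Fin n → ℕ} [∀ i, Fintype (P i)]

theorem atomFree_instCode {m : ℕ} (j : Fin m) : (instCode j : Val K).AtomFree :=
  ⟨trivial, Val.atomFree_nat _⟩

theorem atomFree_letterCode (a : Interaction P r) : (letterCode a : Val K).AtomFree := by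
  refine ⟨Val.atomFree_nat _, Val.atomFree_list fun x hx => ?_⟩
  obtain ⟨q, _, rfl⟩ := List.mem_map.1 hx
  exact ⟨Val.atomFree_nat _, Val.atomFree_nat _, atomFree_instCode _⟩

theorem atomFree_letters : (Val.list ((letters P r).map letterCode) : Val K).AtomFree := by
  refine Val.atomFree_list fun x hx => ?_
  obtain ⟨a, _, rfl⟩ := List.mem_map.1 hx
  exact atomFree_letterCode a

theorem atomFree_context : (context P r : Val K).AtomFree := by
  refine ⟨atomFree_letters, Val.atomFree_list fun x hx => ?_⟩
  obtain ⟨p, hp, rfl⟩ := List.mem_map.1 hx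
  obtain ⟨i, _, rfl⟩ := List.mem_map.1 hp
  refine ⟨Val.atomFree_nat _, Val.atomFree_list fun x hx => ?_⟩
  obtain ⟨j, _, rfl⟩ := List.mem_map.1 hx
  exact atomFree_instCode j

theorem exists_ev_quote [CommSemiring K] (v : Val K) (hv : v.AtomFree) :
    ∃ T, ∀ ρ : List (Val K), Ev bodies ρ (quote v) v T := by
  induction v with
  | nil => exact ⟨2, fun _ => Ev.nil⟩
  | atom k => exact hv.elim
  | cons a b iha ihb =>
    obtain ⟨T₁, h₁⟩ := iha hv.1
    obtain ⟨T₂, h₂⟩ := ihb hv.2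
    exact ⟨T₁ + T₂, fun ρ => Ev.cons (h₁ ρ) (h₂ ρ)⟩

end Quote

section Main

open WFOEIL.Expr Prog

variable {K : Type u} [CommSemiring K] {n : ℕ} {P : Fin n → Type} {r : Fin n → ℕ}
  [∀ i, Fintype (P i)] {B : ℕ}

/-- The difference of the expressions `e` and `f`. -/
noncomputable def diffV {A : Type} (e f : Rex K A) : List ((K × K) × Rex K A) :=
  ins ((1, 0), e) (ins ((0, 1), f) [])

theorem isNull_diffV {A : Type} {L : Type v} [CommRing L] {ι : K →+* L}
    (hι : Function.Injective ι) (e f : Rex K A) :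
    IsNull ι (diffV e f) ↔ ∀ w, Rex.val w e = Rex.val w f := by
  refine forall_congr' fun w => ?_
  rw [diffV, pair_ins, pair_ins, pair_nil]
  simp only [ev, map_one, map_zero, sub_zero, one_mul, zero_sub, add_zero, neg_mul,
    ← sub_eq_add_neg, sub_eq_zero, hι.eq_iff]

theorem supported_diffV {A : Type} {R : Finset (Rex K A)} {e f : Rex K A} (he : e ∈ R)
    (hf : f ∈ R) : Supported R (diffV e f) :=
  (Supported.nil.ins hf).ins he

/-- The state set of two instantiated formulas, and the bounds for it. -/
theorem isTimeBound_union [DecidableEq (Rex K (Interaction P r))] (hB : IsBound K P r B)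
    {h : ℕ} (hh : 2 ≤ h) (e f : Rex K (Interaction P r)) (he : e.hgt ≤ h) (hf : f.hgt ≤ h)
    (he' : e.cnt ≤ 2 ^ h) (hf' : f.cnt ≤ 2 ^ h) :
    IsTimeBound letterCode (letters P r) (e.st ∪ f.st) (2 ^ (200 * (B + 30) * h)) := by
  have hC : 6000 * h + B * 2 ≤ 200 * (B + 30) * h := by nlinarith
  have key : ∀ s ∈ e.st ∪ f.st, PdBound letterCode B h s := fun s hs => by
    rcases Finset.mem_union.1 hs with hs | hs
    · exact (pdBound_of_mem_st letterCode_injective hB.letter e s hs).mono he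
    · exact (pdBound_of_mem_st letterCode_injective hB.letter f s hs).mono hf
  have hp : ∀ k, k ≤ 200 * (B + 30) * h → 2 ^ k ≤ 2 ^ (200 * (B + 30) * h) := fun k hk =>
    Nat.pow_le_pow_right (by omega) hk
  refine ⟨letterCode_injective, hp _ (by omega), ?_, ?_, fun s hs => hp _ ?_, fun s hs a => ?_,
    fun s hs a => Fn.mono ((key s hs).pd a) (hp _ (by nlinarith)), fun s hs a y hy => ?_⟩
  · have h1 := Finset.card_union_le e.st f.st
    have h2 := (Rex.card_st e).1
    have h3 := (Rex.card_st f).1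
    have h4 := hp (h + 2) (by omega)
    have h5 : 1 ≤ 2 ^ h := Nat.one_le_two_pow
    rw [pow_add] at h4
    omega
  · have h1 := hB.letters
    have h2 := hp (B + 2) (by omega)
    have h3 : B + 2 < 2 ^ (B + 2) := Nat.lt_two_pow_self
    omega
  · have h1 := (key s hs).dep
    nlinarith
  · have h1 := (key s hs).length a
    have h2 := hp (h + 2) (by omega)
    have h3 : h + 2 < 2 ^ (h + 2) := Nat.lt_two_pow_self
    omega
  · rcases Finset.mem_union.1 hs with hs | hs
    · exact Finset.mem_union_left _ (Rex.pd_mem_st e s hs a y hy)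
    · exact Finset.mem_union_right _ (Rex.pd_mem_st f s hs a y hy)

variable (K P r) in
/-- The main expression: the loop is started on the difference of the two instantiated formulas. -/
noncomputable def mainExpr : Expr :=
  call₃ iLoop (quote (.list ((letters P r).map letterCode) : Val K))
    (listE [call₂ iIns (.cons ringOne (call₃ iWform A .nil (quote (context P r : Val K))))
      (call₂ iIns (.cons (.cons .zero .one) (call₃ iWform D .nil (quote (context P r : Val K))))
        .nil)]) .nil

/-- The main expression decides equivalence. The height of the evaluation is bounded in terms of
`B`, the size `s` of the formulas, and a bound `h` for their instantiations. -/
theorem exists_eval_mainExpr {L : Type v} [CommRing L] [IsDomain L] {ι : K →+* L}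
    (hι : Function.Injective ι) (hB : IsBound K P r B) :
    ∃ M, ∀ (ψ₁ ψ₂ : WFormula P K) (h : ℕ), 2 ≤ h →
      (ψ₁.inst (letters P r) (Assignment.empty r)).hgt ≤ h →
      (ψ₂.inst (letters P r) (Assignment.empty r)).hgt ≤ h →
      (ψ₁.inst (letters P r) (Assignment.empty r)).cnt ≤ 2 ^ h →
      (ψ₂.inst (letters P r) (Assignment.empty r)).cnt ≤ 2 ^ h →
      Ev bodies [.cons ψ₁.code ψ₂.code] (mainExpr K P r)
        (.ofProp (∀ w, ψ₁.value (Assignment.empty r) w = ψ₂.value (Assignment.empty r) w))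
        (2 ^ (M * (ψ₁.size r + ψ₂.size r + h))) := by
  classical
  obtain ⟨T₁, hT₁⟩ := exists_ev_quote _ (atomFree_letters (K := K) (P := P) (r := r))
  obtain ⟨T₂, hT₂⟩ := exists_ev_quote _ (atomFree_context (K := K) (P := P) (r := r))
  refine ⟨13 * (200 * (B + 30)) + T₁ + 2 * T₂ + 1100 + 200 * B + 20, fun ψ₁ ψ₂ h hh h₁ h₂ h₃ h₄ => ?_⟩
  obtain ⟨e, he⟩ : ∃ e, ψ₁.inst (letters P r) (Assignment.empty r) = e := ⟨_, rfl⟩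
  obtain ⟨f, hf⟩ : ∃ f, ψ₂.inst (letters P r) (Assignment.empty r) = f := ⟨_, rfl⟩
  have hX := isTimeBound_union hB hh _ _ h₁ h₂ h₃ h₄
  rw [he, hf] at hX
  obtain ⟨X, hXdef⟩ : ∃ X, 2 ^ (200 * (B + 30) * h) = X := ⟨_, rfl⟩
  rw [hXdef] at hX
  have heR : e ∈ e.st ∪ f.st := Finset.mem_union_left _ e.self_mem_st
  have hfR : f ∈ e.st ∪ f.st := Finset.mem_union_right _ f.self_mem_st
  obtain ⟨k₁, hk₁⟩ : ∃ k, (400 + 200 * B) * ψ₁.size r + 20 * 0 + 200 * B + 1100 = k := ⟨_, rfl⟩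
  have w₁ := fh_wform hB (Q := 400 + 200 * B) le_rfl ψ₁ []
  obtain ⟨k₂, hk₂⟩ : ∃ k, (400 + 200 * B) * ψ₂.size r + 20 * 0 + 200 * B + 1100 = k := ⟨_, rfl⟩
  have w₂ := fh_wform hB (Q := 400 + 200 * B) le_rfl ψ₂ []
  have ha : asg [] = Assignment.empty r := rfl
  rw [ha, he, List.length_nil, hk₁] at w₁
  rw [ha, hf, List.length_nil, hk₂] at w₂
  have i₂ := (hX.fn_ins ((0, 1), f) hfR []).mono (show _ ≤ X ^ 3 from mul_pow_le (by
    have := hX.card; simp only [List.length_nil]; omega) 2)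
  have i₁ := (hX.fn_ins ((1, 0), e) heR (ins ((0, 1), f) [])).mono (show _ ≤ X ^ 3 from
    mul_pow_le (by have := hX.length_lt (Supported.nil.ins (x := (((0 : K), (1 : K)), f)) hfR); omega) 2)
  have hl := hX.fn_loop_isNull hι mem_letters _ (supported_diffV heR hfR)
  have hval : (∀ w, Rex.val w e = Rex.val w f) =
      ∀ w, ψ₁.value (Assignment.empty r) w = ψ₂.value (Assignment.empty r) w := by
    simp only [← he, ← hf, WFormula.val_inst mem_letters]
  rw [isNull_diffV hι, hval] at hl
  refine Ev.mono (Ev.call (Ev.cons (hT₁ _) (Ev.cons (Ev.cons (Ev.call (Ev.cons (Ev.cons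
    (Ev.cons Ev.one Ev.zero) (Ev.call (Ev.cons (Ev.fst Ev.var0) (Ev.cons Ev.nil (hT₂ _))) w₁))
    (Ev.call (Ev.cons (Ev.cons (Ev.cons Ev.zero Ev.one) (Ev.call (Ev.cons (Ev.snd Ev.var0)
      (Ev.cons Ev.nil (hT₂ _))) w₂)) Ev.nil) i₂)) i₁) Ev.nil) Ev.nil)) hl) ?_
  obtain ⟨M, hM⟩ : ∃ M, 13 * (200 * (B + 30)) + T₁ + 2 * T₂ + 1100 + 200 * B + 20 = M := ⟨_, rfl⟩
  rw [hM]
  have g₀ : M * 2 ≤ M * h := Nat.mul_le_mul_left _ hh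
  have g₁ : (400 + 200 * B) * ψ₁.size r ≤ M * ψ₁.size r := Nat.mul_le_mul_right _ (by omega)
  have g₂ : (400 + 200 * B) * ψ₂.size r ≤ M * ψ₂.size r := Nat.mul_le_mul_right _ (by omega)
  have g₃ : (13 * (200 * (B + 30)) + 20) * h ≤ M * h := Nat.mul_le_mul_right _ (by omega)
  have g₄ : X ^ 13 = 2 ^ (13 * (200 * (B + 30)) * h) := by rw [← hXdef, ← pow_mul]; congr 1; ring
  have g₅ : X ^ 3 ≤ X ^ 13 := Nat.pow_le_pow_right (by have := hX.card; omega) (by omega)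
  obtain ⟨N, hN⟩ : ∃ N, M * (ψ₁.size r + ψ₂.size r + h) = N + 10 := by
    refine ⟨M * (ψ₁.size r + ψ₂.size r + h) - 10, ?_⟩
    rw [mul_add, mul_add]
    omega
  rw [hN, pow_add 2 N 10]
  rw [mul_add, mul_add] at hN
  rw [add_mul] at g₃
  have p : ∀ k, k ≤ N → 2 ^ k ≤ 2 ^ N := fun k hk => Nat.pow_le_pow_right (by omega) hk
  have p₁ := p (13 * (200 * (B + 30)) * h) (by omega)
  have p₂ := p k₁ (by rw [← hk₁]; omega)
  have p₃ := p k₂ (by rw [← hk₂]; omega)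
  have p₄ := p T₁ (by omega)
  have p₅ := p T₂ (by omega)
  have p₆ := p 6 (by omega)
  have p₇ : T₁ < 2 ^ T₁ := Nat.lt_two_pow_self
  have p₈ : T₂ < 2 ^ T₂ := Nat.lt_two_pow_self
  rw [← g₄] at p₁
  linarith

end Main

end WFOEIL

open WFOEIL in
theorem mainTheorem2 {D : Type v} [DivisionRing D] {K : Type u} [CommSemiring K]
    (ι : K →+* D) (hι : Function.Injective ι)
    {n : ℕ} (wB : Fin n → WeightedComponent K) (r : Fin n → ℕ) :
    DecidableInDoublyExpTime
      (fun x : Sentence (ports wB) K × Sentence (ports wB) K => Val.cons x.1.1.code x.2.1.code)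
      (fun x => x.1.1.size r + x.2.1.size r)
      (fun x => Sentence.Equivalent r x.1 x.2) := by
  -- Formal differences of elements of `K` are interpreted in the subring generated by the image of `K`:
  -- it is commutative, and a domain as a subring of a skew field.
  have hcomm : ∀ a ∈ Set.range ι, ∀ b ∈ Set.range ι, a * b = b * a := by
    rintro _ ⟨a, rfl⟩ _ ⟨b, rfl⟩
    rw [← map_mul, ← map_mul, mul_comm]
  have hc := Subring.isMulCommutative_closure hcomm
  let : CommRing (Subring.closure (Set.range ι)) :=
    { (inferInstance : Ring (Subring.closure (Set.range ι))) with mul_comm := hc.is_comm.comm }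
  have : IsDomain (Subring.closure (Set.range ι)) := inferInstance
  let κ : K →+* Subring.closure (Set.range ι) :=
    ι.codRestrict _ fun k => Subring.subset_closure ⟨k, rfl⟩
  have hκ : Function.Injective κ := fun a b h => hι (congrArg Subtype.val h)
  obtain ⟨B, hB⟩ := exists_isBound K (ports wB) r
  obtain ⟨M, hM⟩ := exists_eval_mainExpr (L := Subring.closure (Set.range ι)) (ι := κ) hκ hB
  -- The polynomial bounds the logarithm of `M * (s + h)`, where `s` is the total size and
  -- `h = 2 ^ (4 * growth + 1)` bounds both `hgt` and the logarithm of `cnt` for the two instances.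
  refine ⟨⟨Prog.bodies, mainExpr K (ports wB) r⟩, .C M + .X +
    4 * (.C ((letters (ports wB) r).length + 4) * .X) ^ (5 * B + 2) + 1, fun x => ?_⟩
  obtain ⟨s, hs⟩ : ∃ s, x.1.1.size r + x.2.1.size r = s := ⟨_, rfl⟩
  obtain ⟨G, hG⟩ : ∃ G, growth (letters (ports wB) r).length B s = G := ⟨_, rfl⟩
  have h1 := growth_mono (letters (ports wB) r).length B (show x.1.1.size r ≤ s by omega)
  have h2 := growth_mono (letters (ports wB) r).length B (show x.2.1.size r ≤ s by omega)
  rw [hG] at h1 h2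
  have hp : ∀ k, k ≤ G → 2 ^ (4 * k) ≤ 2 ^ (4 * G + 1) := fun k hk =>
    Nat.pow_le_pow_right (by omega) (by omega)
  obtain ⟨t, ht, H⟩ := hM x.1.1 x.2.1 (2 ^ (4 * G + 1))
    (by rw [pow_succ]; have := Nat.one_le_two_pow (n := 4 * G); omega)
    ((WFormula.hgt_inst_le _ hB.inst _ _).trans (hp _ h1))
    ((WFormula.hgt_inst_le _ hB.inst _ _).trans (hp _ h2))
    ((WFormula.cnt_inst_le _ hB.inst _ _).trans (Nat.pow_le_pow_right (by omega) (hp _ h1)))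
    ((WFormula.cnt_inst_le _ hB.inst _ _).trans (Nat.pow_le_pow_right (by omega) (hp _ h2)))
  refine ⟨t, ?_, H⟩
  beta_reduce
  rw [hs] at ht ⊢
  refine (Nat.le_of_succ_le ht).trans (Nat.pow_le_pow_right (by omega) ?_)
  have h6 : 2 ^ (M + s + (4 * G + 1)) = 2 ^ M * (2 ^ s * 2 ^ (4 * G + 1)) := by
    rw [pow_add, pow_add, mul_assoc]
  simp only [Polynomial.eval_add, Polynomial.eval_mul, Polynomial.eval_pow, Polynomial.eval_C,
    Polynomial.eval_X, Polynomial.eval_ofNat, Polynomial.eval_one]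
  rw [add_assoc (M + s)]
  change _ ≤ 2 ^ (M + s + (4 * growth (letters (ports wB) r).length B s + 1))
  rw [hG, h6]
  have h3 : M < 2 ^ M := Nat.lt_two_pow_self
  have h4 : s < 2 ^ s := Nat.lt_two_pow_self
  have h5 : 1 ≤ 2 ^ (4 * G + 1) := Nat.one_le_two_pow
  refine Nat.mul_le_mul h3.le ?_
  nlinarith
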